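/- Let $N$ be a square-free positive integer, $N=N_0N_1N_2$ with positive integers $N_i$, $\rho=(N_0,N_1,N_2)$, and let $k\ge 4$ be an integer. Let $\chi$ be a Dirichlet character modulo $N$, written as $\chi=\chi_{N_0}\chi_{N_1}\chi_{N_2}$ with $\chi_{N_i}$ a character modulo $N_i$, and assume $\chi_{N_1}^2=1$; put $\chi_{N_0N_2}=\chi_{N_0}\chi_{N_2}$. Let $\Gamma_0(N)$ be the group of all $\gamma=\begin{pmatrix}A_\gamma&B_\gamma\\C_\gamma&D_\gamma\end{pmatrix}\in Sp_2(\mathbb Z)$ ($4\times4$ integral symplectic matrices in $2\times 2$ blocks) with $C_\gamma\equiv0\pmod N$, and let $\mathfrak H_{(2)}$ be the set of symmetric complex $2\times2$ matrices with positive definite imaginary part. Let $M_\rho$ be an integral diagonal $2\times 2$ matrix which, modulo each prime $q\mid N$, is congruent to $0$ if $q\mid N_0$, to $\begin{pmatrix}1&0\\0&0\end{pmatrix}$ if $q\mid N_1$, and to $I$ if $q\mid N_2$. For $\tau\in\mathfrak H_{(2)}$ set $$\mathbb E_\rho(\tau)=\tfrac12\sum_{\gamma}\overline\chi(\det D_\gamma)\,\det(M\tau+M')^{-k},\qquad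 (M\ M')=(M_\rho\ I)\gamma,$$ where $\gamma\in\Gamma_0(N)$ runs over a set of matrices for which $SL_2(\mathbb Z)(M_\rho\ I)\gamma$ runs exactly once through the $\Gamma_0(N)$-orbit of $SL_2(\mathbb Z)(M_\rho\ I)$. For a prime $p$ let $\delta=\begin{pmatrix}pI&0\\0&I\end{pmatrix}$ and $$f|T(p)=p^{k-3}\sum_\gamma\overline\chi(\det D_\gamma)\,f|\delta^{-1}\gamma,$$ where $\gamma$ runs over a set of representatives for $(\delta\Gamma_0(N)\delta^{-1}\cap\Gamma_0(N))\backslash\Gamma_0(N)$ and $(f|g)(\tau)=(\det g)^{k/2}\det(C\tau+D)^{-k}f((A\tau+B)(C\tau+D)^{-1})$ for $g=\begin{pmatrix}A&B\\C&D\end{pmatrix}$. Then, for any choice of $M_\rho$ and of the representatives, the series $\mathbb E_\rho$ converges absolutely on $\mathfrak H_{(2)}$; if $\chi(-1)=(-1)^k$, then $\mathbb E_\rho(\tau)$ is also the sum of the same terms, without the factor $\frac12$, over $\gamma\in\Gamma_0(N)$ for which $GL_2(\mathbb Z)(M_\rho\ I)\gamma$ runs exactly once through the $\Gamma_0(N)$-orbit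 of $GL_2(\mathbb Z)(M_\rho\ I)$; and for every prime $p\nmid N$, on $\mathfrak H_{(2)}$, $$\mathbb E_\rho|T(p)=\Big(\chi_{N_0}(p^2)\chi_{N_1}(p)p^{2k-3}+\chi_{N_0N_2}(p)p^{k-2}(p+1)+\chi_{N_1}(p)\chi_{N_2}(p^2)\Big)\mathbb E_\rho .$$ -/

import Mathlib

noncomputable section

namespace SiegelEis

/-- Block matrices of size `2 + 2`. -/
abbrev Mat4 (R : Type) : Type := Matrix (Fin 2 ⊕ Fin 2) (Fin 2 ⊕ Fin 2) R

/-- The group of `4 × 4` integral symplectic matrices. -/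
abbrev Sp2Z : Type := Matrix.symplecticGroup (Fin 2) ℤ

/-- The block `D` of `γ = (A B; C D)`. -/
def blockD (γ : Sp2Z) : Matrix (Fin 2) (Fin 2) ℤ := (γ : Mat4 ℤ).toBlocks₂₂

/-- The block `C` of `γ = (A B; C D)`. -/
def blockC (γ : Sp2Z) : Matrix (Fin 2) (Fin 2) ℤ := (γ : Mat4 ℤ).toBlocks₂₁

/-- An integral symplectic matrix, viewed as a real matrix. -/
def toReal (γ : Sp2Z) : Mat4 ℝ := (γ : Mat4 ℤ).map (Int.cast : ℤ → ℝ)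

/-- `Γ_∞`: the matrices `(* *; 0 *)` in `Sp_2(ℤ)`. -/
def GammaInf : Set Sp2Z := {γ | blockC γ = 0}

/-- `Γ_∞⁺`: the matrices `(* *; 0 D)` in `Sp_2(ℤ)` with `D ∈ SL_2(ℤ)`.
The cosets `Γ_∞⁺ γ` correspond to the `SL_2(ℤ)`-classes of the pairs `(M N)` of lower blocks,
as the cosets `Γ_∞ γ` correspond to their `GL_2(ℤ)`-classes. -/
def GammaInfPlus : Set Sp2Z := {γ | blockC γ = 0 ∧ (blockD γ).det = 1}

/-- `Γ_0(N)`: the matrices in `Sp_2(ℤ)` that are congruent to `(* *; 0 *)` modulo `N`. -/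
def Gamma0 (N : ℕ) : Set Sp2Z := {γ | ∀ i j, (N : ℤ) ∣ blockC γ i j}

/-- The Siegel upper half space of degree 2. -/
def upperHalf : Set (Matrix (Fin 2) (Fin 2) ℂ) :=
  {τ | τ.IsSymm ∧ (τ.map Complex.im).PosDef}

/-- The weight `k` slash operator
`(f | g)(τ) = (det g)^(k/2) det(Cτ + D)^(-k) f((Aτ + B)(Cτ + D)⁻¹)`, `g = (A B; C D)`. -/
def slash (k : ℕ) (g : Mat4 ℝ) (f : Matrix (Fin 2) (Fin 2) ℂ → ℂ)
    (τ : Matrix (Fin 2) (Fin 2) ℂ) : ℂ :=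
  let A : Matrix (Fin 2) (Fin 2) ℂ := g.toBlocks₁₁.map (fun x : ℝ => (x : ℂ))
  let B : Matrix (Fin 2) (Fin 2) ℂ := g.toBlocks₁₂.map (fun x : ℝ => (x : ℂ))
  let C : Matrix (Fin 2) (Fin 2) ℂ := g.toBlocks₂₁.map (fun x : ℝ => (x : ℂ))
  let D : Matrix (Fin 2) (Fin 2) ℂ := g.toBlocks₂₂.map (fun x : ℝ => (x : ℂ))
  ((g.det ^ ((k : ℝ) / 2) : ℝ) : ℂ) * (C * τ + D).det ^ (-(k : ℤ)) *
    f ((A * τ + B) * (C * τ + D)⁻¹)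

/-- `δ = diag(p I_2, I_2)`. -/
def delta (p : ℕ) : Mat4 ℝ :=
  Matrix.fromBlocks ((p : ℝ) • (1 : Matrix (Fin 2) (Fin 2) ℝ)) 0 0 1

/-- `S` is a set of coset representatives for `(δ Γ_0(N) δ⁻¹ ∩ Γ_0(N)) \ Γ_0(N)`. -/
def IsHeckeReps (N p : ℕ) (S : Set Sp2Z) : Prop :=
  S ⊆ Gamma0 N ∧ ∀ g ∈ Gamma0 N, ∃! s, s ∈ S ∧
    ∃ β ∈ Gamma0 N, toReal g = delta p * toReal β * (delta p)⁻¹ * toReal s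

/-- The Hecke operator `T(p)` in weight `k`, level `N` and character `χ`, computed with the set
`S` of coset representatives:
`f | T(p) = p^(k-3) ∑_{γ ∈ S} conj (χ (det D_γ)) f | δ⁻¹ γ`. -/
def heckeT (N : ℕ) (χ : DirichletCharacter ℂ N) (k p : ℕ) (S : Set Sp2Z)
    (f : Matrix (Fin 2) (Fin 2) ℂ → ℂ) (τ : Matrix (Fin 2) (Fin 2) ℂ) : ℂ :=
  (p : ℂ) ^ ((k : ℤ) - 3) * ∑ᶠ γ ∈ S,
    (starRingEnd ℂ) (χ (((blockD γ).det : ℤ) : ZMod N)) *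
      slash k ((delta p)⁻¹ * toReal γ) f τ

/-- With `P` a subgroup of `Sp_2(ℤ)`, the matrices `γ ∈ R` lie in `Γ_0(N)`, and `P γ₀ γ` runs
exactly once through the `Γ_0(N)`-orbit of the coset `P γ₀` as `γ` runs through `R`. -/
def IsOrbitReps (P : Set Sp2Z) (N : ℕ) (γ₀ : Sp2Z) (R : Set Sp2Z) : Prop :=
  R ⊆ Gamma0 N ∧ ∀ g ∈ Gamma0 N, ∃! s, s ∈ R ∧ ∃ κ ∈ P, γ₀ * g = κ * (γ₀ * s)

/-- The summand `conj (χ (det D_γ)) (1 | γ₀ γ)(τ) = conj (χ (det D_γ)) det(M τ + N)^(-k)`, where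
`γ₀ γ = (* *; M N)`. -/
def eisTerm (N : ℕ) (χ : DirichletCharacter ℂ N) (k : ℕ) (γ₀ : Sp2Z)
    (τ : Matrix (Fin 2) (Fin 2) ℂ) (γ : Sp2Z) : ℂ :=
  (starRingEnd ℂ) (χ (((blockD γ).det : ℤ) : ZMod N)) *
    ((blockC (γ₀ * γ)).map (Int.cast : ℤ → ℂ) * τ +
      (blockD (γ₀ * γ)).map (Int.cast : ℤ → ℂ)).det ^ (-(k : ℤ))

/-- `∑ conj (χ (det D_γ)) (1 | γ₀ γ)(τ)` over `γ ∈ R`. -/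
def eisSum (N : ℕ) (χ : DirichletCharacter ℂ N) (k : ℕ) (γ₀ : Sp2Z) (R : Set Sp2Z)
    (τ : Matrix (Fin 2) (Fin 2) ℂ) : ℂ :=
  ∑' γ : R, eisTerm N χ k γ₀ τ γ

/-- The Eisenstein series `E_{γ₀}`, where `2 E_{γ₀}` is a sum over a set `R` of representatives
of `SL_2(ℤ)`-classes of pairs, that is, `IsOrbitReps GammaInfPlus N γ₀ R`. -/
def eisenstein (N : ℕ) (χ : DirichletCharacter ℂ N) (k : ℕ) (γ₀ : Sp2Z) (R : Set Sp2Z)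
    (τ : Matrix (Fin 2) (Fin 2) ℂ) : ℂ :=
  (1 / 2 : ℂ) * eisSum N χ k γ₀ R τ

/-- The diagonal matrix `M = diag(d 0, d 1)` satisfies the congruences that define `M_ρ` for the
partition `ρ = (N₀, N₁, N₂)`. -/
def IsCuspMatrix (N₀ N₁ N₂ : ℕ) (d : Fin 2 → ℤ) : Prop :=
  ∀ q : ℕ, q.Prime →
    (q ∣ N₀ → (Matrix.diagonal d).map (Int.cast : ℤ → ZMod q) = 0) ∧
    (q ∣ N₁ → (Matrix.diagonal d).map (Int.cast : ℤ → ZMod q) = Matrix.diagonal ![1, 0]) ∧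
    (q ∣ N₂ → (Matrix.diagonal d).map (Int.cast : ℤ → ZMod q) = 1)

/-- The matrix `(I 0; M I)` with `M = diag(d 0, d 1)`. -/
def cuspMatrix (d : Fin 2 → ℤ) : Sp2Z :=
  ⟨Matrix.fromBlocks 1 0 (Matrix.diagonal d) 1, by
    rw [SymplecticGroup.mem_iff, Matrix.J, Matrix.fromBlocks_transpose,
      Matrix.fromBlocks_multiply, Matrix.fromBlocks_multiply]
    simp⟩

end SiegelEis

end

noncomputable section

namespace SiegelEis

open Matrix

/-! Throughout, `M = diag(d 0, d 1)` and `γ₀ = (I 0; M I)`. The series is treated as a sum over all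
cosets `Γ_∞⁺ g` of `Sp_2(ℤ)`: the term is `weight g * det(Cτ + D)^(-k)`, where `weight` is `conj (χ
(det D_γ))` at `g = κ γ₀ γ` and `0` off the orbit. This is well defined because `χ(det D)` is
trivial on the stabilizer of the cusp (`char_detD_eq_one`); modulo `N₁` only a square is left, which
is where `χ₁² = 1` enters.

Convergence: a coset is determined by five minors of `(C D)`, which form a nonzero integral point of
a quadric, and on that quadric the minors are bounded by a multiple of `|det(Cτ + D)|`. So it
suffices to sum `‖w‖⁻⁴` over the quadric (`summable_nullCone`). Three coordinates are free and the
other two have a prescribed product, so a divisor bound with exponent `1/4` leaves a sum of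
`‖b‖^(-7/2)` over `ℤ³`.

Each `Γ_∞` coset splits into two `Γ_∞⁺` cosets, exchanged by `diag(1, -1, 1, -1)`. Their terms agree
when `χ(-1) = (-1)^k`, which accounts for the factor `1/2`.

Hecke action: up to scalars, `δ⁻¹ s` is `diag(I, pI) s`. For a coset of `g'` and a representative
`s` there is exactly one upper triangular `T_i = (* *; 0 D_i)` with `T_i g' = g diag(I, pI) s` for a
symplectic `g`. With `s` fixed, `g' ↦ g` permutes the cosets (`bijective_of_heckeRel`); with `g'`
fixed, `s ↦ i` is a bijection from the representatives to the index set
(`IsHeckeReps.bijective_of_heckeRel`). Passing from `g` to `g'` multiplies the term by a constant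
that depends only on the exponent `e` in `det D_i = p^e`: a power of `p` from the automorphy factor
(`autFactor_heckeAct`) and `χ₀(p^(2-e)) χ₁(p^(1+e)) χ₂(p^e)` from the weight
(`weight_mul_conj_char`). There are `1`, `p(p+1)`, `p³` indices with `e = 0, 1, 2`; interchanging
the two sums gives the eigenvalue. -/

/-- `2 × 2` matrices. -/
abbrev Mat2 (R : Type) : Type := Matrix (Fin 2) (Fin 2) R

/-! ### Block calculus in `Sp_2(ℤ)` -/

/-- The block `A` of `γ = (A B; C D)`. -/
def blockA (γ : Sp2Z) : Mat2 ℤ := (γ : Mat4 ℤ).toBlocks₁₁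

/-- The block `B` of `γ = (A B; C D)`. -/
def blockB (γ : Sp2Z) : Mat2 ℤ := (γ : Mat4 ℤ).toBlocks₁₂

theorem coe_eq_fromBlocks (γ : Sp2Z) :
    (γ : Mat4 ℤ) = fromBlocks (blockA γ) (blockB γ) (blockC γ) (blockD γ) :=
  (fromBlocks_toBlocks _).symm

theorem ext_blocks {g h : Sp2Z} (hA : blockA g = blockA h) (hB : blockB g = blockB h)
    (hC : blockC g = blockC h) (hD : blockD g = blockD h) : g = h := by
  apply Subtype.ext
  rw [coe_eq_fromBlocks, coe_eq_fromBlocks, hA, hB, hC, hD]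

theorem coe_mul_eq (g h : Sp2Z) : ((g * h : Sp2Z) : Mat4 ℤ) =
    fromBlocks (blockA g * blockA h + blockB g * blockC h)
      (blockA g * blockB h + blockB g * blockD h)
      (blockC g * blockA h + blockD g * blockC h)
      (blockC g * blockB h + blockD g * blockD h) := by
  rw [Submonoid.coe_mul, coe_eq_fromBlocks g, coe_eq_fromBlocks h, fromBlocks_multiply]

theorem blockA_mul (g h : Sp2Z) :
    blockA (g * h) = blockA g * blockA h + blockB g * blockC h := by
  rw [blockA, coe_mul_eq, toBlocks_fromBlocks₁₁]

theorem blockB_mul (g h : Sp2Z) :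
    blockB (g * h) = blockA g * blockB h + blockB g * blockD h := by
  rw [blockB, coe_mul_eq, toBlocks_fromBlocks₁₂]

theorem blockC_mul (g h : Sp2Z) :
    blockC (g * h) = blockC g * blockA h + blockD g * blockC h := by
  rw [blockC, coe_mul_eq, toBlocks_fromBlocks₂₁]

theorem blockD_mul (g h : Sp2Z) :
    blockD (g * h) = blockC g * blockB h + blockD g * blockD h := by
  rw [blockD, coe_mul_eq, toBlocks_fromBlocks₂₂]

theorem coe_inv_eq (g : Sp2Z) : ((g⁻¹ : Sp2Z) : Mat4 ℤ) =
    fromBlocks (blockD g)ᵀ (-(blockB g)ᵀ) (-(blockC g)ᵀ) (blockA g)ᵀ := by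
  rw [SymplecticGroup.coe_inv, coe_eq_fromBlocks g, Matrix.J, fromBlocks_transpose,
    fromBlocks_neg, fromBlocks_multiply, fromBlocks_multiply]
  simp

@[simp] theorem blockA_inv (g : Sp2Z) : blockA g⁻¹ = (blockD g)ᵀ := by
  rw [blockA, coe_inv_eq, toBlocks_fromBlocks₁₁]

@[simp] theorem blockB_inv (g : Sp2Z) : blockB g⁻¹ = -(blockB g)ᵀ := by
  rw [blockB, coe_inv_eq, toBlocks_fromBlocks₁₂]

@[simp] theorem blockC_inv (g : Sp2Z) : blockC g⁻¹ = -(blockC g)ᵀ := by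
  rw [blockC, coe_inv_eq, toBlocks_fromBlocks₂₁]

@[simp] theorem blockD_inv (g : Sp2Z) : blockD g⁻¹ = (blockA g)ᵀ := by
  rw [blockD, coe_inv_eq, toBlocks_fromBlocks₂₂]

@[simp] theorem blockA_one : blockA 1 = 1 := by
  rw [blockA, Submonoid.coe_one, ← fromBlocks_one, toBlocks_fromBlocks₁₁]

@[simp] theorem blockB_one : blockB 1 = 0 := by
  rw [blockB, Submonoid.coe_one, ← fromBlocks_one, toBlocks_fromBlocks₁₂]

@[simp] theorem blockC_one : blockC 1 = 0 := by
  rw [blockC, Submonoid.coe_one, ← fromBlocks_one, toBlocks_fromBlocks₂₁]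

@[simp] theorem blockD_one : blockD 1 = 1 := by
  rw [blockD, Submonoid.coe_one, ← fromBlocks_one, toBlocks_fromBlocks₂₂]

theorem transpose_relations (g : Sp2Z) :
    (blockA g)ᵀ * blockC g = (blockC g)ᵀ * blockA g ∧
    (blockB g)ᵀ * blockD g = (blockD g)ᵀ * blockB g ∧
    (blockA g)ᵀ * blockD g - (blockC g)ᵀ * blockB g = 1 :=
  SymplecticGroup.fromBlocks_mem_iff.1 (coe_eq_fromBlocks g ▸ g.2)

theorem relations (g : Sp2Z) :
    blockA g * (blockB g)ᵀ = blockB g * (blockA g)ᵀ ∧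
    blockC g * (blockD g)ᵀ = blockD g * (blockC g)ᵀ ∧
    blockA g * (blockD g)ᵀ - blockB g * (blockC g)ᵀ = 1 := by
  have h := transpose_relations g⁻¹
  simp only [blockA_inv, blockB_inv, blockC_inv, blockD_inv, transpose_transpose, transpose_neg,
    mul_neg, neg_mul, neg_inj, neg_neg] at h
  refine ⟨h.2.1.symm, h.1.symm, ?_⟩
  simpa using congrArg transpose h.2.2

/-- A symplectic matrix from its blocks. -/
def ofBlocks (A B C D : Mat2 ℤ) (h₁ : Aᵀ * C = Cᵀ * A) (h₂ : Bᵀ * D = Dᵀ * B)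
    (h₃ : Aᵀ * D - Cᵀ * B = 1) : Sp2Z :=
  ⟨fromBlocks A B C D, SymplecticGroup.fromBlocks_mem_iff.2 ⟨h₁, h₂, h₃⟩⟩

section ofBlocks
variable {A B C D : Mat2 ℤ} {h₁ : Aᵀ * C = Cᵀ * A} {h₂ : Bᵀ * D = Dᵀ * B}
    {h₃ : Aᵀ * D - Cᵀ * B = 1}

@[simp] theorem blockA_ofBlocks : blockA (ofBlocks A B C D h₁ h₂ h₃) = A :=
  toBlocks_fromBlocks₁₁ ..
@[simp] theorem blockB_ofBlocks : blockB (ofBlocks A B C D h₁ h₂ h₃) = B :=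
  toBlocks_fromBlocks₁₂ ..
@[simp] theorem blockC_ofBlocks : blockC (ofBlocks A B C D h₁ h₂ h₃) = C :=
  toBlocks_fromBlocks₂₁ ..
@[simp] theorem blockD_ofBlocks : blockD (ofBlocks A B C D h₁ h₂ h₃) = D :=
  toBlocks_fromBlocks₂₂ ..

end ofBlocks

/-- The matrix `(I X; 0 I)` with `X` symmetric. -/
def upper (X : Mat2 ℤ) (hX : Xᵀ = X) : Sp2Z :=
  ofBlocks 1 X 0 1 (by simp) (by simp [hX]) (by simp)

/-- The matrix `(I 0; X I)` with `X` symmetric. -/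
def lower (X : Mat2 ℤ) (hX : Xᵀ = X) : Sp2Z :=
  ofBlocks 1 0 X 1 (by simp [hX]) (by simp) (by simp)

/-- The matrix `(U⁻ᵀ 0; 0 U)`, where `U` is invertible and `U' = U⁻¹`. -/
def levi (U U' : Mat2 ℤ) (hU : U' * U = 1) : Sp2Z :=
  ofBlocks U'ᵀ 0 0 U (by simp) (by simp) (by simp [hU])

section blocks
variable {X : Mat2 ℤ} {hX : Xᵀ = X} {U U' : Mat2 ℤ} {hU : U' * U = 1}

@[simp] theorem blockA_upper : blockA (upper X hX) = 1 := blockA_ofBlocks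
@[simp] theorem blockB_upper : blockB (upper X hX) = X := blockB_ofBlocks
@[simp] theorem blockC_upper : blockC (upper X hX) = 0 := blockC_ofBlocks
@[simp] theorem blockD_upper : blockD (upper X hX) = 1 := blockD_ofBlocks
@[simp] theorem blockA_lower : blockA (lower X hX) = 1 := blockA_ofBlocks
@[simp] theorem blockB_lower : blockB (lower X hX) = 0 := blockB_ofBlocks
@[simp] theorem blockC_lower : blockC (lower X hX) = X := blockC_ofBlocks
@[simp] theorem blockD_lower : blockD (lower X hX) = 1 := blockD_ofBlocks
@[simp] theorem blockA_levi : blockA (levi U U' hU) = U'ᵀ := blockA_ofBlocks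
@[simp] theorem blockB_levi : blockB (levi U U' hU) = 0 := blockB_ofBlocks
@[simp] theorem blockC_levi : blockC (levi U U' hU) = 0 := blockC_ofBlocks
@[simp] theorem blockD_levi : blockD (levi U U' hU) = U := blockD_ofBlocks

end blocks

@[simp] theorem blockA_cuspMatrix (d : Fin 2 → ℤ) : blockA (cuspMatrix d) = 1 :=
  toBlocks_fromBlocks₁₁ ..
@[simp] theorem blockB_cuspMatrix (d : Fin 2 → ℤ) : blockB (cuspMatrix d) = 0 :=
  toBlocks_fromBlocks₁₂ ..
@[simp] theorem blockC_cuspMatrix (d : Fin 2 → ℤ) : blockC (cuspMatrix d) = diagonal d :=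
  toBlocks_fromBlocks₂₁ ..
@[simp] theorem blockD_cuspMatrix (d : Fin 2 → ℤ) : blockD (cuspMatrix d) = 1 :=
  toBlocks_fromBlocks₂₂ ..

theorem det_blockA_mul_det_blockD {g : Sp2Z} (h : blockC g = 0) :
    (blockA g).det * (blockD g).det = 1 := by
  have := congrArg det (transpose_relations g).2.2
  simpa [h] using this

/-! ### The cosets of `Γ_∞⁺` and the factor of automorphy -/

/-- `Γ_∞⁺` as a subgroup. -/
def parabolicPlus : Subgroup Sp2Z where
  carrier := GammaInfPlus
  one_mem' := by simp [GammaInfPlus]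
  mul_mem' := by
    rintro a b ⟨ha, ha'⟩ ⟨hb, hb'⟩
    simp [GammaInfPlus, blockC_mul, blockD_mul, ha, hb, ha', hb']
  inv_mem' := by
    rintro a ⟨ha, ha'⟩
    have := det_blockA_mul_det_blockD ha
    rw [ha', mul_one] at this
    simp [GammaInfPlus, ha, this]

/-- `Γ_0(N)` as a subgroup. -/
def congruenceSubgroup (N : ℕ) : Subgroup Sp2Z where
  carrier := Gamma0 N
  one_mem' := by simp [Gamma0]
  mul_mem' := by
    intro a b ha hb i j
    rw [blockC_mul, Matrix.add_apply, Matrix.mul_apply, Matrix.mul_apply]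
    exact dvd_add (Finset.dvd_sum fun k _ => (ha i k).mul_right _)
      (Finset.dvd_sum fun k _ => (hb k j).mul_left _)
  inv_mem' := by
    intro a ha i j
    simpa using ha j i

/-- The cosets `Γ_∞⁺ γ` in `Sp_2(ℤ)`. -/
abbrev Cosets : Type := Quotient (QuotientGroup.rightRel parabolicPlus)

/-- The coset `Γ_∞⁺ g`. -/
def toCoset (g : Sp2Z) : Cosets := Quotient.mk _ g

theorem toCoset_eq_iff {g h : Sp2Z} : toCoset g = toCoset h ↔ h * g⁻¹ ∈ parabolicPlus := by
  rw [toCoset, toCoset, Quotient.eq, QuotientGroup.rightRel_apply]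

theorem toCoset_out (c : Cosets) : toCoset c.out = c := Quotient.out_eq c

theorem out_mul_inv_mem (g : Sp2Z) : (toCoset g).out * g⁻¹ ∈ parabolicPlus :=
  toCoset_eq_iff.1 (toCoset_out _).symm

/-- The factor of automorphy `det(Cτ + D)`. -/
def autFactor (g : Sp2Z) (τ : Mat2 ℂ) : ℂ :=
  ((blockC g).map (Int.cast : ℤ → ℂ) * τ + (blockD g).map (Int.cast : ℤ → ℂ)).det

theorem det_map_intCast {R : Type} [CommRing R] (A : Mat2 ℤ) :
    (A.map (Int.cast : ℤ → R)).det = (A.det : R) := by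
  simp [det_fin_two]

theorem map_mul_intCast {R : Type} [CommRing R] (A B : Mat2 ℤ) :
    (A * B).map (Int.cast : ℤ → R) = A.map (Int.cast : ℤ → R) * B.map (Int.cast : ℤ → R) :=
  Matrix.map_mul (f := Int.castRingHom R)

theorem map_add_intCast {R : Type} [CommRing R] (A B : Mat2 ℤ) :
    (A + B).map (Int.cast : ℤ → R) = A.map (Int.cast : ℤ → R) + B.map (Int.cast : ℤ → R) :=
  Matrix.map_add _ (by simp) _ _

theorem autFactor_mul {u g : Sp2Z} (hu : blockC u = 0) (τ : Mat2 ℂ) :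
    autFactor (u * g) τ = (blockD u).det * autFactor g τ := by
  rw [autFactor, autFactor, blockC_mul, blockD_mul, hu, zero_mul, zero_mul, zero_add, zero_add,
    map_mul_intCast, map_mul_intCast, Matrix.mul_assoc, ← Matrix.mul_add, det_mul,
    det_map_intCast]

theorem autFactor_eq_of_mem {g h : Sp2Z} (hgh : h * g⁻¹ ∈ parabolicPlus) (τ : Mat2 ℂ) :
    autFactor h τ = autFactor g τ := by
  have := autFactor_mul (g := g) hgh.1 τ
  rw [inv_mul_cancel_right, hgh.2] at this
  simpa using this

/-! ### Divisor bound and summation over the integral points of a quadric -/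

/-- The quotient `(a + 1)^4 / 2^a` is largest at `a = 5`, where it equals `40.5`. -/
theorem add_one_pow_four_le (a : ℕ) : (a + 1) ^ 4 ≤ 41 * 2 ^ a := by
  rcases lt_or_ge a 6 with h | h
  · interval_cases a <;> norm_num
  · induction a, h using Nat.le_induction with
    | base => norm_num
    | succ n hn ih =>
      rw [pow_succ 2 n]
      nlinarith [Nat.pow_le_pow_left hn 2, Nat.pow_le_pow_left hn 3, Nat.pow_le_pow_left hn 4,
        mul_le_mul hn (le_refl (n ^ 3)) (by positivity) (by positivity),
        mul_le_mul hn (le_refl (n ^ 2)) (by positivity) (by positivity)]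

/-- The number of divisors of `n` is `O(n^(1/4))`. -/
theorem card_divisors_pow_four_le {n : ℕ} (hn : n ≠ 0) :
    n.divisors.card ^ 4 ≤ 41 ^ 16 * n := by
  have key : ∀ q ∈ n.primeFactors, (n.factorization q + 1) ^ 4 ≤
      (if q < 16 then 41 else 1) * q ^ n.factorization q := by
    intro q hq
    split_ifs with h
    · exact (add_one_pow_four_le _).trans (Nat.mul_le_mul_left _
        (Nat.pow_le_pow_left (Nat.prime_of_mem_primeFactors hq).two_le _))
    -- Primes `q ≥ 16 = 2^4` cost no constant.
    · have : n.factorization q + 1 ≤ 2 ^ n.factorization q := Nat.lt_two_pow_self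
      calc (n.factorization q + 1) ^ 4 ≤ (2 ^ n.factorization q) ^ 4 := Nat.pow_le_pow_left this 4
        _ = 16 ^ n.factorization q := by rw [← pow_mul, mul_comm, pow_mul]; norm_num
        _ ≤ 1 * q ^ n.factorization q := by
          rw [one_mul]; exact Nat.pow_le_pow_left (not_lt.1 h) _
  rw [Nat.card_divisors hn, ← Finset.prod_pow]
  refine (Finset.prod_le_prod' key).trans ?_
  rw [Finset.prod_mul_distrib]
  refine Nat.mul_le_mul ?_ (le_of_eq (Nat.prod_factorization_pow_eq_self hn))
  -- One factor `41` for each prime below `16`; their number is bounded crudely by `16`.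
  rw [← Finset.prod_filter, Finset.prod_const]
  refine Nat.pow_le_pow_right (by norm_num) ?_
  calc _ ≤ (Finset.range 16).card :=
        Finset.card_le_card fun x hx => by simpa using (Finset.mem_filter.1 hx).2
    _ = 16 := by simp

/-- The lattice-sum criterion for `ℤⁿ` in `ℝⁿ` with the sup norm. The origin does no harm, since `0
^ r = 0` for `r ≠ 0`. -/
theorem summable_pi_int_norm_rpow (n : ℕ) {r : ℝ} (hr : r < -n) :
    Summable fun x : Fin n → ℤ => ‖x‖ ^ r := by
  let b := Pi.basisFun ℝ (Fin n)
  let L := Submodule.span ℤ (Set.range b)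
  have hrank : Module.finrank ℤ L = n := by
    rw [ZLattice.rank ℝ]; simp
  have hs := ZLattice.summable_norm_rpow L r (by rw [hrank]; exact hr)
  have hmem (x : Fin n → ℤ) : (fun i => (x i : ℝ)) ∈ L := by
    rw [Module.Basis.mem_span_iff_repr_mem]
    intro i
    exact ⟨x i, by simp [b]⟩
  have hinj : Function.Injective fun x : Fin n → ℤ => (⟨_, hmem x⟩ : L) := by
    intro x y hxy
    funext i
    have := congrFun (congrArg Subtype.val hxy) i
    exact Int.cast_injective (α := ℝ) this
  refine (hs.comp_injective hinj).congr fun x => ?_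
  simp only [Function.comp_apply]
  congr 1

theorem summable_of_fiber_sum_le {α β : Type*} [DecidableEq β] (π : α → β) {f : α → ℝ}
    {g : β → ℝ} (hf : ∀ a, 0 ≤ f a) (hg : Summable g)
    (h : ∀ b, ∀ s : Finset α, (∀ a ∈ s, π a = b) → ∑ a ∈ s, f a ≤ g b) : Summable f := by
  refine summable_of_sum_le (c := ∑' b, g b) hf fun s => ?_
  rw [← Finset.sum_fiberwise_of_maps_to (t := s.image π) (g := π)
    fun a ha => Finset.mem_image_of_mem _ ha]
  refine (Finset.sum_le_sum fun b _ => h b _ fun a ha => (Finset.mem_filter.1 ha).2).trans ?_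
  exact hg.sum_le_tsum _ fun b _ => by simpa using h b ∅ (by simp)

/-- The quadratic cone that contains the vectors of minors of the pairs `(C D)`. -/
def nullCone : Set (Fin 5 → ℤ) := {w | w 0 * w 1 + w 2 ^ 2 + w 3 * w 4 = 0}

theorem norm_comp_le {m n : ℕ} (w : Fin n → ℤ) (e : Fin m → Fin n) : ‖w ∘ e‖ ≤ ‖w‖ :=
  (pi_norm_le_iff_of_nonneg (norm_nonneg _)).2 fun i => norm_le_pi_norm w (e i)

theorem one_le_norm {n : ℕ} {w : Fin n → ℤ} (hw : w ≠ 0) : 1 ≤ ‖w‖ := by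
  obtain ⟨i, hi⟩ := Function.ne_iff.1 hw
  refine le_trans ?_ (norm_le_pi_norm w i)
  rw [Int.norm_eq_abs]
  exact_mod_cast Int.one_le_abs hi

theorem card_pow_four_le_of_dvd {n : ℤ} (hn : n ≠ 0) (t : Finset ℤ) (ht : ∀ a ∈ t, a ∣ n) :
    t.card ^ 4 ≤ 16 * (41 ^ 16 * n.natAbs) := by
  have h1 : t.card ≤ 2 * n.natAbs.divisors.card := by
    have hsub : t ⊆ n.natAbs.divisors.image (fun m : ℕ => (m : ℤ)) ∪
        n.natAbs.divisors.image (fun m : ℕ => -(m : ℤ)) := by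
      intro a ha
      have hd : a.natAbs ∈ n.natAbs.divisors := by
        rw [Nat.mem_divisors]
        exact ⟨Int.natAbs_dvd_natAbs.2 (ht a ha), by simpa using hn⟩
      rw [Finset.mem_union, Finset.mem_image, Finset.mem_image]
      rcases Int.natAbs_eq a with h | h
      · exact Or.inl ⟨_, hd, h.symm⟩
      · exact Or.inr ⟨_, hd, h.symm⟩
    refine (Finset.card_le_card hsub).trans ((Finset.card_union_le _ _).trans ?_)
    rw [two_mul]
    exact add_le_add Finset.card_image_le Finset.card_image_le
  calc t.card ^ 4 ≤ (2 * n.natAbs.divisors.card) ^ 4 := Nat.pow_le_pow_left h1 4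
    _ = 16 * n.natAbs.divisors.card ^ 4 := by ring
    _ ≤ _ := Nat.mul_le_mul_left _ (card_divisors_pow_four_le (by simpa using hn))

/-- Fibre over the three coordinates `b = w ∘ e`. In a fibre the product `w i * w j = -n` is a fixed
nonzero number with `|n| ≤ 2‖b‖²`, so `w i` is a divisor of `n` and determines `w`. Hence a fibre
has `O(‖b‖^(1/2))` points, each contributing at most `‖b‖^(-4)`, and `-4 + 1/2 < -3`. -/
theorem summable_cone_part (i j : Fin 5) (e : Fin 3 → Fin 5)
    (hcover : ∀ l, l = i ∨ l = j ∨ ∃ m, l = e m) :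
    Summable fun w : {w : Fin 5 → ℤ // w i * w j + (w (e 0) ^ 2 + w (e 1) * w (e 2)) = 0 ∧
      w i * w j ≠ 0} => ‖(w : Fin 5 → ℤ)‖ ^ (-4 : ℝ) := by
  have hs := (summable_pi_int_norm_rpow 3 (r := -7 / 2) (by norm_num)).mul_left (4 * 41 ^ 4 : ℝ)
  refine summable_of_fiber_sum_le (fun w => w.1 ∘ e) (fun _ => by positivity) hs fun b s hsb => ?_
  rcases s.eq_empty_or_nonempty with rfl | ⟨w₀, hw₀⟩
  · simp only [Finset.sum_empty]; positivity
  set n : ℤ := b 0 ^ 2 + b 1 * b 2 with hn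
  have hw (w) (hws : w ∈ s) : w.1 i * w.1 j = -n := by
    have h1 := w.2.1
    rw [hn, ← hsb w hws]
    simp only [Function.comp_apply]
    linarith
  have hn0 : n ≠ 0 := fun h => w₀.2.2 (by rw [hw w₀ hw₀, h, neg_zero])
  have hb : b ≠ 0 := by rintro rfl; simp [hn] at hn0
  have hb1 := one_le_norm hb
  -- The constant only has to satisfy `16 * 41^16 * 2 ≤ (4 * 41^4)^4`.
  have hcard : (s.card : ℝ) ≤ 4 * 41 ^ 4 * ‖b‖ ^ (1 / 2 : ℝ) := by
    have hinj : Set.InjOn (fun w : {w : Fin 5 → ℤ //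
        w i * w j + (w (e 0) ^ 2 + w (e 1) * w (e 2)) = 0 ∧ w i * w j ≠ 0} => w.1 i) s := by
      intro w hws w' hws' hww
      dsimp only at hww
      have h3 : w.1 j = w'.1 j := by
        have := (hw w hws).trans (hw w' hws').symm
        rw [hww] at this
        exact mul_left_cancel₀ (left_ne_zero_of_mul w'.2.2) this
      apply Subtype.ext
      funext l
      rcases hcover l with rfl | rfl | ⟨m, rfl⟩
      · exact hww
      · exact h3
      · exact congrFun ((hsb w hws).trans (hsb w' hws').symm) m
    have h4 := card_pow_four_le_of_dvd hn0 (s.image fun w => w.1 i) (by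
      intro a ha
      obtain ⟨w, hws, rfl⟩ := Finset.mem_image.1 ha
      exact (dvd_neg.1 ⟨_, (hw w hws).symm⟩))
    rw [Finset.card_image_of_injOn hinj] at h4
    have hnb : (n.natAbs : ℝ) ≤ 2 * ‖b‖ ^ 2 := by
      rw [Nat.cast_natAbs, Int.cast_abs, hn]
      have hb' (l) : |(b l : ℝ)| ≤ ‖b‖ := by
        simpa [Int.norm_eq_abs] using norm_le_pi_norm b l
      push_cast
      refine (abs_add_le _ _).trans ?_
      rw [abs_pow, abs_mul]
      nlinarith [hb' 0, hb' 1, hb' 2, abs_nonneg (b 0 : ℝ), abs_nonneg (b 1 : ℝ),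
        abs_nonneg (b 2 : ℝ), mul_le_mul (hb' 1) (hb' 2) (abs_nonneg _) (norm_nonneg _),
        pow_le_pow_left₀ (abs_nonneg _) (hb' 0) 2]
    refine le_of_pow_le_pow_left₀ (n := 4) (by norm_num) (by positivity) ?_
    have h5 : (s.card : ℝ) ^ 4 ≤ 16 * (41 ^ 16 * n.natAbs) := by exact_mod_cast h4
    have h6 : (‖b‖ ^ (1 / 2 : ℝ)) ^ 4 = ‖b‖ ^ 2 := by
      rw [← Real.rpow_natCast, ← Real.rpow_mul (norm_nonneg _), ← Real.rpow_natCast]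
      norm_num
    rw [mul_pow, h6]
    nlinarith [sq_nonneg ‖b‖]
  calc ∑ w ∈ s, ‖(w : Fin 5 → ℤ)‖ ^ (-4 : ℝ) ≤ ∑ w ∈ s, ‖b‖ ^ (-4 : ℝ) := by
        refine Finset.sum_le_sum fun w hws => ?_
        refine Real.rpow_le_rpow_of_nonpos (by linarith) ?_ (by norm_num)
        rw [← hsb w hws]
        exact norm_comp_le _ _
    _ = s.card * ‖b‖ ^ (-4 : ℝ) := by simp
    _ ≤ 4 * 41 ^ 4 * ‖b‖ ^ (1 / 2 : ℝ) * ‖b‖ ^ (-4 : ℝ) := by gcongr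
    _ = 4 * 41 ^ 4 * ‖b‖ ^ (-7 / 2 : ℝ) := by
        rw [mul_assoc, ← Real.rpow_add (by linarith)]; norm_num

theorem summable_plane (i j : Fin 5) :
    Summable fun w : {w : Fin 5 → ℤ // ∀ l, l ≠ i → l ≠ j → w l = 0} =>
      ‖(w : Fin 5 → ℤ)‖ ^ (-4 : ℝ) := by
  have hs := summable_pi_int_norm_rpow 2 (r := -4) (by norm_num)
  have hinj : Function.Injective
      fun w : {w : Fin 5 → ℤ // ∀ l, l ≠ i → l ≠ j → w l = 0} => w.1 ∘ ![i, j] := by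
    intro w w' h
    apply Subtype.ext
    funext l
    by_cases hi : l = i
    · subst hi; exact congrFun h 0
    by_cases hj : l = j
    · subst hj; exact congrFun h 1
    rw [w.2 l hi hj, w'.2 l hi hj]
  refine (hs.comp_injective hinj).congr fun w => ?_
  simp only [Function.comp_apply]
  congr 1
  refine le_antisymm (norm_comp_le _ _) ?_
  refine (pi_norm_le_iff_of_nonneg (norm_nonneg _)).2 fun l => ?_
  by_cases hi : l = i
  · subst hi; exact norm_le_pi_norm (w.1 ∘ ![l, j]) 0
  by_cases hj : l = j
  · subst hj; exact norm_le_pi_norm (w.1 ∘ ![i, l]) 1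
  rw [w.2 l hi hj, norm_zero]
  exact norm_nonneg _

/-- If `w 0 * w 1` or `w 3 * w 4` is nonzero, the divisor argument applies to that product. If both
vanish, the equation forces `w 2 = 0`, and `w` lies in one of four coordinate planes, where the
exponent `-4 < -2` suffices. -/
theorem summable_nullCone :
    Summable fun w : nullCone => ‖(w : Fin 5 → ℤ)‖ ^ (-4 : ℝ) := by
  have hsub : nullCone ⊆
      {w | w 0 * w 1 + (w 2 ^ 2 + w 3 * w 4) = 0 ∧ w 0 * w 1 ≠ 0} ∪
      ({w | w 3 * w 4 + (w 2 ^ 2 + w 0 * w 1) = 0 ∧ w 3 * w 4 ≠ 0} ∪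
      (({w | ∀ l, l ≠ 0 → l ≠ 3 → w l = 0} ∪ {w | ∀ l, l ≠ 0 → l ≠ 4 → w l = 0}) ∪
      ({w | ∀ l, l ≠ 1 → l ≠ 3 → w l = 0} ∪ {w | ∀ l, l ≠ 1 → l ≠ 4 → w l = 0}))) := by
    intro w hw
    have hw : w 0 * w 1 + w 2 ^ 2 + w 3 * w 4 = 0 := hw
    by_cases h1 : w 0 * w 1 = 0
    · by_cases h2 : w 3 * w 4 = 0
      · have h3 : w 2 = 0 := by
          rw [h1, h2] at hw; simpa using hw
        refine Or.inr (Or.inr ?_)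
        rcases mul_eq_zero.1 h1 with h1 | h1 <;> rcases mul_eq_zero.1 h2 with h2 | h2
        · refine Or.inr (Or.inr fun l hl hl' => ?_)
          fin_cases l <;> simp_all
        · refine Or.inr (Or.inl fun l hl hl' => ?_)
          fin_cases l <;> simp_all
        · refine Or.inl (Or.inr fun l hl hl' => ?_)
          fin_cases l <;> simp_all
        · refine Or.inl (Or.inl fun l hl hl' => ?_)
          fin_cases l <;> simp_all
      · exact Or.inr (Or.inl ⟨by linarith, h2⟩)
    · exact Or.inl ⟨by linarith, h1⟩
  have hA := summable_cone_part 0 1 ![2, 3, 4] (by decide)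
  have hB := summable_cone_part 3 4 ![2, 0, 1] (by decide)
  rw [← Function.comp_def (fun w : Fin 5 → ℤ => ‖w‖ ^ (-4 : ℝ)),
    summable_subtype_iff_indicator]
  have hU {s t : Set (Fin 5 → ℤ)}
      (h1 : Summable (s.indicator fun w : Fin 5 → ℤ => ‖w‖ ^ (-4 : ℝ)))
      (h2 : Summable (t.indicator fun w : Fin 5 → ℤ => ‖w‖ ^ (-4 : ℝ))) :
      Summable ((s ∪ t).indicator fun w : Fin 5 → ℤ => ‖w‖ ^ (-4 : ℝ)) := by
    refine (h1.add h2).of_nonneg_of_le (fun w => Set.indicator_nonneg (fun _ _ => by positivity) _)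
      fun w => ?_
    by_cases hs : w ∈ s <;> by_cases ht : w ∈ t <;> simp [hs, ht]
  have hbig := hU (summable_subtype_iff_indicator.1 hA) (hU (summable_subtype_iff_indicator.1 hB)
    (hU (hU (summable_subtype_iff_indicator.1 (summable_plane 0 3))
      (summable_subtype_iff_indicator.1 (summable_plane 0 4)))
      (hU (summable_subtype_iff_indicator.1 (summable_plane 1 3))
      (summable_subtype_iff_indicator.1 (summable_plane 1 4)))))
  refine hbig.of_nonneg_of_le (fun w => Set.indicator_nonneg (fun _ _ => by positivity) _)
      fun w => ?_
  exact Set.indicator_le_indicator_of_subset hsub (fun _ => by positivity) w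

/-! ### Plücker coordinates of the pairs `(C D)` -/

/-- The `2 × 2` minors of the lower half `(C D)` of a symplectic matrix: `det C`, `det D` and
three of the minors that mix a column of `C` and a column of `D`. -/
def minors (g : Sp2Z) : Fin 5 → ℤ :=
  ![(blockC g).det, (blockD g).det,
    blockC g 0 0 * blockD g 1 0 - blockD g 0 0 * blockC g 1 0,
    blockC g 0 0 * blockD g 1 1 - blockD g 0 1 * blockC g 1 0,
    blockC g 0 1 * blockD g 1 0 - blockD g 0 0 * blockC g 1 1]

/-- The off-diagonal entry of `C Dᵀ = D Cᵀ`. It makes the minor of the two second columns the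
negative of the minor of the two first columns, so five of the six minors suffice. -/
theorem isotropy (g : Sp2Z) : blockC g 0 0 * blockD g 1 0 + blockC g 0 1 * blockD g 1 1 =
    blockD g 0 0 * blockC g 1 0 + blockD g 0 1 * blockC g 1 1 := by
  simpa [Matrix.mul_apply] using congrFun (congrFun (relations g).2.1 0) 1

/-- The Plücker relation among the six minors, with the sixth eliminated by `isotropy`. -/
theorem minors_mem_nullCone (g : Sp2Z) : minors g ∈ nullCone := by
  have h := isotropy g
  simp only [nullCone, Set.mem_ofPred_eq, minors, det_fin_two, cons_val]
  linear_combination (blockC g 0 0 * blockD g 1 0 - blockD g 0 0 * blockC g 1 0) * h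

/-- Cauchy–Binet for the product of `(C D)` with the column `(τ; I)`; symmetry of `τ` merges the two
minors related by `isotropy`. -/
theorem autFactor_eq_minors (g : Sp2Z) {τ : Mat2 ℂ} (hτ : τ.IsSymm) :
    autFactor g τ = minors g 0 * τ.det + minors g 1 - 2 * minors g 2 * τ 0 1 +
      minors g 3 * τ 0 0 - minors g 4 * τ 1 1 := by
  have h : ((blockC g 0 0 * blockD g 1 0 + blockC g 0 1 * blockD g 1 1 : ℤ) : ℂ) =
    (blockD g 0 0 * blockC g 1 0 + blockD g 0 1 * blockC g 1 1 : ℤ) := by rw [isotropy g]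
  have hs : τ 1 0 = τ 0 1 := hτ.apply 0 1
  push_cast at h
  simp only [autFactor, minors, det_fin_two, cons_val, Matrix.add_apply, Matrix.mul_apply,
    Fin.sum_univ_two, Matrix.map_apply, hs]
  push_cast
  linear_combination τ 0 1 * h

/-- The alternating form on the columns. -/
def altForm : Mat2 ℤ := !![0, 1; -1, 0]

theorem transpose_mul_altForm_mul (X Y : Mat2 ℤ) : Xᵀ * altForm * Y =
    !![X 0 0 * Y 1 0 - Y 0 0 * X 1 0, X 0 0 * Y 1 1 - Y 0 1 * X 1 0;
      X 0 1 * Y 1 0 - Y 0 0 * X 1 1, X 0 1 * Y 1 1 - Y 0 1 * X 1 1] := by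
  ext i j
  fin_cases i <;> fin_cases j <;> simp [altForm, Matrix.mul_apply, Fin.sum_univ_two] <;> ring

theorem transpose_mul_altForm_mul_self (X : Mat2 ℤ) :
    Xᵀ * altForm * X = X.det • altForm := by
  rw [transpose_mul_altForm_mul, det_fin_two]
  ext i j
  fin_cases i <;> fin_cases j <;> simp [altForm]

/-- The minors are the values of the alternating form `J` on pairs of columns of `(C D)`. The lower
half of `h g⁻¹` is obtained from that of `h` by the column operations in `g⁻¹`, so its pairings
equal those of `g g⁻¹ = 1`. For that half, `Dᵀ J D = J` gives `det D = 1`, and then `Cᵀ J D = 0`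
gives `C = 0`. -/
theorem mul_inv_mem_of_minors_eq {g h : Sp2Z} (hgh : minors g = minors h) :
    h * g⁻¹ ∈ parabolicPlus := by
  have h0 : (blockC g).det = (blockC h).det := congrFun hgh 0
  have h1 : (blockD g).det = (blockD h).det := congrFun hgh 1
  have h2 := congrFun hgh 2
  have h3 := congrFun hgh 3
  have h4 := congrFun hgh 4
  simp only [minors, cons_val] at h2 h3 h4
  have hCC : (blockC h)ᵀ * altForm * blockC h = (blockC g)ᵀ * altForm * blockC g := by
    rw [transpose_mul_altForm_mul_self, transpose_mul_altForm_mul_self, h0]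
  have hDD : (blockD h)ᵀ * altForm * blockD h = (blockD g)ᵀ * altForm * blockD g := by
    rw [transpose_mul_altForm_mul_self, transpose_mul_altForm_mul_self, h1]
  have hCD : (blockC h)ᵀ * altForm * blockD h = (blockC g)ᵀ * altForm * blockD g := by
    have h5 : blockC g 0 1 * blockD g 1 1 - blockD g 0 1 * blockC g 1 1 =
        blockC h 0 1 * blockD h 1 1 - blockD h 0 1 * blockC h 1 1 := by
      linarith [isotropy g, isotropy h]
    rw [transpose_mul_altForm_mul, transpose_mul_altForm_mul, h2, h3, h4, h5]
  have hDC : (blockD h)ᵀ * altForm * blockC h = (blockD g)ᵀ * altForm * blockC g := by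
    have := congrArg transpose hCD
    have ha : altFormᵀ = -altForm := by
      ext i j; fin_cases i <;> fin_cases j <;> simp [altForm]
    simpa [transpose_mul, ha, ← Matrix.mul_assoc] using this
  have hC (x : Sp2Z) : blockC (x * g⁻¹) =
      blockC x * (blockD g)ᵀ - blockD x * (blockC g)ᵀ := by
    rw [blockC_mul, blockA_inv, blockC_inv, Matrix.mul_neg, ← sub_eq_add_neg]
  have hD (x : Sp2Z) : blockD (x * g⁻¹) =
      blockD x * (blockA g)ᵀ - blockC x * (blockB g)ᵀ := by
    rw [blockD_mul, blockB_inv, blockD_inv, Matrix.mul_neg]; abel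
  have e1 : (blockD (h * g⁻¹))ᵀ * altForm * blockD (h * g⁻¹) =
      (blockD (g * g⁻¹))ᵀ * altForm * blockD (g * g⁻¹) := by
    have key (x : Sp2Z) : (blockD (x * g⁻¹))ᵀ * altForm * blockD (x * g⁻¹) =
        blockA g * ((blockD x)ᵀ * altForm * blockD x) * (blockA g)ᵀ
        - blockA g * ((blockD x)ᵀ * altForm * blockC x) * (blockB g)ᵀ
        - blockB g * ((blockC x)ᵀ * altForm * blockD x) * (blockA g)ᵀ
        + blockB g * ((blockC x)ᵀ * altForm * blockC x) * (blockB g)ᵀ := by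
      rw [hD, transpose_sub, transpose_mul, transpose_mul, transpose_transpose,
        transpose_transpose]
      noncomm_ring
    rw [key, key, hCC, hDD, hCD, hDC]
  have e2 : (blockC (h * g⁻¹))ᵀ * altForm * blockD (h * g⁻¹) =
      (blockC (g * g⁻¹))ᵀ * altForm * blockD (g * g⁻¹) := by
    have key (x : Sp2Z) : (blockC (x * g⁻¹))ᵀ * altForm * blockD (x * g⁻¹) =
        blockD g * ((blockC x)ᵀ * altForm * blockD x) * (blockA g)ᵀ
        - blockD g * ((blockC x)ᵀ * altForm * blockC x) * (blockB g)ᵀ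
        - blockC g * ((blockD x)ᵀ * altForm * blockD x) * (blockA g)ᵀ
        + blockC g * ((blockD x)ᵀ * altForm * blockC x) * (blockB g)ᵀ := by
      rw [hD, hC, transpose_sub, transpose_mul, transpose_mul, transpose_transpose,
        transpose_transpose]
      noncomm_ring
    rw [key, key, hCC, hDD, hCD, hDC]
  have hdet : (blockD (h * g⁻¹)).det = 1 := by
    rw [transpose_mul_altForm_mul_self, transpose_mul_altForm_mul_self] at e1
    simpa [altForm] using congrFun (congrFun e1 0) 1
  refine ⟨?_, hdet⟩
  have e3 : (blockC (h * g⁻¹))ᵀ * (altForm * blockD (h * g⁻¹)) = 0 := by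
    rw [← Matrix.mul_assoc, e2, mul_inv_cancel]; simp
  have hu : IsUnit (altForm * blockD (h * g⁻¹)) := by
    rw [isUnit_iff_isUnit_det, det_mul, hdet]; simp [altForm]
  have := hu.mul_left_eq_zero.1 e3
  simpa using this

theorem det_mul_transpose_sub {R : Type} [CommRing R] (A B C D : Mat2 R) :
    (A * Dᵀ - B * Cᵀ).det = A.det * D.det + B.det * C.det +
      (A 0 0 * B 1 0 - B 0 0 * A 1 0) * (C 0 0 * D 1 0 - D 0 0 * C 1 0) +
      (A 0 0 * B 1 1 - B 0 1 * A 1 0) * (C 0 1 * D 1 0 - D 0 0 * C 1 1) +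
      (A 0 1 * B 1 0 - B 0 0 * A 1 1) * (C 0 0 * D 1 1 - D 0 1 * C 1 0) +
      (A 0 1 * B 1 1 - B 0 1 * A 1 1) * (C 0 1 * D 1 1 - D 0 1 * C 1 1) := by
  simp only [det_fin_two, Matrix.sub_apply, Matrix.mul_apply, Fin.sum_univ_two, transpose_apply]
  ring

/-- By Cauchy–Binet the determinant of `A Dᵀ - B Cᵀ = 1` is a combination of the minors of `(C D)`.
-/
theorem minors_ne_zero (g : Sp2Z) : minors g ≠ 0 := by
  intro h0
  have h := congrArg det (relations g).2.2
  have e0 : (blockC g).det = 0 := congrFun h0 0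
  have e1 : (blockD g).det = 0 := congrFun h0 1
  have e2 := congrFun h0 2
  have e3 := congrFun h0 3
  have e4 := congrFun h0 4
  have hi := isotropy g
  simp only [minors, cons_val, Pi.zero_apply] at e2 e3 e4
  have e5 : blockC g 0 1 * blockD g 1 1 - blockD g 0 1 * blockC g 1 1 = 0 := by linarith
  rw [det_mul_transpose_sub, e0, e1, e2, e3, e4, e5] at h
  simp at h

/-! ### Lower bound for `det(Cτ + D)` and absolute convergence -/

/-- The minors of `(C D)` are bounded by a multiple of `det(Cτ + D)`. -/
theorem exists_forall_abs_le_norm_of_null {τ : Mat2 ℂ} (hτ : τ ∈ upperHalf) :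
    ∃ K : ℝ, 0 < K ∧ ∀ a b z u v : ℝ, a * b + z ^ 2 + u * v = 0 →
      ∀ j, |![a, b, z, u, v] j| ≤
        K * ‖(a * τ.det + b - 2 * z * τ 0 1 + u * τ 0 0 - v * τ 1 1 : ℂ)‖ := by
  obtain ⟨hsymm, hpos⟩ := hτ
  have hs : τ 1 0 = τ 0 1 := hsymm.apply 0 1
  set x₁ := (τ 0 0).re
  set x₂ := (τ 0 1).re
  set x₃ := (τ 1 1).re
  set y₁ := (τ 0 0).im with hy₁
  set y₂ := (τ 0 1).im with hy₂
  set y₃ := (τ 1 1).im with hy₃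
  have y₁pos : 0 < y₁ := by simpa using hpos.diag_pos (i := 0)
  have Δpos : 0 < y₁ * y₃ - y₂ ^ 2 := by
    have := hpos.det_pos
    simp only [det_fin_two, Matrix.map_apply, hs] at this
    rw [← hy₁, ← hy₂, ← hy₃] at this
    linarith
  set Δ := y₁ * y₃ - y₂ ^ 2 with hΔ
  -- The primed variables are the minors after a translation that moves the real part of `τ` to `0`.
  -- The squared absolute value alone is degenerate in the minors; adding a multiple of the quadric
  -- equation `h0` and completing squares makes it positive definite, with `Δ` the determinant of
  -- the imaginary part.
  have key (a b z u v : ℝ) (h0 : a * b + z ^ 2 + u * v = 0) :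
      ∃ z' u' v' b' : ℝ, z' = z + a * x₂ ∧ u' = u + a * x₃ ∧ v' = v - a * x₁ ∧
        b' = a * (x₁ * x₃ - x₂ ^ 2) + b - 2 * z * x₂ + u * x₁ - v * x₃ ∧
        y₁ ^ 2 * ‖(a * τ.det + b - 2 * z * τ 0 1 + u * τ 0 0 - v * τ 1 1 : ℂ)‖ ^ 2 =
          y₁ ^ 2 * (b' ^ 2 + a ^ 2 * Δ ^ 2) + Δ ^ 2 * v' ^ 2 + 2 * Δ * (y₁ * z' + y₂ * v') ^ 2 +
          (y₁ ^ 2 * u' - 2 * y₁ * y₂ * z' - y₂ ^ 2 * v') ^ 2 := by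
    refine ⟨_, _, _, _, rfl, rfl, rfl, rfl, ?_⟩
    rw [Complex.sq_norm, Complex.normSq_apply]
    have hdet : τ.det = τ 0 0 * τ 1 1 - τ 0 1 * τ 0 1 := by rw [det_fin_two, hs]
    have hre : (a * τ.det + b - 2 * z * τ 0 1 + u * τ 0 0 - v * τ 1 1 : ℂ).re =
        a * (x₁ * x₃ - x₂ ^ 2 - Δ) + b - 2 * z * x₂ + u * x₁ - v * x₃ := by
      rw [hdet]; simp; ring
    have him : (a * τ.det + b - 2 * z * τ 0 1 + u * τ 0 0 - v * τ 1 1 : ℂ).im =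
        a * (x₁ * y₃ + x₃ * y₁ - 2 * x₂ * y₂) - 2 * z * y₂ + u * y₁ - v * y₃ := by
      rw [hdet]; simp; ring
    rw [hre, him, hΔ]
    linear_combination (-2 * y₁ ^ 2 * Δ) * h0
  let S := {w : Fin 5 → ℝ // w 0 * w 1 + w 2 ^ 2 + w 3 * w 4 = 0}
  let n : S → ℝ := fun w => ‖(w.1 0 * τ.det + w.1 1 - 2 * w.1 2 * τ 0 1 + w.1 3 * τ 0 0 -
    w.1 4 * τ 1 1 : ℂ)‖
  choose z' u' v' b' hz' hu' hv' hb' hn using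
    fun w : S => key (w.1 0) (w.1 1) (w.1 2) (w.1 3) (w.1 4) w.2
  have of_sq (f : S → ℝ) (c : ℝ) (h : ∀ w, f w ^ 2 ≤ c * n w ^ 2) : f =O[⊤] n := by
    refine Asymptotics.IsBigO.of_pow (n := 2) two_ne_zero
      (Asymptotics.isBigO_top.2 ⟨c, fun w => ?_⟩)
    simpa using h w
  have hn' (w : S) : y₁ ^ 2 * n w ^ 2 = y₁ ^ 2 * Δ ^ 2 * w.1 0 ^ 2 + y₁ ^ 2 * b' w ^ 2 +
      Δ ^ 2 * v' w ^ 2 + 2 * Δ * (y₁ * z' w + y₂ * v' w) ^ 2 +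
      1 * (y₁ ^ 2 * u' w - 2 * y₁ * y₂ * z' w - y₂ ^ 2 * v' w) ^ 2 := by
    linear_combination hn w
  have nonneg (w : S) : 0 ≤ y₁ ^ 2 * Δ ^ 2 * w.1 0 ^ 2 ∧ 0 ≤ y₁ ^ 2 * b' w ^ 2 ∧
      0 ≤ Δ ^ 2 * v' w ^ 2 ∧ 0 ≤ 2 * Δ * (y₁ * z' w + y₂ * v' w) ^ 2 ∧
      0 ≤ 1 * (y₁ ^ 2 * u' w - 2 * y₁ * y₂ * z' w - y₂ ^ 2 * v' w) ^ 2 := by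
    refine ⟨?_, ?_, ?_, ?_, ?_⟩ <;> positivity
  have bound (f : S → ℝ) (c : ℝ) (hc : 0 < c) (h : ∀ w, c * f w ^ 2 ≤ y₁ ^ 2 * n w ^ 2) :
      f =O[⊤] n := by
    refine of_sq f (y₁ ^ 2 / c) fun w => ?_
    rw [div_mul_eq_mul_div, le_div_iff₀ hc, mul_comm]
    exact h w
  -- Each square is bounded by the whole sum. The original coordinates then follow one after
  -- another, since the changes of variables are triangular.
  have Oa : (fun w : S => w.1 0) =O[⊤] n :=
    bound _ (y₁ ^ 2 * Δ ^ 2) (by positivity) fun w => by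
      obtain ⟨h1, h2, h3, h4, h5⟩ := nonneg w; rw [hn']; linarith
  have Ob' : b' =O[⊤] n :=
    bound _ (y₁ ^ 2) (by positivity) fun w => by
      obtain ⟨h1, h2, h3, h4, h5⟩ := nonneg w; rw [hn']; linarith
  have Ov' : v' =O[⊤] n :=
    bound _ (Δ ^ 2) (by positivity) fun w => by
      obtain ⟨h1, h2, h3, h4, h5⟩ := nonneg w; rw [hn']; linarith
  have Oz'' : (fun w => y₁ * z' w + y₂ * v' w) =O[⊤] n :=
    bound _ (2 * Δ) (by positivity) fun w => by
      obtain ⟨h1, h2, h3, h4, h5⟩ := nonneg w; rw [hn']; linarith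
  have Ou'' : (fun w => y₁ ^ 2 * u' w - 2 * y₁ * y₂ * z' w - y₂ ^ 2 * v' w) =O[⊤] n :=
    bound _ 1 one_pos fun w => by
      obtain ⟨h1, h2, h3, h4, h5⟩ := nonneg w; rw [hn']; linarith
  have Oz' : z' =O[⊤] n :=
    ((Oz''.sub (Ov'.const_mul_left y₂)).const_mul_left y₁⁻¹).congr_left fun w => by
      field_simp; ring
  have Ou' : u' =O[⊤] n :=
    (((Ou''.add (Oz'.const_mul_left (2 * y₁ * y₂))).add
      (Ov'.const_mul_left (y₂ ^ 2))).const_mul_left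
      (y₁ ^ 2)⁻¹).congr_left fun w => by
      field_simp; ring
  have Oz : (fun w : S => w.1 2) =O[⊤] n :=
    (Oz'.sub (Oa.const_mul_left x₂)).congr_left fun w => by rw [hz']; ring
  have Ou : (fun w : S => w.1 3) =O[⊤] n :=
    (Ou'.sub (Oa.const_mul_left x₃)).congr_left fun w => by rw [hu']; ring
  have Ov : (fun w : S => w.1 4) =O[⊤] n :=
    (Ov'.add (Oa.const_mul_left x₁)).congr_left fun w => by rw [hv']; ring
  have Ob : (fun w : S => w.1 1) =O[⊤] n :=
    ((((Ob'.sub (Oa.const_mul_left (x₁ * x₃ - x₂ ^ 2))).add (Oz.const_mul_left (2 * x₂))).sub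
      (Ou.const_mul_left x₁)).add (Ov.const_mul_left x₃)).congr_left fun w => by rw [hb']; ring
  have Oall : (fun w : S => w.1) =O[⊤] n := by
    refine Asymptotics.isBigO_pi.2 fun j => ?_
    fin_cases j
    exacts [Oa, Ob, Oz, Ou, Ov]
  obtain ⟨K, hK⟩ := Asymptotics.isBigO_top.1 Oall
  refine ⟨|K| + 1, by positivity, fun a b z u v h0 j => ?_⟩
  have h1 := hK ⟨![a, b, z, u, v], by simpa using h0⟩
  have h2 := (norm_le_pi_norm ![a, b, z, u, v] j).trans h1
  simp only [n, Real.norm_eq_abs, abs_norm, cons_val] at h2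
  refine h2.trans (mul_le_mul_of_nonneg_right ?_ (norm_nonneg _))
  linarith [le_abs_self K]

theorem exists_norm_minors_le {τ : Mat2 ℂ} (hτ : τ ∈ upperHalf) :
    ∃ K : ℝ, 0 < K ∧ ∀ g, ‖minors g‖ ≤ K * ‖autFactor g τ‖ := by
  obtain ⟨K, hK, h⟩ := exists_forall_abs_le_norm_of_null hτ
  refine ⟨K, hK, fun g => (pi_norm_le_iff_of_nonneg (by positivity)).2 fun j => ?_⟩
  have h0 : minors g 0 * minors g 1 + minors g 2 ^ 2 + minors g 3 * minors g 4 = 0 :=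
    minors_mem_nullCone g
  have := h (minors g 0) (minors g 1) (minors g 2) (minors g 3) (minors g 4)
    (by exact_mod_cast h0) j
  rw [autFactor_eq_minors g hτ.1]
  push_cast at this
  rw [Int.norm_eq_abs]
  convert this using 2
  fin_cases j <;> rfl

theorem autFactor_ne_zero (g : Sp2Z) {τ : Mat2 ℂ} (hτ : τ ∈ upperHalf) : autFactor g τ ≠ 0 := by
  obtain ⟨K, hK, h⟩ := exists_norm_minors_le hτ
  intro h0
  have := h g
  rw [h0, norm_zero, mul_zero] at this
  linarith [one_le_norm (minors_ne_zero g)]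

/-- The minors embed the cosets into the quadric. They have norm at least `1`, so the exponent `k`
may be lowered to `4`. -/
theorem summable_norm_autFactor_inv_pow {k : ℕ} (hk : 4 ≤ k) {τ : Mat2 ℂ} (hτ : τ ∈ upperHalf) :
    Summable fun c : Cosets => ‖autFactor c.out τ‖⁻¹ ^ k := by
  obtain ⟨K, hK, h⟩ := exists_norm_minors_le hτ
  have hinj : Function.Injective
      fun c : Cosets => (⟨minors c.out, minors_mem_nullCone _⟩ : nullCone) := by
    intro c c' hc
    rw [← toCoset_out c, ← toCoset_out c', toCoset_eq_iff]
    exact mul_inv_mem_of_minors_eq (congrArg Subtype.val hc)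
  refine ((summable_nullCone.comp_injective hinj).mul_left (K ^ k)).of_nonneg_of_le
    (fun c => by positivity) fun c => ?_
  have h1 := one_le_norm (minors_ne_zero c.out)
  have h2 := h c.out
  have h3 : 0 < ‖autFactor c.out τ‖ := norm_pos_iff.2 (autFactor_ne_zero _ hτ)
  have h4 : ‖autFactor c.out τ‖⁻¹ ≤ K * ‖minors c.out‖⁻¹ := by
    rw [inv_le_iff_one_le_mul₀ h3, mul_comm, ← mul_assoc, ← div_eq_mul_inv,
      le_div_iff₀ (by linarith)]
    linarith
  calc ‖autFactor c.out τ‖⁻¹ ^ k ≤ (K * ‖minors c.out‖⁻¹) ^ k := by gcongr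
    _ = K ^ k * ‖minors c.out‖⁻¹ ^ k := mul_pow _ _ _
    _ ≤ K ^ k * ‖minors c.out‖⁻¹ ^ 4 :=
        mul_le_mul_of_nonneg_left
          (pow_le_pow_of_le_one (by positivity) (inv_le_one_of_one_le₀ h1) hk) (by positivity)
    _ = _ := by
        simp only [Function.comp_apply]
        congr 1
        rw [Real.rpow_neg (by positivity), inv_pow]
        norm_cast

/-! ### Lifting matrices from `ℤ/N` to `ℤ` -/

/-- Take `x = N / gcd(N, a)`. A prime `q ∣ N` that does not divide `a` divides `x`. If `q ∣ a`, then
`q` divides neither `x`, as `N` is squarefree, nor `c`, as `ad - bc ≡ 1`. In both cases `q ∤ a + x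
c`. -/
theorem exists_isCoprime_add_mul {N : ℕ} (hN : Squarefree N) {a b c d : ℤ}
    (h : ((a * d - b * c : ℤ) : ZMod N) = 1) : ∃ x : ℤ, IsCoprime (a + x * c) N := by
  have hN0 : N ≠ 0 := hN.ne_zero
  obtain ⟨x, hx⟩ := Nat.gcd_dvd_left N a.natAbs
  refine ⟨x, ?_⟩
  rw [Int.isCoprime_iff_nat_coprime, Int.natAbs_natCast]
  refine Nat.Coprime.symm (Nat.coprime_of_dvd fun q hq hqN hqa => ?_)
  have hqa₁ : (q : ℤ) ∣ a + x * c := Int.natCast_dvd.2 hqa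
  have h1 : (q : ℤ) ∣ a * d - b * c - 1 := by
    have : ((a * d - b * c - 1 : ℤ) : ZMod N) = 0 := by
      rw [Int.cast_sub, h]; simp
    exact (Int.natCast_dvd_natCast.2 hqN).trans ((ZMod.intCast_zmod_eq_zero_iff_dvd _ _).1 this)
  have hqp : Prime (q : ℤ) := Nat.prime_iff_prime_int.1 hq
  by_cases ha : (q : ℤ) ∣ a
  · have hqg : q ∣ N.gcd a.natAbs := Nat.dvd_gcd hqN (Int.natCast_dvd.1 ha)
    have hqx : ¬ q ∣ x := by
      intro hqx
      have : q * q ∣ N := hx ▸ mul_dvd_mul hqg hqx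
      exact hq.one_lt.ne' (Nat.isUnit_iff.1 (hN q this))
    have hc : (q : ℤ) ∣ c := by
      have := (dvd_add_right ha).1 hqa₁
      exact (hqp.dvd_or_dvd this).resolve_left fun h => hqx (Int.natCast_dvd_natCast.1 h)
    have : (q : ℤ) ∣ 1 := by
      have := dvd_sub (dvd_sub (ha.mul_right d) (hc.mul_left b)) h1
      simpa using this
    exact hqp.not_isUnit (isUnit_of_dvd_one this)
  · have hqx : q ∣ x := by
      refine (hq.dvd_mul.1 (hx ▸ hqN)).resolve_left fun h => ha ?_
      exact Int.natCast_dvd.2 (h.trans (Nat.gcd_dvd_right _ _))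
    exact ha ((dvd_add_left ((Int.natCast_dvd_natCast.2 hqx).mul_right c)).1 hqa₁)

/-- Reduction `SL_2(ℤ) → SL_2(ℤ/N)` is onto. -/
theorem exists_lift_of_det_eq_one {N : ℕ} (hN : Squarefree N) {U : Mat2 (ZMod N)}
    (hU : U.det = 1) : ∃ V : Mat2 ℤ, V.det = 1 ∧ V.map (Int.cast : ℤ → ZMod N) = U := by
  obtain ⟨a, ha⟩ := ZMod.intCast_surjective (U 0 0)
  obtain ⟨b, hb⟩ := ZMod.intCast_surjective (U 0 1)
  obtain ⟨c, hc⟩ := ZMod.intCast_surjective (U 1 0)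
  obtain ⟨d, hd⟩ := ZMod.intCast_surjective (U 1 1)
  have hdet : (a * d - b * c : ZMod N) = 1 := by
    rw [ha, hb, hc, hd, ← det_fin_two, hU]
  obtain ⟨x, e, m, hx⟩ := exists_isCoprime_add_mul hN (a := a) (b := b) (c := c) (d := d)
    (by push_cast; exact hdet)
  have he : (e * (a + x * c) : ZMod N) = 1 := by
    have := congrArg (Int.cast : ℤ → ZMod N) hx
    simpa using this
  -- Row operations modulo `N`: adding `x` times the second row makes the corner a unit with inverse
  -- `e`, `y` then turns the lower left entry into `1`, and `w` turns the corner into `1`. What is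
  -- left is `(1 v; 1 v+1) = (1 0; 1 1)(1 v; 0 1)`; undoing the operations writes the matrix as a
  -- product of elementary ones, which lift.
  let y : ℤ := (1 - c) * e
  let w : ℤ := 1 - (a + x * c)
  let v : ℤ := b + x * d + w * (d + y * (b + x * d))
  refine ⟨!![1, -x; 0, 1] * !![1, 0; -y, 1] * !![1, -w; 0, 1] * !![1, 0; 1, 1] * !![1, v; 0, 1],
    by simp only [det_mul, det_fin_two_of]; ring, ?_⟩
  have hy : (c + y * (a + x * c) : ZMod N) = 1 := by
    simp only [y]; push_cast; linear_combination (1 - c : ZMod N) * he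
  have hdet' : ((a + x * c) * (d + y * (b + x * d)) - (b + x * d) * (c + y * (a + x * c)) :
      ZMod N) = 1 := by linear_combination hdet
  rw [hy] at hdet'
  have hA : (1 - w : ZMod N) = a + x * c := by simp only [w]; push_cast; ring
  have hv : (v : ZMod N) = b + x * d + w * (d + y * (b + x * d)) := by
    simp only [v]; push_cast; ring
  have h10 : (1 - y * (1 - w) : ZMod N) = c := by rw [hA]; linear_combination -hy
  have hv2 : (v + 1 : ZMod N) = d + y * (b + x * d) := by
    rw [hv]; simp only [w]; push_cast; linear_combination -hdet'
  have hv3 : (v - w * (v + 1) : ZMod N) = b + x * d := by rw [hv2, hv]; ring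
  simp only [map_mul_intCast]
  ext i j
  fin_cases i <;> fin_cases j
  · simp [Matrix.mul_apply, Fin.sum_univ_two, ← ha]
    linear_combination hA - x * h10
  · simp [Matrix.mul_apply, Fin.sum_univ_two, ← hb]
    linear_combination hv3 - x * (hv2 - y * hv3)
  · simp [Matrix.mul_apply, Fin.sum_univ_two, ← hc]
    linear_combination h10
  · simp [Matrix.mul_apply, Fin.sum_univ_two, ← hd]
    linear_combination (hv2 - y * hv3)

theorem exists_symm_lift {N : ℕ} {X : Mat2 (ZMod N)} (hX : Xᵀ = X) :
    ∃ Y : Mat2 ℤ, Yᵀ = Y ∧ Y.map (Int.cast : ℤ → ZMod N) = X := by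
  choose f hf using ZMod.intCast_surjective (n := N)
  have h10 : X 1 0 = X 0 1 := congrFun (congrFun hX 0) 1
  refine ⟨!![f (X 0 0), f (X 0 1); f (X 0 1), f (X 1 1)], ?_, ?_⟩
  · ext i j; fin_cases i <;> fin_cases j <;> rfl
  · ext i j; fin_cases i <;> fin_cases j <;> simp [hf, h10]

theorem row_relations {R : Type} [CommRing R] {A B C D : Mat2 R}
    (h : fromBlocks A B C D ∈ symplecticGroup (Fin 2) R) :
    A * Bᵀ = B * Aᵀ ∧ C * Dᵀ = D * Cᵀ ∧ A * Dᵀ - B * Cᵀ = 1 := by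
  have := SymplecticGroup.transpose_mem h
  rw [fromBlocks_transpose, SymplecticGroup.fromBlocks_mem_iff] at this
  simpa using this

theorem exists_symm_of_lower_eq {R : Type} [CommRing R] {A₁ B₁ A₂ B₂ C D : Mat2 R}
    (hg₁ : fromBlocks A₁ B₁ C D ∈ symplecticGroup (Fin 2) R)
    (hg₂ : fromBlocks A₂ B₂ C D ∈ symplecticGroup (Fin 2) R) :
    ∃ X : Mat2 R, Xᵀ = X ∧ A₁ = A₂ + X * C ∧ B₁ = B₂ + X * D := by
  obtain ⟨h₁, -, h₁'⟩ := row_relations hg₁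
  obtain ⟨h₃, h₃'', h₃'⟩ := row_relations hg₂
  obtain ⟨h₂, h₂', h₂''⟩ := SymplecticGroup.fromBlocks_mem_iff.1 hg₂
  -- The upper right block of `g₁ g₂⁻¹`.
  let X := B₁ * A₂ᵀ - A₁ * B₂ᵀ
  have t : Dᵀ * A₂ - B₂ᵀ * C = 1 := by simpa using congrArg transpose h₂''
  have hA : A₁ = A₂ + X * C := by
    have : X * C = B₁ * (A₂ᵀ * C) - A₁ * (B₂ᵀ * C) := by simp only [X]; noncomm_ring
    have t' : B₂ᵀ * C = Dᵀ * A₂ - 1 := by rw [← t]; abel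
    rw [this, h₂, t']
    have e : B₁ * (Cᵀ * A₂) - A₁ * (Dᵀ * A₂ - 1) = A₁ - (A₁ * Dᵀ - B₁ * Cᵀ) * A₂ := by
      noncomm_ring
    rw [e, h₁']; simp
  have hB : B₁ = B₂ + X * D := by
    have : X * D = B₁ * (A₂ᵀ * D) - A₁ * (B₂ᵀ * D) := by simp only [X]; noncomm_ring
    rw [this, h₂', sub_eq_iff_eq_add.1 h₂'']
    have e : B₁ * (1 + Cᵀ * B₂) - A₁ * (Dᵀ * B₂) = B₁ - (A₁ * Dᵀ - B₁ * Cᵀ) * B₂ := by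
      noncomm_ring
    rw [e, h₁']; simp
  refine ⟨X, ?_, hA, hB⟩
  have t3 : D * A₂ᵀ - C * B₂ᵀ = 1 := by simpa using congrArg transpose h₃'
  have e1 : (A₂ + X * C) * (B₂ + X * D)ᵀ - (B₂ + X * D) * (A₂ + X * C)ᵀ = 0 := by
    rw [← hA, ← hB, h₁, sub_self]
  have e2 : (A₂ + X * C) * (B₂ + X * D)ᵀ - (B₂ + X * D) * (A₂ + X * C)ᵀ =
      (A₂ * B₂ᵀ - B₂ * A₂ᵀ) + (A₂ * Dᵀ - B₂ * Cᵀ) * Xᵀ - X * (D * A₂ᵀ - C * B₂ᵀ) +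
      X * (C * Dᵀ - D * Cᵀ) * Xᵀ := by
    simp only [transpose_add, transpose_mul]; noncomm_ring
  rw [e2, h₃, h₃', h₃'', t3] at e1
  simpa [sub_eq_zero] using e1

/-! ### The cusp modulo `N` and the character on its stabilizer -/

/-- The level `N = N₀N₁N₂`, the factorization of the character and the cusp `diag(d 0, d 1)`. -/
structure CuspDatum (N N₀ N₁ N₂ : ℕ) (χ : DirichletCharacter ℂ N) (χ₀ : DirichletCharacter ℂ N₀)
    (χ₁ : DirichletCharacter ℂ N₁) (χ₂ : DirichletCharacter ℂ N₂) (d : Fin 2 → ℤ) : Prop where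
  squarefree : Squarefree N
  mul_eq : N₀ * N₁ * N₂ = N
  char_eq : ∀ a : ℤ, χ (a : ZMod N) = χ₀ (a : ZMod N₀) * χ₁ (a : ZMod N₁) * χ₂ (a : ZMod N₂)
  sq_eq_one : χ₁ ^ 2 = 1
  cusp : IsCuspMatrix N₀ N₁ N₂ d

theorem natCast_dvd_of_forall_prime {n : ℕ} (hn : Squarefree n) {a : ℤ}
    (h : ∀ q : ℕ, q.Prime → q ∣ n → (q : ℤ) ∣ a) : (n : ℤ) ∣ a := by
  rw [Int.natCast_dvd, ← Nat.prod_primeFactors_of_squarefree hn]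
  refine Finset.prod_primes_dvd _ (fun q hq => (Nat.prime_of_mem_primeFactors hq).prime)
    fun q hq => ?_
  exact Int.natCast_dvd.1 (h q (Nat.prime_of_mem_primeFactors hq) (Nat.dvd_of_mem_primeFactors hq))

/-- Reduction of a matrix modulo `N`. -/
def red (N : ℕ) : Mat2 ℤ →+* Mat2 (ZMod N) := (Int.castRingHom (ZMod N)).mapMatrix

theorem red_apply (N : ℕ) (A : Mat2 ℤ) (i j : Fin 2) : red N A i j = (A i j : ZMod N) := rfl

theorem red_transpose (N : ℕ) (A : Mat2 ℤ) : red N Aᵀ = (red N A)ᵀ := rfl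

theorem det_red (N : ℕ) (A : Mat2 ℤ) : (red N A).det = (A.det : ZMod N) := det_map_intCast A

theorem red_mem_symplecticGroup (N : ℕ) (g : Sp2Z) :
    fromBlocks (red N (blockA g)) (red N (blockB g)) (red N (blockC g)) (red N (blockD g)) ∈
      symplecticGroup (Fin 2) (ZMod N) := by
  have := SymplecticGroup.map_mem g.2 (Int.castRingHom (ZMod N))
  rw [coe_eq_fromBlocks, fromBlocks_map] at this
  exact this

theorem congruenceSubgroup_mono {n N : ℕ} (h : n ∣ N) {g : Sp2Z}
    (hg : g ∈ congruenceSubgroup N) : g ∈ congruenceSubgroup n :=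
  fun i j => (Int.natCast_dvd_natCast.2 h).trans (hg i j)

theorem red_blockC_eq_zero_iff {N : ℕ} {g : Sp2Z} :
    red N (blockC g) = 0 ↔ g ∈ congruenceSubgroup N := by
  rw [← Matrix.ext_iff]
  exact forall₂_congr fun i j => ZMod.intCast_zmod_eq_zero_iff_dvd _ _

theorem red_relations {N : ℕ} {g : Sp2Z} (hg : g ∈ congruenceSubgroup N) :
    (red N (blockB g))ᵀ * red N (blockD g) = (red N (blockD g))ᵀ * red N (blockB g) ∧
    (red N (blockA g))ᵀ * red N (blockD g) = 1 ∧
    red N (blockA g) * (red N (blockD g))ᵀ = 1 := by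
  have h := SymplecticGroup.fromBlocks_mem_iff.1 (red_mem_symplecticGroup N g)
  have hr := row_relations (red_mem_symplecticGroup N g)
  rw [red_blockC_eq_zero_iff.2 hg] at h hr
  exact ⟨h.2.1, by simpa using h.2.2, by simpa using hr.2.2⟩

/-- The determinant of the block `D` modulo `N`. -/
def detD (N : ℕ) (g : Sp2Z) : ZMod N := ((blockD g).det : ℤ)

theorem detD_eq (N : ℕ) (g : Sp2Z) : detD N g = (red N (blockD g)).det :=
  (det_red _ _).symm

theorem detD_mul {N : ℕ} {g : Sp2Z} (hg : g ∈ congruenceSubgroup N) (h : Sp2Z) :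
    detD N (g * h) = detD N g * detD N h := by
  rw [detD_eq, detD_eq, detD_eq, blockD_mul, map_add, map_mul, map_mul,
    red_blockC_eq_zero_iff.2 hg, zero_mul, zero_add, det_mul]

theorem isUnit_detD {N : ℕ} {g : Sp2Z} (hg : g ∈ congruenceSubgroup N) : IsUnit (detD N g) := by
  refine IsUnit.of_mul_eq_one (detD N g⁻¹) ?_
  rw [← detD_mul hg, mul_inv_cancel, detD, blockD_one, det_one, Int.cast_one]

theorem conj_char_mul_self {N : ℕ} (χ : DirichletCharacter ℂ N) {a : ZMod N} (ha : IsUnit a) :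
    (starRingEnd ℂ) (χ a) * χ a = 1 := by
  obtain ⟨u, rfl⟩ := ha
  rw [mul_comm, Complex.mul_conj, Complex.normSq_eq_norm_sq, χ.unit_norm_eq_one]
  simp

namespace CuspDatum

variable {N N₀ N₁ N₂ : ℕ} {χ : DirichletCharacter ℂ N} {χ₀ : DirichletCharacter ℂ N₀}
    {χ₁ : DirichletCharacter ℂ N₁} {χ₂ : DirichletCharacter ℂ N₂} {d : Fin 2 → ℤ}

theorem dvd₀ (H : CuspDatum N N₀ N₁ N₂ χ χ₀ χ₁ χ₂ d) : N₀ ∣ N := H.mul_eq ▸ ⟨N₁ * N₂, by ring⟩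
theorem dvd₁ (H : CuspDatum N N₀ N₁ N₂ χ χ₀ χ₁ χ₂ d) : N₁ ∣ N := H.mul_eq ▸ ⟨N₀ * N₂, by ring⟩
theorem dvd₂ (H : CuspDatum N N₀ N₁ N₂ χ χ₀ χ₁ χ₂ d) : N₂ ∣ N := H.mul_eq ▸ ⟨N₀ * N₁, by ring⟩

theorem cusp₀ (H : CuspDatum N N₀ N₁ N₂ χ χ₀ χ₁ χ₂ d) (i : Fin 2) : (d i : ZMod N₀) = 0 := by
  rw [ZMod.intCast_zmod_eq_zero_iff_dvd]
  refine natCast_dvd_of_forall_prime (H.squarefree.squarefree_of_dvd H.dvd₀) fun q hq hqN => ?_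
  have := congrFun (congrFun ((H.cusp q hq).1 hqN) i) i
  rw [← ZMod.intCast_zmod_eq_zero_iff_dvd]
  simpa using this

theorem cusp₁ (H : CuspDatum N N₀ N₁ N₂ χ χ₀ χ₁ χ₂ d)
    : (d 0 : ZMod N₁) = 1 ∧ (d 1 : ZMod N₁) = 0 := by
  have hs := H.squarefree.squarefree_of_dvd H.dvd₁
  constructor
  · rw [← sub_eq_zero]
    have : (N₁ : ℤ) ∣ d 0 - 1 := by
      refine natCast_dvd_of_forall_prime hs fun q hq hqN => ?_
      have := congrFun (congrFun ((H.cusp q hq).2.1 hqN) 0) 0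
      rw [← ZMod.intCast_zmod_eq_zero_iff_dvd]
      simpa [sub_eq_zero] using this
    simpa using (ZMod.intCast_zmod_eq_zero_iff_dvd _ _).2 this
  · rw [ZMod.intCast_zmod_eq_zero_iff_dvd]
    refine natCast_dvd_of_forall_prime hs fun q hq hqN => ?_
    have := congrFun (congrFun ((H.cusp q hq).2.1 hqN) 1) 1
    rw [← ZMod.intCast_zmod_eq_zero_iff_dvd]
    simpa using this

theorem cusp₂ (H : CuspDatum N N₀ N₁ N₂ χ χ₀ χ₁ χ₂ d) (i : Fin 2) : (d i : ZMod N₂) = 1 := by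
  rw [← sub_eq_zero]
  have : (N₂ : ℤ) ∣ d i - 1 := by
    refine natCast_dvd_of_forall_prime (H.squarefree.squarefree_of_dvd H.dvd₂) fun q hq hqN => ?_
    have := congrFun (congrFun ((H.cusp q hq).2.2 hqN) i) i
    rw [← ZMod.intCast_zmod_eq_zero_iff_dvd]
    simpa [sub_eq_zero] using this
  simpa using (ZMod.intCast_zmod_eq_zero_iff_dvd _ _).2 this

theorem ext_zmod (H : CuspDatum N N₀ N₁ N₂ χ χ₀ χ₁ χ₂ d)
    {a b : ZMod N} (h₀ : ZMod.castHom H.dvd₀ (ZMod N₀) a = ZMod.castHom H.dvd₀ _ b)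
    (h₁ : ZMod.castHom H.dvd₁ (ZMod N₁) a = ZMod.castHom H.dvd₁ _ b)
    (h₂ : ZMod.castHom H.dvd₂ (ZMod N₂) a = ZMod.castHom H.dvd₂ _ b) : a = b := by
  obtain ⟨a, rfl⟩ := ZMod.intCast_surjective a
  obtain ⟨b, rfl⟩ := ZMod.intCast_surjective b
  simp only [map_intCast] at h₀ h₁ h₂
  rw [← sub_eq_zero, ← Int.cast_sub, ZMod.intCast_zmod_eq_zero_iff_dvd] at h₀ h₁ h₂ ⊢
  refine natCast_dvd_of_forall_prime H.squarefree fun q hq hqN => ?_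
  rw [← H.mul_eq, hq.dvd_mul, hq.dvd_mul] at hqN
  rcases hqN with (h | h) | h
  · exact (Int.natCast_dvd_natCast.2 h).trans h₀
  · exact (Int.natCast_dvd_natCast.2 h).trans h₁
  · exact (Int.natCast_dvd_natCast.2 h).trans h₂

theorem idempotents (H : CuspDatum N N₀ N₁ N₂ χ χ₀ χ₁ χ₂ d)
    : (d 0 * d 0 : ZMod N) = d 0 ∧ (d 1 * d 1 : ZMod N) = d 1 := by
  constructor <;> apply H.ext_zmod <;>
    simp only [map_mul, map_intCast, H.cusp₀, H.cusp₁, H.cusp₂, mul_one, mul_zero]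

theorem char_apply (H : CuspDatum N N₀ N₁ N₂ χ χ₀ χ₁ χ₂ d)
    (a : ZMod N) : χ a = χ₀ (ZMod.castHom H.dvd₀ (ZMod N₀) a) *
    χ₁ (ZMod.castHom H.dvd₁ (ZMod N₁) a) * χ₂ (ZMod.castHom H.dvd₂ (ZMod N₂) a) := by
  obtain ⟨a, rfl⟩ := ZMod.intCast_surjective a
  simpa using H.char_eq a

theorem char₁_sq (H : CuspDatum N N₀ N₁ N₂ χ χ₀ χ₁ χ₂ d)
    {a : ZMod N₁} (ha : IsUnit a) : χ₁ a * χ₁ a = 1 := by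
  have := congrArg (fun ψ : DirichletCharacter ℂ N₁ => ψ a) H.sq_eq_one
  simpa [pow_two, MulChar.one_apply ha] using this

/-- The stabilizer of the cusp acts trivially. -/
theorem char_detD_eq_one (H : CuspDatum N N₀ N₁ N₂ χ χ₀ χ₁ χ₂ d)
    {κ u : Sp2Z} (hκ : κ ∈ parabolicPlus) (hu : u ∈ congruenceSubgroup N)
    (h : κ * cuspMatrix d = cuspMatrix d * u) : χ (detD N u) = 1 := by
  obtain ⟨hκC, hκD⟩ := hκ
  have hC := congrArg blockC h
  have hD := congrArg blockD h
  rw [blockC_mul, blockC_mul, hκC, blockA_cuspMatrix, blockC_cuspMatrix, blockD_cuspMatrix,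
    zero_mul, zero_add, one_mul] at hC
  rw [blockD_mul, blockD_mul, hκC, blockC_cuspMatrix, blockD_cuspMatrix,
    zero_mul, zero_add, one_mul, mul_one] at hD
  set U := blockD κ
  -- The lower halves give `U M = M A + C` and `U = M B + D`, with `A, B, C, D` the blocks of `u`.
  -- Where `M = 0` this reads `D = U`; where `M = I` and `C = 0` it reads `A = U`, and `Aᵀ D = 1`
  -- gives `det D`.
  have h₀ : ZMod.castHom H.dvd₀ (ZMod N₀) (detD N u) = 1 := by
    have hr : red N₀ (blockD u) = red N₀ U := by
      rw [hD]
      ext i j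
      fin_cases i <;> fin_cases j <;> simp [H.cusp₀, red_apply]
    rw [detD, map_intCast, ← det_red, hr, det_red, hκD, Int.cast_one]
  have h₂ : ZMod.castHom H.dvd₂ (ZMod N₂) (detD N u) = 1 := by
    have hu₂ := congruenceSubgroup_mono H.dvd₂ hu
    have hM : red N₂ (diagonal d) = 1 := by
      ext i j
      fin_cases i <;> fin_cases j <;> simp [H.cusp₂, red_apply]
    have hr : red N₂ (blockA u) = red N₂ U := by
      have := congrArg (red N₂) hC
      rw [map_mul, map_add, map_mul, hM, red_blockC_eq_zero_iff.2 hu₂, mul_one, one_mul,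
        add_zero] at this
      exact this.symm
    have := congrArg det (red_relations hu₂).2.1
    rw [hr, det_mul, det_transpose, det_red, hκD, Int.cast_one, one_mul, det_one,
      det_red] at this
    rwa [detD, map_intCast]
  -- For `M = diag(1, 0)` the determinant of `D` is only known up to a unit square: `a` is the
  -- corner of `A` and of `U`, `U` and `D` have lower left entry `0` and the same entry `U 1 1`, and
  -- `Aᵀ D = 1` gives `a * D 0 0 = 1`.
  have h₁ : (blockA u 0 0 : ZMod N₁) ^ 2 * ZMod.castHom H.dvd₁ (ZMod N₁) (detD N u) = 1 := by
    have hu₁ := congruenceSubgroup_mono H.dvd₁ hu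
    have hCu := red_blockC_eq_zero_iff.2 hu₁
    have e := congrArg (red N₁) hC
    rw [map_add, hCu, add_zero] at e
    have f := congrArg (red N₁) hD
    have e00 := congrFun (congrFun e 0) 0
    have e10 := congrFun (congrFun e 1) 0
    have f10 := congrFun (congrFun f 1) 0
    have f11 := congrFun (congrFun f 1) 1
    simp [H.cusp₁, red_apply] at e00 e10 f10 f11
    have g00 := congrFun (congrFun (red_relations hu₁).2.1 0) 0
    simp [Matrix.mul_apply, Fin.sum_univ_two, red_apply] at g00
    have hdet : (U 0 0 * U 1 1 - U 0 1 * U 1 0 : ZMod N₁) = 1 := by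
      have := congrArg (Int.cast : ℤ → ZMod N₁) hκD
      rw [det_fin_two] at this
      simpa using this
    rw [detD, map_intCast, ← det_red, det_fin_two]
    simp only [red_apply]
    have hD10 : (blockD u 1 0 : ZMod N₁) = 0 := f10.symm.trans e10
    rw [e00, f11, e10, mul_zero, sub_zero] at hdet
    rw [hD10, mul_zero, add_zero] at g00
    rw [hD10]
    linear_combination (blockA u 0 0 * blockD u 1 1 : ZMod N₁) * g00 + hdet
  have hunit : IsUnit (blockA u 0 0 : ZMod N₁) :=
    IsUnit.of_mul_eq_one (blockA u 0 0 * ZMod.castHom H.dvd₁ (ZMod N₁) (detD N u) : ZMod N₁)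
      (by rw [← h₁]; ring)
  have h₁' := congrArg χ₁ h₁
  rw [map_mul, map_pow, map_one, pow_two, H.char₁_sq hunit, one_mul] at h₁'
  rw [H.char_apply, h₀, h₂, h₁']
  simp

/-- A pair `(C D)` that modulo `N` has the form `T (M I) h` with `h = (A B; 0 D)` a symplectic
similitude lies in the orbit of the cusp. -/
theorem exists_eq_mul_cuspMatrix_mul (H : CuspDatum N N₀ N₁ N₂ χ χ₀ χ₁ χ₂ d)
    {g : Sp2Z} {T A B D : Mat2 (ZMod N)} {t' r r' : ZMod N}
    (ht : T.det * t' = 1) (hr : r * r' = 1) (hAD : Aᵀ * D = r • (1 : Mat2 (ZMod N)))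
    (hBD : Bᵀ * D = Dᵀ * B) (hC : red N (blockC g) = T * (red N (diagonal d) * A))
    (hD : red N (blockD g) = T * (red N (diagonal d) * B + D)) :
    ∃ κ ∈ parabolicPlus, ∃ γ ∈ congruenceSubgroup N, g = κ * (cuspMatrix d * γ) ∧
      detD N γ * ((d 0 * r + 1 - d 0) * (d 1 * r * T.det + (1 - d 1) * t')) = D.det := by
  obtain ⟨i0, i1⟩ := H.idempotents
  set M := red N (diagonal d) with hMdef
  have hM : M = diagonal ![(d 0 : ZMod N), (d 1 : ZMod N)] := by
    ext i j; fin_cases i <;> fin_cases j <;> simp [hMdef, red_apply]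
  set t := T.det
  set e₀ : ZMod N := (d 0 : ZMod N)
  set e₁ : ZMod N := (d 1 : ZMod N)
  -- Splits `T = V diag(1, t)` modulo `N` with `V` in `SL_2(ℤ)`.
  obtain ⟨V, hV, hVT⟩ := exists_lift_of_det_eq_one H.squarefree
    (U := T * diagonal ![1, t']) (by rw [det_mul, det_diagonal]; simpa using ht)
  have hVT : red N V = T * diagonal ![1, t'] := hVT
  -- the diagonal part of the similitude, moved across the cusp
  let a : Mat2 (ZMod N) := diagonal ![e₀ * r + 1 - e₀, e₁ * r * t + (1 - e₁) * t']
  let b : Mat2 (ZMod N) := diagonal ![1 - r', t - r' * t']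
  let a' : Mat2 (ZMod N) := diagonal ![e₀ * r' + 1 - e₀, e₁ * r' * t' + (1 - e₁) * t]
  have haT : aᵀ = a := diagonal_transpose _
  have hbT : bᵀ = b := diagonal_transpose _
  have ha'T : a'ᵀ = a' := diagonal_transpose _
  have haa' : a * a' = 1 := by
    ext i j
    fin_cases i <;> fin_cases j <;> simp [a, a']
    · linear_combination (r * r' + 1 - r - r') * i0 + e₀ * hr
    · linear_combination (r * r' * (t * t') + t * t' - r * t ^ 2 - r' * t' ^ 2) * i1 +
        e₁ * (t * t') * hr + ht
  have hab : a' * b = b * a' := by simp [a', b, mul_comm]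
  have hMT : Mᵀ = M := by rw [hM, diagonal_transpose]
  -- Together with `diag(1, t) = M b + a'` this rewrites `T (M I) h` as `V (M I) (A₂ B₂; 0 D₂)` with
  -- `(A₂ B₂; 0 D₂)` symplectic. Both identities are checked entrywise; the first needs that the `d
  -- i` are idempotent modulo `N`.
  have hMa : M * a = r • (diagonal ![1, t] * M) := by
    rw [hM]
    ext i j
    fin_cases i <;> fin_cases j <;> simp [a]
    · linear_combination (r - 1) * i0
    · linear_combination (r * t - t') * i1
  have hMb : M * b + a' = diagonal ![1, t] := by
    rw [hM]
    ext i j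
    fin_cases i <;> fin_cases j <;> simp [a', b] <;> ring
  have hVt : red N V * diagonal ![1, t] = T := by
    rw [hVT, Matrix.mul_assoc, diagonal_mul_diagonal]
    have : (diagonal fun i => ![1, t'] i * ![1, t] i : Mat2 (ZMod N)) = 1 := by
      ext i j
      fin_cases i <;> fin_cases j <;> simp [mul_comm t' t, ht]
    rw [this, mul_one]
  let A₂ := r' • (a * A)
  let B₂ := r' • (a * B) + b * D
  let D₂ := a' * D
  have hAD₂ : A₂ᵀ * D₂ = 1 := by
    simp only [A₂, D₂, transpose_smul, transpose_mul, haT]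
    rw [smul_mul_assoc, Matrix.mul_assoc, ← Matrix.mul_assoc a, haa', one_mul, hAD, smul_smul,
      mul_comm r', hr, one_smul]
  have hBD₂ : B₂ᵀ * D₂ = D₂ᵀ * B₂ := by
    have h1 : B₂ᵀ * D₂ = r' • (Bᵀ * (a * a') * D) + Dᵀ * (b * a') * D := by
      simp only [B₂, D₂, transpose_add, transpose_smul, transpose_mul, haT, hbT]
      rw [add_mul, smul_mul_assoc]; simp only [Matrix.mul_assoc]
    have h2 : D₂ᵀ * B₂ = r' • (Dᵀ * (a' * a) * B) + Dᵀ * (a' * b) * D := by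
      simp only [B₂, D₂, transpose_mul, ha'T]
      rw [mul_add, mul_smul_comm]; simp only [Matrix.mul_assoc]
    rw [h1, h2, haa', mul_eq_one_comm.1 haa', hab, mul_one, mul_one, hBD]
  have hV' : V.adjugate * V = 1 := by rw [adjugate_mul, hV, one_smul]
  have hVr : red N V.adjugate * red N V = 1 := by rw [← map_mul, hV', map_one]
  let l := levi V V.adjugate hV'
  have hC₁ : red N (blockC (l⁻¹ * g)) = M * A₂ := by
    rw [blockC_mul]
    simp only [l, blockC_inv, blockC_levi, blockD_inv, blockA_levi, transpose_zero, neg_zero,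
      zero_mul, zero_add, transpose_transpose, map_mul, hC]
    have h1 : M * A₂ = r' • (M * a * A) := by
      simp only [A₂]
      rw [mul_smul_comm, Matrix.mul_assoc]
    rw [h1, hMa, smul_mul_assoc, smul_smul, mul_comm r', hr, one_smul, ← hVt,
      Matrix.mul_assoc (red N V), ← Matrix.mul_assoc, hVr, one_mul, Matrix.mul_assoc]
  have hD₁ : red N (blockD (l⁻¹ * g)) = M * B₂ + D₂ := by
    rw [blockD_mul]
    simp only [l, blockC_inv, blockC_levi, blockD_inv, blockA_levi, transpose_zero, neg_zero,
      zero_mul, zero_add, transpose_transpose, map_mul, hD]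
    rw [← hVt, Matrix.mul_assoc (red N V), ← Matrix.mul_assoc, hVr, one_mul]
    have h1 : M * B₂ + D₂ = r' • (M * a * B) + (M * b + a') * D := by
      simp only [B₂, D₂]
      rw [mul_add, mul_smul_comm, add_mul]; simp only [Matrix.mul_assoc, add_assoc]
    rw [h1, hMa, hMb, smul_mul_assoc, smul_smul, mul_comm r', hr, one_smul, mul_add,
      Matrix.mul_assoc]
  -- This is `(I 0; M I)(A₂ B₂; 0 D₂)`. It has the same lower half as `l⁻¹ g` modulo `N`, so the two
  -- differ by a unipotent factor `(I X; 0 I)`, which lifts to `ℤ`.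
  have hmem : fromBlocks A₂ B₂ (M * A₂) (M * B₂ + D₂) ∈ symplecticGroup (Fin 2) (ZMod N) := by
    rw [SymplecticGroup.fromBlocks_mem_iff]
    refine ⟨?_, ?_, ?_⟩
    · rw [transpose_mul, hMT, Matrix.mul_assoc]
    · rw [transpose_add (M * B₂), transpose_mul M, hMT, mul_add, add_mul, hBD₂, Matrix.mul_assoc]
    · rw [transpose_mul, hMT, mul_add, hAD₂, Matrix.mul_assoc, add_sub_cancel_left]
  have hmem₁ := red_mem_symplecticGroup N (l⁻¹ * g)
  rw [hC₁, hD₁] at hmem₁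
  obtain ⟨X, hX, hA₁, hB₁⟩ := exists_symm_of_lower_eq hmem₁ hmem
  obtain ⟨Y, hY, hYX⟩ := exists_symm_lift hX
  have hYX : red N Y = X := hYX
  let γ := (cuspMatrix d)⁻¹ * ((upper Y hY)⁻¹ * (l⁻¹ * g))
  have hCγ : red N (blockC γ) = 0 := by
    simp only [γ]
    rw [blockC_mul, blockA_mul (upper Y hY)⁻¹, blockC_mul (upper Y hY)⁻¹]
    simp only [blockA_inv, blockB_inv, blockC_inv, blockD_inv, blockA_upper, blockB_upper,
      blockC_upper, blockD_upper, blockC_cuspMatrix, blockA_cuspMatrix, transpose_one,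
      transpose_zero, neg_zero, zero_mul, one_mul, zero_add, hY, map_add, map_mul, map_neg,
      hC₁, hA₁, hYX, red_transpose]
    rw [← hMdef, hMT]
    noncomm_ring
  have hDγ : red N (blockD γ) = D₂ := by
    simp only [γ]
    rw [blockD_mul, blockB_mul (upper Y hY)⁻¹, blockD_mul (upper Y hY)⁻¹]
    simp only [blockA_inv, blockB_inv, blockC_inv, blockD_inv, blockA_upper, blockB_upper,
      blockC_upper, blockD_upper, blockC_cuspMatrix, blockA_cuspMatrix, transpose_one,
      transpose_zero, neg_zero, zero_mul, one_mul, zero_add, hY, map_add, map_mul, map_neg,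
      hD₁, hB₁, hYX, red_transpose]
    rw [← hMdef, hMT]
    noncomm_ring
  refine ⟨l * upper Y hY, ⟨?_, ?_⟩, γ, red_blockC_eq_zero_iff.1 hCγ, by simp only [γ]; group, ?_⟩
  · simp [l, blockC_mul]
  · simp [l, blockD_mul, hV]
  · have hdet : (e₀ * r + 1 - e₀) * (e₁ * r * t + (1 - e₁) * t') = a.det := by
      simp [a]
    rw [detD_eq, hDγ, det_mul, hdet, mul_right_comm, ← det_mul, mul_eq_one_comm.1 haa', det_one,
      one_mul]

end CuspDatum

/-! ### The weight of a coset and its change under `T(p)` -/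

/-- `g` lies in the orbit `Γ_∞⁺ γ₀ Γ_0(N)` of the cusp. -/
def InOrbit (N : ℕ) (d : Fin 2 → ℤ) (g : Sp2Z) : Prop :=
  ∃ γ ∈ congruenceSubgroup N, ∃ κ ∈ parabolicPlus, g = κ * (cuspMatrix d * γ)

open Classical in
/-- The function on `Sp_2(ℤ)` with value `conj (χ (det D_γ))` at `κ γ₀ γ`, for `κ ∈ Γ_∞⁺` and
`γ ∈ Γ_0(N)`, and with value `0` outside of the orbit. -/
def weight (N : ℕ) (χ : DirichletCharacter ℂ N) (d : Fin 2 → ℤ) (g : Sp2Z) : ℂ :=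
  if h : InOrbit N d g then (starRingEnd ℂ) (χ (detD N h.choose)) else 0

theorem norm_char_le_one {N : ℕ} (χ : DirichletCharacter ℂ N) (a : ZMod N) :
    ‖(starRingEnd ℂ) (χ a)‖ ≤ 1 := by
  rw [RCLike.norm_conj]; exact χ.norm_le_one a

theorem norm_weight_le_one (N : ℕ) (χ : DirichletCharacter ℂ N) (d : Fin 2 → ℤ) (g : Sp2Z) :
    ‖weight N χ d g‖ ≤ 1 := by
  rw [weight]
  split_ifs
  · exact norm_char_le_one _ _
  · simp

theorem inOrbit_mul_iff {N : ℕ} {d : Fin 2 → ℤ} {κ g : Sp2Z} (hκ : κ ∈ parabolicPlus) :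
    InOrbit N d (κ * g) ↔ InOrbit N d g := by
  constructor
  · rintro ⟨γ, hγ, κ', hκ', h⟩
    exact ⟨γ, hγ, κ⁻¹ * κ', mul_mem (inv_mem hκ) hκ', by rw [mul_assoc, ← h, inv_mul_cancel_left]⟩
  · rintro ⟨γ, hγ, κ', hκ', h⟩
    exact ⟨γ, hγ, κ * κ', mul_mem hκ hκ', by rw [mul_assoc, ← h]⟩

theorem red_natCast_smul (N p : ℕ) (A : Mat2 ℤ) :
    red N ((p : ℤ) • A) = (p : ZMod N) • red N A := by
  ext i j
  rw [red_apply, Matrix.smul_apply, Matrix.smul_apply, red_apply]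
  simp

namespace CuspDatum

variable {N N₀ N₁ N₂ : ℕ} {χ : DirichletCharacter ℂ N} {χ₀ : DirichletCharacter ℂ N₀}
    {χ₁ : DirichletCharacter ℂ N₁} {χ₂ : DirichletCharacter ℂ N₂} {d : Fin 2 → ℤ}

/-- Two decompositions `κ γ₀ γ` of one matrix differ by an element of the stabilizer of the cusp, on
which `χ(det D)` is `1`; so the choice made in `weight` is immaterial. -/
theorem weight_mul (H : CuspDatum N N₀ N₁ N₂ χ χ₀ χ₁ χ₂ d)
    {κ γ : Sp2Z} (hκ : κ ∈ parabolicPlus) (hγ : γ ∈ congruenceSubgroup N) :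
    weight N χ d (κ * (cuspMatrix d * γ)) = (starRingEnd ℂ) (χ (detD N γ)) := by
  have h : InOrbit N d (κ * (cuspMatrix d * γ)) := ⟨γ, hγ, κ, hκ, rfl⟩
  rw [weight, dif_pos h]
  obtain ⟨hγ', κ', hκ', e⟩ := h.choose_spec
  set γ' := h.choose
  have h1 : χ (detD N (γ' * γ⁻¹)) = 1 := by
    refine H.char_detD_eq_one (κ := κ'⁻¹ * κ) (mul_mem (inv_mem hκ') hκ)
      (mul_mem hγ' (inv_mem hγ)) ?_
    have : cuspMatrix d * γ' = κ'⁻¹ * κ * (cuspMatrix d * γ) := by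
      rw [mul_assoc, e, inv_mul_cancel_left]
    rw [← mul_assoc, this]; group
  congr 1
  calc χ (detD N γ') = χ (detD N (γ' * γ⁻¹ * γ)) := by rw [inv_mul_cancel_right]
    _ = χ (detD N γ) := by
      rw [detD_mul (mul_mem hγ' (inv_mem hγ)), map_mul, h1, one_mul]

theorem weight_mul_left (H : CuspDatum N N₀ N₁ N₂ χ χ₀ χ₁ χ₂ d)
    {κ g : Sp2Z} (hκ : κ ∈ parabolicPlus) :
    weight N χ d (κ * g) = weight N χ d g := by
  by_cases h : InOrbit N d g
  · obtain ⟨γ, hγ, κ', hκ', rfl⟩ := h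
    rw [H.weight_mul hκ' hγ, ← mul_assoc, H.weight_mul (mul_mem hκ hκ') hγ]
  · rw [weight, weight, dif_neg h, dif_neg (mt (inOrbit_mul_iff hκ).1 h)]

theorem weight_eq_of_mem (H : CuspDatum N N₀ N₁ N₂ χ χ₀ χ₁ χ₂ d)
    {g h : Sp2Z} (hgh : h * g⁻¹ ∈ parabolicPlus) :
    weight N χ d h = weight N χ d g := by
  rw [← H.weight_mul_left (g := g) hgh, inv_mul_cancel_right]

variable {p : ℕ} {g g' s : Sp2Z} {K : Mat2 ℤ}

/-- The lower halves of `κ g' = g diag(I, pI) s` modulo `N`, for `κ = (* *; 0 K)`. -/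
theorem inOrbit_of_inOrbit (H : CuspDatum N N₀ N₁ N₂ χ χ₀ χ₁ χ₂ d)
    {p' : ZMod N} (hp : (p * p' : ZMod N) = 1) {k' : ZMod N}
    (hK : K.det * k' = 1)
    (hs : s ∈ congruenceSubgroup N)
    (hC : K * blockC g' = blockC g * blockA s + (p : ℤ) • (blockD g * blockC s))
    (hD : K * blockD g' = blockC g * blockB s + (p : ℤ) • (blockD g * blockD s))
    (hg : InOrbit N d g) : InOrbit N d g' := by
  obtain ⟨γ, hγ, κ, ⟨hκ, hκ'⟩, rfl⟩ := hg
  obtain ⟨r1, r2, r3⟩ := red_relations hγ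
  obtain ⟨s1, s2, s3⟩ := red_relations hs
  have hCγ := red_blockC_eq_zero_iff.2 hγ
  have hCs := red_blockC_eq_zero_iff.2 hs
  have hC := congrArg (red N) hC
  have hD := congrArg (red N) hD
  rw [blockC_mul, hκ, blockC_mul] at hC hD
  rw [blockD_mul, hκ, blockD_mul] at hD
  simp only [map_add, map_mul, red_natCast_smul, hCs, hCγ, mul_zero, smul_zero, add_zero, zero_mul,
    blockC_cuspMatrix, blockD_cuspMatrix, one_mul, zero_add] at hC hD
  let T : Mat2 (ZMod N) := k' • (red N K).adjugate * red N (blockD κ)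
  have hKT : k' • (red N K).adjugate * red N K = 1 := by
    rw [smul_mul_assoc, adjugate_mul, smul_smul, det_red, mul_comm k', hK, one_smul]
  have hTdet : T.det * K.det = 1 := by
    rw [det_mul, det_red, hκ', Int.cast_one, mul_one, ← det_red, ← det_mul, hKT, det_one]
  have hAD : (red N (blockA γ) * red N (blockA s))ᵀ *
      ((p : ZMod N) • (red N (blockD γ) * red N (blockD s))) = (p : ZMod N) • 1 := by
    rw [transpose_mul, mul_smul_comm, Matrix.mul_assoc, ← Matrix.mul_assoc _ (red N (blockD γ)),
      r2, one_mul, s2]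
  have hBD : (red N (blockA γ) * red N (blockB s) +
      (p : ZMod N) • (red N (blockB γ) * red N (blockD s)))ᵀ *
      ((p : ZMod N) • (red N (blockD γ) * red N (blockD s))) =
      ((p : ZMod N) • (red N (blockD γ) * red N (blockD s)))ᵀ *
        (red N (blockA γ) * red N (blockB s) +
      (p : ZMod N) • (red N (blockB γ) * red N (blockD s))) := by
    have r2' : (red N (blockD γ))ᵀ * red N (blockA γ) = 1 := by
      simpa using congrArg transpose r2
    have e1 : (red N (blockA γ) * red N (blockB s) +
      (p : ZMod N) • (red N (blockB γ) * red N (blockD s)))ᵀ *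
      ((p : ZMod N) • (red N (blockD γ) * red N (blockD s))) =
      (p : ZMod N) • ((red N (blockB s))ᵀ * ((red N (blockA γ))ᵀ * red N (blockD γ)) *
        red N (blockD s)) + (p * p : ZMod N) • ((red N (blockD s))ᵀ *
        ((red N (blockB γ))ᵀ * red N (blockD γ)) * red N (blockD s)) := by
      simp only [transpose_add, transpose_mul, transpose_smul, add_mul, mul_smul_comm,
        smul_mul_assoc, smul_add, smul_smul, Matrix.mul_assoc]
    have e2 : ((p : ZMod N) • (red N (blockD γ) * red N (blockD s)))ᵀ *
      (red N (blockA γ) * red N (blockB s) +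
      (p : ZMod N) • (red N (blockB γ) * red N (blockD s))) =
      (p : ZMod N) • ((red N (blockD s))ᵀ * ((red N (blockD γ))ᵀ * red N (blockA γ)) *
        red N (blockB s)) + (p * p : ZMod N) • ((red N (blockD s))ᵀ *
        ((red N (blockD γ))ᵀ * red N (blockB γ)) * red N (blockD s)) := by
      simp only [transpose_mul, transpose_smul, mul_add, mul_smul_comm,
        smul_mul_assoc, smul_smul, Matrix.mul_assoc]
    rw [e1, e2, r1, r2, r2', mul_one, mul_one, s1]
  have hC' : red N (blockC g') =
      T * (red N (diagonal d) * (red N (blockA γ) * red N (blockA s))) := by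
    calc red N (blockC g') = (k' • (red N K).adjugate) * (red N K * red N (blockC g')) := by
          rw [← Matrix.mul_assoc, hKT, one_mul]
      _ = _ := by rw [hC]; simp only [T, Matrix.mul_assoc]
  have hD' : red N (blockD g') =
      T * (red N (diagonal d) *
        (red N (blockA γ) * red N (blockB s) +
      (p : ZMod N) • (red N (blockB γ) * red N (blockD s))) +
      (p : ZMod N) • (red N (blockD γ) * red N (blockD s))) := by
    calc red N (blockD g') = (k' • (red N K).adjugate) * (red N K * red N (blockD g')) := by
          rw [← Matrix.mul_assoc, hKT, one_mul]
      _ = _ := by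
          rw [hD]
          simp only [T, Matrix.mul_assoc, mul_add, add_mul, mul_smul_comm, smul_add, add_assoc]
  obtain ⟨κ₂, hκ₂, γ₂, hγ₂, e, -⟩ :=
    H.exists_eq_mul_cuspMatrix_mul hTdet hp hAD hBD hC' hD'
  exact ⟨γ₂, hγ₂, κ₂, hκ₂, e⟩

/-- Since `p` is a unit modulo `N`, the relation can be solved for `g` there. If `g' = κ γ₀ γ`, then
`(C D)` of `g` is `T (M I) h` with `det T = p^e` and `h` a similitude of multiplier `p⁻¹`; so `g` is
again in the orbit, and its weight is read off from the determinant formula of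
`exists_eq_mul_cuspMatrix_mul`. -/
theorem weight_mul_conj_char (H : CuspDatum N N₀ N₁ N₂ χ χ₀ χ₁ χ₂ d)
    {e : ℕ} (he : e ≤ 2) {p' : ZMod N} (hp : (p * p' : ZMod N) = 1)
    (hK : K.det = (p : ℤ) ^ e) (hs : s ∈ congruenceSubgroup N)
    (hC : K * blockC g' = blockC g * blockA s + (p : ℤ) • (blockD g * blockC s))
    (hD : K * blockD g' = blockC g * blockB s + (p : ℤ) • (blockD g * blockD s)) :
    weight N χ d g * (starRingEnd ℂ) (χ (detD N s)) =
      χ₀ ((p : ZMod N₀) ^ (2 - e)) * χ₁ ((p : ZMod N₁) ^ (1 + e)) * χ₂ ((p : ZMod N₂) ^ e) *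
        weight N χ d g' := by
  have hK' : (K.det : ZMod N) * p' ^ e = 1 := by
    rw [hK]; push_cast; rw [← mul_pow, hp, one_pow]
  by_cases hg' : InOrbit N d g'
  swap
  · have hg : ¬ InOrbit N d g := fun hg => hg' (H.inOrbit_of_inOrbit hp hK' hs hC hD hg)
    rw [weight, weight, dif_neg hg, dif_neg hg', zero_mul, mul_zero]
  obtain ⟨γ, hγ, κ, hκP, rfl⟩ := hg'
  rw [H.weight_mul hκP hγ]
  obtain ⟨hκ, hκ'⟩ := hκP
  obtain ⟨r1, r2, r3⟩ := red_relations hγ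
  obtain ⟨s1, s2, s3⟩ := red_relations hs
  have s2' : red N (blockD s) * (red N (blockA s))ᵀ = 1 := mul_eq_one_comm.1 s2
  have hCγ := red_blockC_eq_zero_iff.2 hγ
  have hCs := red_blockC_eq_zero_iff.2 hs
  have hC := congrArg (red N) hC
  have hD := congrArg (red N) hD
  rw [blockC_mul, hκ, blockC_mul] at hC
  rw [blockD_mul, hκ, blockD_mul] at hD
  simp only [map_add, map_mul, red_natCast_smul, hCs, hCγ, mul_zero, smul_zero, add_zero, zero_mul,
    blockC_cuspMatrix, blockD_cuspMatrix, one_mul, zero_add] at hC hD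
  let T : Mat2 (ZMod N) := red N K * red N (blockD κ)
  have hTdet : T.det = (p : ZMod N) ^ e := by
    rw [det_mul, det_red, det_red, hκ', hK]; simp
  have hT : T.det * p' ^ e = 1 := by rw [hTdet, ← mul_pow, hp, one_pow]
  set As := red N (blockA s)
  set Bs := red N (blockB s)
  set Ds := red N (blockD s)
  set Aγ := red N (blockA γ)
  set Bγ := red N (blockB γ)
  set Dγ := red N (blockD γ)
  set M := red N (diagonal d)
  have hC' : red N (blockC g) = T * (M * (Aγ * Dsᵀ)) := by
    calc red N (blockC g) = red N (blockC g) * As * Dsᵀ := by rw [Matrix.mul_assoc, s3, mul_one]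
      _ = _ := by rw [← hC]; simp only [T, Matrix.mul_assoc]
  have hD' : red N (blockD g) =
      T * (M * (p' • (Bγ * Asᵀ - Aγ * Dsᵀ * Bs * Asᵀ)) + p' • (Dγ * Asᵀ)) := by
    have e1 : (p : ZMod N) • red N (blockD g) =
        (red N K * (red N (blockD κ) * (M * Bγ + Dγ)) - red N (blockC g) * Bs) * Asᵀ := by
      rw [hD, add_sub_cancel_left, smul_mul_assoc, Matrix.mul_assoc, s2', mul_one]
    calc red N (blockD g) = p' • ((p : ZMod N) • red N (blockD g)) := by
          rw [smul_smul, mul_comm, hp, one_smul]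
      _ = _ := by
          rw [e1, hC']
          simp only [T, Matrix.mul_assoc, mul_add, add_mul, sub_mul, mul_sub, mul_smul_comm,
            smul_add, smul_sub]
          abel
  have hAD : (Aγ * Dsᵀ)ᵀ * (p' • (Dγ * Asᵀ)) = p' • 1 := by
    rw [transpose_mul, transpose_transpose, mul_smul_comm, Matrix.mul_assoc,
      ← Matrix.mul_assoc _ Dγ, r2, one_mul, s2']
  have hBD : (p' • (Bγ * Asᵀ - Aγ * Dsᵀ * Bs * Asᵀ))ᵀ * (p' • (Dγ * Asᵀ)) =
      (p' • (Dγ * Asᵀ))ᵀ * (p' • (Bγ * Asᵀ - Aγ * Dsᵀ * Bs * Asᵀ)) := by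
    have r2' : Dγᵀ * Aγ = 1 := by simpa using congrArg transpose r2
    have e1 : (p' • (Bγ * Asᵀ - Aγ * Dsᵀ * Bs * Asᵀ))ᵀ * (p' • (Dγ * Asᵀ)) =
        (p' * p') • (As * (Bγᵀ * Dγ) * Asᵀ - As * (Bsᵀ * Ds) * (Aγᵀ * Dγ) * Asᵀ) := by
      simp only [transpose_sub, transpose_mul, transpose_smul, transpose_transpose, sub_mul,
        mul_smul_comm, smul_mul_assoc, smul_sub, smul_smul, Matrix.mul_assoc]
    have e2 : (p' • (Dγ * Asᵀ))ᵀ * (p' • (Bγ * Asᵀ - Aγ * Dsᵀ * Bs * Asᵀ)) =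
        (p' * p') • (As * (Dγᵀ * Bγ) * Asᵀ - As * (Dγᵀ * Aγ) * (Dsᵀ * Bs) * Asᵀ) := by
      simp only [transpose_mul, transpose_smul, transpose_transpose, mul_sub,
        mul_smul_comm, smul_mul_assoc, smul_sub, smul_smul, Matrix.mul_assoc]
    rw [e1, e2, r1, r2, r2', mul_one, mul_one, s1]
  obtain ⟨κ₂, hκ₂, γ₂, hγ₂, rfl, hdet⟩ :=
    H.exists_eq_mul_cuspMatrix_mul hT (mul_comm (p : ZMod N) p' ▸ hp) hAD hBD hC' hD'
  rw [H.weight_mul hκ₂ hγ₂]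
  rw [hTdet] at hdet
  -- Modulo `N₀`, `N₁`, `N₂` the unit `p² x` becomes `p^(2-e)`, `p^(1-e)`, `p^e`. As `χ₁² = 1`, the
  -- exponent `1 - e` may be replaced by `1 + e`.
  set x : ZMod N := (d 0 * p' + 1 - d 0) * (d 1 * p' * p ^ e + (1 - d 1) * p' ^ e) with hx
  have hprod : detD N γ₂ * detD N s * (p ^ 2 * x) = detD N γ := by
    have hs' : As.det * detD N s = 1 := by
      rw [detD_eq, ← det_transpose, ← det_mul, s2, det_one]
    rw [det_smul, det_mul, det_transpose, Fintype.card_fin] at hdet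
    rw [detD_eq N γ]
    linear_combination (p : ZMod N) ^ 2 * detD N s * hdet +
      (p : ZMod N) ^ 2 * p' ^ 2 * Dγ.det * hs' + Dγ.det * (p * p' + 1 : ZMod N) * hp
  have hunit : IsUnit ((p : ZMod N) ^ 2 * x) :=
    isUnit_of_mul_isUnit_right (hprod ▸ isUnit_detD hγ)
  have hpe : (p : ZMod N) ^ e * p' ^ e = 1 := by rw [← mul_pow, hp, one_pow]
  have hp2 : (p : ZMod N) ^ 2 = p ^ (2 - e) * p ^ e := by rw [← pow_add, Nat.sub_add_cancel he]
  have hμ : χ (p ^ 2 * x) = χ₀ ((p : ZMod N₀) ^ (2 - e)) * χ₁ ((p : ZMod N₁) ^ (1 + e)) *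
      χ₂ ((p : ZMod N₂) ^ e) := by
    have c₀ : ZMod.castHom H.dvd₀ (ZMod N₀) (p ^ 2 * x) = (p : ZMod N₀) ^ (2 - e) := by
      have h1 := congrArg (ZMod.castHom H.dvd₀ (ZMod N₀)) hpe
      have h2 := congrArg (ZMod.castHom H.dvd₀ (ZMod N₀)) hp2
      simp only [map_mul, map_pow, map_natCast, map_one] at h1 h2
      simp only [hx, map_mul, map_pow, map_add, map_sub, map_one, map_natCast, map_intCast, H.cusp₀]
      linear_combination (ZMod.castHom H.dvd₀ (ZMod N₀) p') ^ e * h2 + (p : ZMod N₀) ^ (2 - e) * h1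
    have c₁ : χ₁ (ZMod.castHom H.dvd₁ (ZMod N₁) (p ^ 2 * x)) = χ₁ ((p : ZMod N₁) ^ (1 + e)) := by
      have h1 := congrArg (ZMod.castHom H.dvd₁ (ZMod N₁)) hpe
      have h2 := congrArg (ZMod.castHom H.dvd₁ (ZMod N₁)) hp
      simp only [map_mul, map_pow, map_natCast, map_one] at h1 h2
      have h3 : ZMod.castHom H.dvd₁ (ZMod N₁) (p ^ 2 * x) =
          p * (ZMod.castHom H.dvd₁ (ZMod N₁) p') ^ e := by
        simp only [hx, map_mul, map_pow, map_add, map_sub, map_one, map_natCast, map_intCast,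
          H.cusp₁]
        linear_combination (p : ZMod N₁) * (ZMod.castHom H.dvd₁ (ZMod N₁) p') ^ e * h2
      have h4 := congrArg χ₁ h1
      have h5 := H.char₁_sq (IsUnit.of_mul_eq_one _ h1)
      rw [h3, pow_add, pow_one, map_mul, map_mul]
      rw [map_mul, map_one] at h4
      congr 1
      calc _ = χ₁ ((p : ZMod N₁) ^ e) * (χ₁ ((p : ZMod N₁) ^ e) * χ₁ _) := by
            rw [← mul_assoc, h5, one_mul]
        _ = _ := by rw [h4, mul_one]
    have c₂ : ZMod.castHom H.dvd₂ (ZMod N₂) (p ^ 2 * x) = (p : ZMod N₂) ^ e := by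
      have h2 := congrArg (ZMod.castHom H.dvd₂ (ZMod N₂)) hp
      simp only [map_mul, map_natCast, map_one] at h2
      simp only [hx, map_mul, map_pow, map_add, map_sub, map_one, map_natCast, map_intCast, H.cusp₂]
      linear_combination (p : ZMod N₂) ^ e *
        ((p : ZMod N₂) * ZMod.castHom H.dvd₂ (ZMod N₂) p' + 1) * h2
    rw [H.char_apply, c₀, c₁, c₂]
  have hconj (a b c : ZMod N) : starRingEnd ℂ (χ (a * b * c)) =
      starRingEnd ℂ (χ a) * starRingEnd ℂ (χ b) * starRingEnd ℂ (χ c) := by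
    rw [map_mul, map_mul, map_mul, map_mul]
  rw [← hμ, ← hprod, hconj]
  linear_combination -(starRingEnd ℂ (χ (detD N γ₂))) * starRingEnd ℂ (χ (detD N s)) *
    conj_char_mul_self χ hunit

end CuspDatum

/-! ### The Eisenstein series as a sum over all cosets -/

/-- The summand of the Eisenstein series at a coset `Γ_∞⁺ g`. -/
def cosetTerm (N : ℕ) (χ : DirichletCharacter ℂ N) (k : ℕ) (d : Fin 2 → ℤ) (τ : Mat2 ℂ)
    (c : Cosets) : ℂ :=
  weight N χ d c.out * autFactor c.out τ ^ (-(k : ℤ))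

theorem norm_zpow_neg (z : ℂ) (k : ℕ) : ‖z ^ (-(k : ℤ))‖ = ‖z‖⁻¹ ^ k := by
  rw [_root_.zpow_neg, zpow_natCast, norm_inv, norm_pow, inv_pow]

theorem summable_cosetTerm {N : ℕ} (χ : DirichletCharacter ℂ N) {k : ℕ} (hk : 4 ≤ k)
    (d : Fin 2 → ℤ) {τ : Mat2 ℂ} (hτ : τ ∈ upperHalf) : Summable (cosetTerm N χ k d τ) := by
  refine Summable.of_norm_bounded (summable_norm_autFactor_inv_pow hk hτ) fun c => ?_
  rw [cosetTerm, norm_mul, norm_zpow_neg]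
  exact mul_le_of_le_one_left (by positivity) (norm_weight_le_one _ _ _ _)

theorem eisTerm_eq (N : ℕ) (χ : DirichletCharacter ℂ N) (k : ℕ) (γ₀ : Sp2Z) (τ : Mat2 ℂ)
    (γ : Sp2Z) : eisTerm N χ k γ₀ τ γ =
      (starRingEnd ℂ) (χ (detD N γ)) * autFactor (γ₀ * γ) τ ^ (-(k : ℤ)) := rfl

theorem toCoset_mul_injective {N : ℕ} {γ₀ : Sp2Z} {R : Set Sp2Z}
    (hR : IsOrbitReps GammaInfPlus N γ₀ R) :
    Function.Injective fun γ : R => toCoset (γ₀ * γ) := by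
  intro a b h
  have h := toCoset_eq_iff.1 h
  refine Subtype.ext ((hR.2 b (hR.1 b.2)).unique ⟨a.2, _, h, ?_⟩
    ⟨b.2, 1, parabolicPlus.one_mem, ?_⟩)
  · rw [inv_mul_cancel_right]
  · rw [one_mul]

theorem exists_of_cosetTerm_ne_zero {N : ℕ} {χ : DirichletCharacter ℂ N} {d : Fin 2 → ℤ} {k : ℕ}
    {τ : Mat2 ℂ} {c : Cosets}
    (h : cosetTerm N χ k d τ c ≠ 0) :
    ∃ γ ∈ congruenceSubgroup N, c = toCoset (cuspMatrix d * γ) := by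
  have : InOrbit N d c.out := by
    by_contra h0
    apply h
    rw [cosetTerm, weight, dif_neg h0, zero_mul]
  obtain ⟨γ, hγ, κ, hκ, e⟩ := this
  refine ⟨γ, hγ, ?_⟩
  rw [← toCoset_out c, toCoset_eq_iff, e]
  convert inv_mem hκ using 1
  group

theorem det_blockD_eq_one_or {g : Sp2Z} (h : blockC g = 0) :
    (blockD g).det = 1 ∨ (blockD g).det = -1 :=
  Int.isUnit_iff.1 (IsUnit.of_mul_eq_one _ ((mul_comm _ _).trans (det_blockA_mul_det_blockD h)))

namespace CuspDatum

variable {N N₀ N₁ N₂ : ℕ} {χ : DirichletCharacter ℂ N} {χ₀ : DirichletCharacter ℂ N₀}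
    {χ₁ : DirichletCharacter ℂ N₁} {χ₂ : DirichletCharacter ℂ N₂} {d : Fin 2 → ℤ}

theorem cosetTerm_toCoset (H : CuspDatum N N₀ N₁ N₂ χ χ₀ χ₁ χ₂ d) (k : ℕ) (g : Sp2Z) (τ : Mat2 ℂ) :
    cosetTerm N χ k d τ (toCoset g) = weight N χ d g * autFactor g τ ^ (-(k : ℤ)) := by
  rw [cosetTerm, H.weight_eq_of_mem (out_mul_inv_mem g), autFactor_eq_of_mem (out_mul_inv_mem g)]

theorem cosetTerm_eq_eisTerm (H : CuspDatum N N₀ N₁ N₂ χ χ₀ χ₁ χ₂ d)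
    (k : ℕ) {γ : Sp2Z} (hγ : γ ∈ Gamma0 N) (τ : Mat2 ℂ) :
    cosetTerm N χ k d τ (toCoset (cuspMatrix d * γ)) = eisTerm N χ k (cuspMatrix d) τ γ := by
  rw [H.cosetTerm_toCoset, eisTerm_eq]
  have := H.weight_mul parabolicPlus.one_mem (γ := γ) hγ
  rw [one_mul] at this
  rw [this]

theorem summable_eisTerm (H : CuspDatum N N₀ N₁ N₂ χ χ₀ χ₁ χ₂ d) {k : ℕ} (hk : 4 ≤ k) {R : Set Sp2Z}
    (hR : IsOrbitReps GammaInfPlus N (cuspMatrix d) R) {τ : Mat2 ℂ} (hτ : τ ∈ upperHalf) :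
    Summable fun γ : R => eisTerm N χ k (cuspMatrix d) τ γ :=
  ((summable_cosetTerm χ hk d hτ).comp_injective (toCoset_mul_injective hR)).congr
    fun γ => H.cosetTerm_eq_eisTerm k (hR.1 γ.2) τ

/-- The representatives inject into the cosets and reach the whole support. No condition on `τ` is
needed, since reindexing a `tsum` along an injection requires no convergence. -/
theorem eisSum_eq_tsum (H : CuspDatum N N₀ N₁ N₂ χ χ₀ χ₁ χ₂ d) (k : ℕ) {R : Set Sp2Z}
    (hR : IsOrbitReps GammaInfPlus N (cuspMatrix d) R) (τ : Mat2 ℂ) :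
    eisSum N χ k (cuspMatrix d) R τ = ∑' c, cosetTerm N χ k d τ c := by
  rw [eisSum, ← (toCoset_mul_injective hR).tsum_eq]
  · exact tsum_congr fun γ => (H.cosetTerm_eq_eisTerm k (hR.1 γ.2) τ).symm
  · intro c hc
    obtain ⟨γ, hγ, rfl⟩ := exists_of_cosetTerm_ne_zero hc
    obtain ⟨s, ⟨hs, κ, hκ, e⟩, -⟩ := hR.2 γ hγ
    refine ⟨⟨s, hs⟩, ?_⟩
    rw [toCoset_eq_iff, e, mul_inv_cancel_right]
    exact hκ

end CuspDatum

/-! ### Classes under `GL_2(ℤ)` and under `SL_2(ℤ)` -/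

/-- The matrix `diag(1, -1, 1, -1)`. -/
def signMatrix : Sp2Z := levi (diagonal ![1, -1]) (diagonal ![1, -1]) (by
  ext i j; fin_cases i <;> fin_cases j <;> simp)

theorem cuspMatrix_mul_signMatrix (d : Fin 2 → ℤ) :
    cuspMatrix d * signMatrix = signMatrix * cuspMatrix d := by
  apply ext_blocks <;> simp [signMatrix, blockA_mul, blockB_mul, blockC_mul, blockD_mul, mul_comm]

theorem det_blockD_signMatrix : (blockD signMatrix).det = -1 := by
  simp [signMatrix]

namespace CuspDatum

variable {N N₀ N₁ N₂ : ℕ} {χ : DirichletCharacter ℂ N} {χ₀ : DirichletCharacter ℂ N₀}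
    {χ₁ : DirichletCharacter ℂ N₁} {χ₂ : DirichletCharacter ℂ N₂} {d : Fin 2 → ℤ}

/-- The sign matrix has `det D = -1`, lies in `Γ_0(N)` and commutes with `γ₀`. So it exchanges the
two halves of a `Γ_∞` coset within the orbit and changes the term by `conj (χ (-1)) (-1)^(-k) = 1`.
-/
theorem eisenstein_eq_eisSum (H : CuspDatum N N₀ N₁ N₂ χ χ₀ χ₁ χ₂ d)
    {k : ℕ} (hk : 4 ≤ k) (hχ : χ (-1) = (-1) ^ k) {R R' : Set Sp2Z}
    (hR : IsOrbitReps GammaInfPlus N (cuspMatrix d) R)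
    (hR' : IsOrbitReps GammaInf N (cuspMatrix d) R') {τ : Mat2 ℂ} (hτ : τ ∈ upperHalf) :
    eisenstein N χ k (cuspMatrix d) R τ = eisSum N χ k (cuspMatrix d) R' τ := by
  have hsC : blockC signMatrix = 0 := blockC_levi
  have hsΓ : signMatrix ∈ congruenceSubgroup N := fun i j => by rw [hsC]; simp
  let e : Bool → Sp2Z := fun b => if b then signMatrix else 1
  have heC (b) : blockC (e b) = 0 := by cases b <;> simp [e, hsC]
  let F : R' × Bool → Cosets := fun x => toCoset (e x.2 * (cuspMatrix d * x.1))
  have hF : Function.Injective F := by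
    rintro ⟨a, i⟩ ⟨b, j⟩ h
    have h := toCoset_eq_iff.1 h
    dsimp only at h
    have hab : a = b := by
      refine Subtype.ext ((hR'.2 b (hR'.1 b.2)).unique
        ⟨a.2, (e j)⁻¹ * (e j * (cuspMatrix d * b) * (e i * (cuspMatrix d * a))⁻¹) * e i, ?_, ?_⟩
        ⟨b.2, 1, blockC_one, ?_⟩)
      · show blockC _ = 0
        rw [blockC_mul, heC, mul_zero, add_zero, blockC_mul, h.1, mul_zero, add_zero, blockC_inv,
          heC]
        simp
      · group
      · rw [one_mul]
    subst hab
    have h1 : e j * (e i)⁻¹ ∈ parabolicPlus := by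
      convert h using 1; group
    have h2 := h1.2
    have hs1 : blockA signMatrix = diagonal ![1, -1] := by simp [signMatrix]
    have hs2 : blockD signMatrix = diagonal ![1, -1] := by simp [signMatrix]
    cases i <;> cases j <;> simp [e, hs1, hs2] at h2 ⊢
  have hterm (γ : R') (b : Bool) :
      cosetTerm N χ k d τ (F (γ, b)) = eisTerm N χ k (cuspMatrix d) τ γ := by
    cases b
    · simp only [F, e, Bool.false_eq_true, if_false, one_mul]
      exact H.cosetTerm_eq_eisTerm k (hR'.1 γ.2) τ
    · simp only [F, e, if_true]
      rw [H.cosetTerm_toCoset, autFactor_mul hsC, ← mul_assoc, ← cuspMatrix_mul_signMatrix,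
        mul_assoc, eisTerm_eq]
      have := H.weight_mul parabolicPlus.one_mem (mul_mem hsΓ (hR'.1 γ.2))
      rw [one_mul] at this
      rw [this, detD_mul hsΓ, mul_zpow, det_blockD_signMatrix]
      have h1 : detD N signMatrix = -1 := by rw [detD, det_blockD_signMatrix]; simp
      rw [h1, map_mul, hχ, map_mul]
      have h2 : (starRingEnd ℂ) ((-1 : ℂ) ^ k) * ((-1 : ℤ) : ℂ) ^ (-(k : ℤ)) = 1 := by
        rcases Nat.even_or_odd k with h | h <;> simp [h.neg_one_pow, _root_.zpow_neg]
      linear_combination (starRingEnd ℂ (χ (detD N γ)) *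
        autFactor (cuspMatrix d * γ) τ ^ (-(k : ℤ))) * h2
  have hsupp : Function.support (cosetTerm N χ k d τ) ⊆ Set.range F := by
    intro c hc
    obtain ⟨γ, hγ, rfl⟩ := exists_of_cosetTerm_ne_zero hc
    obtain ⟨s, ⟨hs, κ, hκ, e'⟩, -⟩ := hR'.2 γ hγ
    rcases det_blockD_eq_one_or hκ with h | h
    · refine ⟨(⟨s, hs⟩, false), ?_⟩
      simp only [F, e, Bool.false_eq_true, if_false, one_mul]
      rw [toCoset_eq_iff, e', mul_inv_cancel_right]
      exact ⟨hκ, h⟩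
    · refine ⟨(⟨s, hs⟩, true), ?_⟩
      simp only [F, e, if_true]
      rw [toCoset_eq_iff, e', _root_.mul_inv_rev, ← mul_assoc, mul_inv_cancel_right]
      have hκ : blockC κ = 0 := hκ
      refine ⟨?_, ?_⟩
      · rw [blockC_mul, hκ, blockC_inv, hsC]; simp
      · rw [blockD_mul, hκ, zero_mul, zero_add, det_mul, h, blockD_inv]
        simp [signMatrix]
  have hsum : Summable fun x => cosetTerm N χ k d τ (F x) :=
    (summable_cosetTerm χ hk d hτ).comp_injective hF
  rw [eisenstein, H.eisSum_eq_tsum k hR, ← hF.tsum_eq hsupp, hsum.tsum_prod, eisSum]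
  simp_rw [hterm, tsum_bool, ← two_mul]
  rw [tsum_mul_left]
  ring

end CuspDatum

/-! ### The similitude `diag(I, pI)` and weak approximation at `p` -/

/-- The integral similitude `diag(I, pI)`. -/
def simil (p : ℕ) : Mat4 ℤ := fromBlocks 1 0 0 ((p : ℤ) • 1)

/-- The matrices in `Sp_2(ℤ)` with `B ≡ 0` modulo `p`, as a subgroup. -/
def lowerCongruence (p : ℕ) : Subgroup Sp2Z where
  carrier := {g | ∀ i j, (p : ℤ) ∣ blockB g i j}
  one_mem' := by simp
  mul_mem' := by
    intro a b ha hb i j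
    rw [blockB_mul, Matrix.add_apply, Matrix.mul_apply, Matrix.mul_apply]
    exact dvd_add (Finset.dvd_sum fun k _ => (hb k j).mul_left _)
      (Finset.dvd_sum fun k _ => (ha i k).mul_right _)
  inv_mem' := by
    intro a ha i j
    simpa using ha j i

theorem exists_smul_eq {p : ℕ} {A : Mat2 ℤ} (h : ∀ i j, (p : ℤ) ∣ A i j) :
    ∃ A' : Mat2 ℤ, A = (p : ℤ) • A' := by
  choose f hf using h
  exact ⟨of f, by ext i j; simpa using hf i j⟩

theorem simil_mul (p : ℕ) (g : Sp2Z) : simil p * (g : Mat4 ℤ) =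
    fromBlocks (blockA g) (blockB g) ((p : ℤ) • blockC g) ((p : ℤ) • blockD g) := by
  rw [coe_eq_fromBlocks, simil, fromBlocks_multiply]; simp

theorem mul_simil (p : ℕ) (g : Sp2Z) : (g : Mat4 ℤ) * simil p =
    fromBlocks (blockA g) ((p : ℤ) • blockB g) (blockC g) ((p : ℤ) • blockD g) := by
  rw [coe_eq_fromBlocks, simil, fromBlocks_multiply]
  simp only [mul_one, mul_zero, add_zero, zero_add, mul_smul_comm]

theorem smul_injective {p : ℕ} (hp : p ≠ 0) {A B : Mat2 ℤ} (h : (p : ℤ) • A = (p : ℤ) • B) :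
    A = B := by
  ext i j
  have := congrFun (congrFun h i) j
  simpa [hp] using this

/-- Conjugation by `diag(I, pI)` divides `B` by `p` and multiplies `C` by `p`, so it stays integral
when `p ∣ B`. -/
theorem exists_simil_mul_eq {p : ℕ} (hp : p ≠ 0) {g : Sp2Z} (hg : g ∈ lowerCongruence p) :
    ∃ g' : Sp2Z, simil p * (g : Mat4 ℤ) = g' * simil p ∧ blockA g' = blockA g ∧
      blockB g = (p : ℤ) • blockB g' ∧ blockC g' = (p : ℤ) • blockC g ∧ blockD g' = blockD g := by
  obtain ⟨B, hB⟩ := exists_smul_eq hg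
  obtain ⟨r1, r2, r3⟩ := transpose_relations g
  rw [hB] at r2 r3
  refine ⟨ofBlocks (blockA g) B ((p : ℤ) • blockC g) (blockD g) ?_ ?_ ?_, ?_, ?_⟩
  · rw [mul_smul_comm, r1, transpose_smul, smul_mul_assoc]
  · rw [transpose_smul, smul_mul_assoc, mul_smul_comm] at r2
    exact smul_injective hp r2
  · rw [mul_smul_comm] at r3
    rw [transpose_smul, smul_mul_assoc, r3]
  · rw [simil_mul, mul_simil]
    simp [← hB]
  · simp [← hB]

theorem mem_lowerCongruence_of_simil_mul_eq {p : ℕ} {g g' : Sp2Z}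
    (h : simil p * (g : Mat4 ℤ) = g' * simil p) : g ∈ lowerCongruence p := by
  rw [simil_mul, mul_simil, fromBlocks_inj] at h
  intro i j
  rw [h.2.1]
  exact ⟨_, rfl⟩

/-- If `A` is invertible modulo `p` and `A Bᵀ` is symmetric, then `A⁻¹ B` is symmetric modulo
`p`. -/
theorem exists_symm_dvd_sub {p : ℕ} (hp : p.Prime) {A B : Mat2 ℤ} (hA : ¬ (p : ℤ) ∣ A.det)
    (h : A * Bᵀ = B * Aᵀ) : ∃ Y : Mat2 ℤ, Yᵀ = Y ∧ ∀ i j, (p : ℤ) ∣ (B - A * Y) i j := by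
  have hp' : Prime (p : ℤ) := Nat.prime_iff_prime_int.1 hp
  obtain ⟨m, n, hmn⟩ := (hp'.coprime_iff_not_dvd.2 hA).symm
  have hdet : A.det ≠ 0 := fun h0 => hA (h0 ▸ dvd_zero _)
  have hsymm : (A.adjugate * B)ᵀ = A.adjugate * B := by
    have e1 : A.adjugate * (A * Bᵀ) * A.adjugateᵀ = A.adjugate * (B * Aᵀ) * A.adjugateᵀ := by
      rw [h]
    have e2 : Aᵀ * A.adjugateᵀ = A.det • (1 : Mat2 ℤ) := by
      rw [← transpose_mul, adjugate_mul, transpose_smul, transpose_one]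
    rw [← Matrix.mul_assoc, adjugate_mul, Matrix.mul_assoc A.adjugate, Matrix.mul_assoc B, e2,
      smul_mul_assoc, one_mul, smul_mul_assoc, mul_smul_comm, mul_one, mul_smul_comm] at e1
    rw [transpose_mul]
    ext i j
    have := congrFun (congrFun e1 i) j
    simpa [hdet] using this
  refine ⟨m • (A.adjugate * B), by rw [transpose_smul, hsymm], fun i j => ?_⟩
  have e : B - A * (m • (A.adjugate * B)) = (n * p) • B := by
    rw [mul_smul_comm, ← Matrix.mul_assoc, mul_adjugate, smul_mul_assoc, one_mul, smul_smul,
      eq_sub_of_add_eq' hmn, sub_smul, one_smul]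
  rw [e]
  exact ⟨n * B i j, by simp only [Matrix.smul_apply, smul_eq_mul]; ring⟩

/-- Modulo `p` the determinant is affine in `x` and in `y`, with four minors of `(A B)` as
coefficients. If it vanished at all `x, y ∈ {0, 1}`, these minors would be `0`, hence also the other
two, against `A Dᵀ - B Cᵀ = 1`. The factor `c ≡ 1` leaves room for divisibility by `N`. -/
theorem exists_diagonal_not_dvd_det {p : ℕ} (hp : p.Prime) (h : Sp2Z) {c : ℤ}
    (hc : (c : ZMod p) = 1) :
    ∃ x y : ℤ, ¬ (p : ℤ) ∣ (blockA h + blockB h * diagonal ![c * x, c * y]).det := by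
  have := Fact.mk hp
  by_contra! hcon
  obtain ⟨r1, -, r3⟩ := row_relations (red_mem_symplecticGroup p h)
  set A := red p (blockA h)
  set B := red p (blockB h)
  have key (x y : ℤ) : A.det + x * (B 0 0 * A 1 1 - A 0 1 * B 1 0) +
      y * (A 0 0 * B 1 1 - B 0 1 * A 1 0) + x * y * B.det = 0 := by
    have := (ZMod.intCast_zmod_eq_zero_iff_dvd _ _).2 (hcon x y)
    rw [← det_red, map_add, map_mul] at this
    have hd : red p (diagonal ![c * x, c * y]) = diagonal ![(x : ZMod p), (y : ZMod p)] := by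
      ext i j; fin_cases i <;> fin_cases j <;> simp [red_apply, hc]
    rw [hd] at this
    rw [← this]
    simp [det_fin_two]
    ring
  have k00 : A.det = 0 := by simpa using key 0 0
  have k10 : B 0 0 * A 1 1 - A 0 1 * B 1 0 = 0 := by simpa [k00] using key 1 0
  have k01 : A 0 0 * B 1 1 - B 0 1 * A 1 0 = 0 := by simpa [k00] using key 0 1
  have k11 : B.det = 0 := by simpa [k00, k10, k01] using key 1 1
  have hs := congrFun (congrFun r1 0) 1
  simp only [Matrix.mul_apply, Fin.sum_univ_two, transpose_apply] at hs
  -- By symmetry of `A Bᵀ` the two remaining minors are negatives of each other, and the Plücker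
  -- relation then makes the square of one of them vanish.
  have hz : (A 0 0 * B 1 0 - B 0 0 * A 1 0) = 0 := by
    rw [det_fin_two] at k00 k11
    refine pow_eq_zero_iff (two_ne_zero) |>.1 ?_
    linear_combination (A 0 0 * B 1 0 - B 0 0 * A 1 0) * hs -
      (B 0 0 * B 1 1 - B 0 1 * B 1 0) * k00 - (A 0 1 * B 1 0 - B 0 0 * A 1 1) * k01
  have hz' : A 0 1 * B 1 1 - B 0 1 * A 1 1 = 0 := by linear_combination hs - hz
  have := congrArg det r3
  rw [det_mul_transpose_sub, k00, k01, k11, hz, hz', det_one] at this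
  have k10' : A 0 1 * B 1 0 - B 0 0 * A 1 1 = 0 := by linear_combination -k10
  rw [k10'] at this
  simp at this

/-- Weak approximation: `Γ_0(N)` meets every coset of `{B ≡ 0 mod p}` if `p ∤ N`. -/
theorem exists_mul_inv_mem_lowerCongruence {N p : ℕ} (hp : p.Prime) (hpN : ¬ p ∣ N) (h : Sp2Z) :
    ∃ t ∈ congruenceSubgroup N, h * t⁻¹ ∈ lowerCongruence p := by
  obtain ⟨m, n, hmn⟩ := Nat.isCoprime_iff_coprime.2 ((hp.coprime_iff_not_dvd).2 hpN)
  have hc : ((n * N : ℤ) : ZMod p) = 1 := by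
    have := congrArg (Int.cast : ℤ → ZMod p) hmn
    simpa using this
  obtain ⟨x, y, hxy⟩ := exists_diagonal_not_dvd_det hp h hc
  set E : Mat2 ℤ := diagonal ![n * N * x, n * N * y] with hE
  have hET : Eᵀ = E := diagonal_transpose _
  have hr := (relations (h * lower E hET)).1
  rw [blockA_mul, blockB_mul] at hr
  simp only [blockA_lower, blockB_lower, blockC_lower, blockD_lower, mul_one, mul_zero,
    zero_add] at hr
  obtain ⟨Y, hY, hd⟩ := exists_symm_dvd_sub hp hxy hr
  -- Multiplying `h` by `(I 0; E I)` makes its block `A` invertible modulo `p`, and `(I -Y; 0 I)`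
  -- then clears `B` modulo `p`. Both factors are in `Γ_0(N)`, as `N ∣ E`.
  refine ⟨upper Y hY * (lower E hET)⁻¹, ?_, ?_⟩
  · refine mul_mem ?_ (inv_mem ?_)
    · intro i j; simp
    · intro i j
      rw [blockC_lower, hE]
      fin_cases i <;> fin_cases j <;> simp
      · exact ⟨n * x, by ring⟩
      · exact ⟨n * y, by ring⟩
  · intro i j
    rw [_root_.mul_inv_rev, inv_inv, ← mul_assoc, blockB_mul, blockA_mul, blockB_mul]
    convert hd i j using 2
    simp only [blockA_lower, blockB_lower, blockC_lower, blockD_lower, mul_one, mul_zero,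
      zero_add, blockB_inv, blockB_upper, blockD_inv, blockA_upper, transpose_one, hY]
    rw [mul_neg, neg_add_eq_sub]

/-! ### Upper triangular representatives of multiplier `p` -/

/-- Index set for the upper triangular representatives of the integral similitudes of
multiplier `p`, modulo `Γ_∞⁺` on the left. -/
abbrev TriIndex (p : ℕ) : Type := Unit ⊕ (Option (Fin p) × Fin p) ⊕ (Fin p × Fin p × Fin p)

/-- The block `A` of an upper triangular representative. -/
def triA {p : ℕ} : TriIndex p → Mat2 ℤ
  | .inl _ => !![(p : ℤ), 0; 0, (p : ℤ)]
  | .inr (.inl (none, _)) => !![0, (p : ℤ); -1, 0]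
  | .inr (.inl (some j, _)) => !![(p : ℤ), 0; -(j : ℤ), 1]
  | .inr (.inr _) => 1

/-- The block `B` of an upper triangular representative. -/
def triB {p : ℕ} : TriIndex p → Mat2 ℤ
  | .inl _ => 0
  | .inr (.inl (none, x)) => !![0, 0; -(x : ℤ), 0]
  | .inr (.inl (some _, x)) => !![0, 0; 0, (x : ℤ)]
  | .inr (.inr (x, y, z)) => !![(x : ℤ), (y : ℤ); (y : ℤ), (z : ℤ)]

/-- The block `D` of an upper triangular representative. -/
def triD {p : ℕ} : TriIndex p → Mat2 ℤ
  | .inl _ => 1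
  | .inr (.inl (none, _)) => !![0, 1; -(p : ℤ), 0]
  | .inr (.inl (some j, _)) => !![1, (j : ℤ); 0, (p : ℤ)]
  | .inr (.inr _) => !![(p : ℤ), 0; 0, (p : ℤ)]

/-- The exponent of `p` in the determinant of the block `D`. -/
def triExp {p : ℕ} : TriIndex p → ℕ
  | .inl _ => 0
  | .inr (.inl _) => 1
  | .inr (.inr _) => 2

/-- The upper triangular representatives. -/
def tri {p : ℕ} (i : TriIndex p) : Mat4 ℤ := fromBlocks (triA i) (triB i) 0 (triD i)

theorem triExp_le {p : ℕ} (i : TriIndex p) : triExp i ≤ 2 := by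
  rcases i with _ | _ | _ <;> simp [triExp]

theorem det_triD {p : ℕ} (i : TriIndex p) : (triD i).det = (p : ℤ) ^ triExp i := by
  rcases i with _ | ⟨_ | _, _⟩ | _ <;> simp [triExp, triD, det_fin_two, pow_two]

/-- These multiplicities `1`, `p(p+1)`, `p³` are the weights of the three terms of the eigenvalue.
-/
theorem sum_triExp {p : ℕ} (f : ℕ → ℂ) :
    ∑ i : TriIndex p, f (triExp i) = f 0 + (p + 1) * p * f 1 + p ^ 3 * f 2 := by
  simp [Fintype.sum_sum_type, triExp]
  ring

theorem tri_relations {p : ℕ} (i : TriIndex p) :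
    (triA i)ᵀ * triD i = (p : ℤ) • 1 ∧ (triB i)ᵀ * triD i = (triD i)ᵀ * triB i := by
  rcases i with _ | ⟨_ | j, x⟩ | ⟨x, y, z⟩
  · constructor <;> ext a b <;> fin_cases a <;> fin_cases b <;>
      simp [triA, triB, triD]
  · constructor <;> ext a b <;> fin_cases a <;> fin_cases b <;>
      simp [triA, triB, triD, Matrix.mul_apply, mul_comm]
  · constructor <;> ext a b <;> fin_cases a <;> fin_cases b <;>
      simp [triA, triB, triD, Matrix.mul_apply, mul_comm]
  · constructor <;> ext a b <;> fin_cases a <;> fin_cases b <;>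
      simp [triA, triB, triD, Matrix.mul_apply, mul_comm]

theorem tri_mul {p : ℕ} (i : TriIndex p) (g : Sp2Z) : tri i * (g : Mat4 ℤ) =
    fromBlocks (triA i * blockA g + triB i * blockC g) (triA i * blockB g + triB i * blockD g)
      (triD i * blockC g) (triD i * blockD g) := by
  rw [tri, coe_eq_fromBlocks g, fromBlocks_multiply]; simp

theorem mul_tri {p : ℕ} (i : TriIndex p) (g : Sp2Z) : (g : Mat4 ℤ) * tri i =
    fromBlocks (blockA g * triA i) (blockA g * triB i + blockB g * triD i)
      (blockC g * triA i) (blockC g * triB i + blockD g * triD i) := by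
  rw [tri, coe_eq_fromBlocks g, fromBlocks_multiply]; simp

/-- The product `T_i h` is a similitude of multiplier `p`; if its right half is divisible by `p`,
dividing that half by `p` leaves a symplectic matrix. -/
theorem exists_tri_mul_eq_mul_simil {p : ℕ} (hp : p ≠ 0) (i : TriIndex p) (h : Sp2Z)
    (hB : ∀ a b, (p : ℤ) ∣ (triA i * blockB h + triB i * blockD h) a b)
    (hD : ∀ a b, (p : ℤ) ∣ (triD i * blockD h) a b) :
    ∃ y : Sp2Z, tri i * (h : Mat4 ℤ) = y * simil p := by
  obtain ⟨B, hB⟩ := exists_smul_eq hB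
  obtain ⟨D, hD⟩ := exists_smul_eq hD
  obtain ⟨t1, t2⟩ := tri_relations i
  have t1' : (triD i)ᵀ * triA i = (p : ℤ) • 1 := by simpa using congrArg transpose t1
  obtain ⟨r1, r2, r3⟩ := transpose_relations h
  refine ⟨ofBlocks (triA i * blockA h + triB i * blockC h) B (triD i * blockC h) D ?_ ?_ ?_, ?_⟩
  · have e1 : (triA i * blockA h + triB i * blockC h)ᵀ * (triD i * blockC h) =
        (blockA h)ᵀ * ((triA i)ᵀ * triD i) * blockC h +
        (blockC h)ᵀ * ((triB i)ᵀ * triD i) * blockC h := by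
      simp only [transpose_add, transpose_mul, add_mul, Matrix.mul_assoc]
    have e2 : (triD i * blockC h)ᵀ * (triA i * blockA h + triB i * blockC h) =
        (blockC h)ᵀ * ((triD i)ᵀ * triA i) * blockA h +
        (blockC h)ᵀ * ((triD i)ᵀ * triB i) * blockC h := by
      simp only [transpose_mul, mul_add, Matrix.mul_assoc]
    rw [e1, e2, t1, t2, t1', mul_smul_comm, mul_smul_comm, mul_one, mul_one, smul_mul_assoc,
      smul_mul_assoc, r1]
  · refine smul_injective hp (smul_injective hp ?_)
    have e1 : (p : ℤ) • (p : ℤ) • (Bᵀ * D) = ((p : ℤ) • B)ᵀ * ((p : ℤ) • D) := by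
      rw [transpose_smul, smul_mul_assoc, mul_smul_comm]
    have e2 : (p : ℤ) • (p : ℤ) • (Dᵀ * B) = ((p : ℤ) • D)ᵀ * ((p : ℤ) • B) := by
      rw [transpose_smul, smul_mul_assoc, mul_smul_comm]
    have e3 : (triA i * blockB h + triB i * blockD h)ᵀ * (triD i * blockD h) =
        (blockB h)ᵀ * ((triA i)ᵀ * triD i) * blockD h +
        (blockD h)ᵀ * ((triB i)ᵀ * triD i) * blockD h := by
      simp only [transpose_add, transpose_mul, add_mul, Matrix.mul_assoc]
    have e4 : (triD i * blockD h)ᵀ * (triA i * blockB h + triB i * blockD h) =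
        (blockD h)ᵀ * ((triD i)ᵀ * triA i) * blockB h +
        (blockD h)ᵀ * ((triD i)ᵀ * triB i) * blockD h := by
      simp only [transpose_mul, mul_add, Matrix.mul_assoc]
    rw [e1, e2, ← hB, ← hD, e3, e4, t1, t2, t1', mul_smul_comm, mul_smul_comm, mul_one, mul_one,
      smul_mul_assoc, smul_mul_assoc, r2]
  · refine smul_injective hp ?_
    rw [smul_sub, ← mul_smul_comm, ← mul_smul_comm, ← hB, ← hD]
    have e3 : (triA i * blockA h + triB i * blockC h)ᵀ * (triD i * blockD h) =
        (blockA h)ᵀ * ((triA i)ᵀ * triD i) * blockD h +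
        (blockC h)ᵀ * ((triB i)ᵀ * triD i) * blockD h := by
      simp only [transpose_add, transpose_mul, add_mul, Matrix.mul_assoc]
    have e4 : (triD i * blockC h)ᵀ * (triA i * blockB h + triB i * blockD h) =
        (blockC h)ᵀ * ((triD i)ᵀ * triA i) * blockB h +
        (blockC h)ᵀ * ((triD i)ᵀ * triB i) * blockD h := by
      simp only [transpose_mul, mul_add, Matrix.mul_assoc]
    rw [e3, e4, t1, t2, t1', mul_smul_comm, mul_smul_comm, mul_one, mul_one,
      smul_mul_assoc, smul_mul_assoc, add_sub_add_right_eq_sub, ← smul_sub, r3]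
  · rw [tri_mul, mul_simil]
    simp [← hB, ← hD]

theorem exists_fin_intCast_eq {p : ℕ} (hp : p ≠ 0) (a : ZMod p) :
    ∃ x : Fin p, ((x : ℤ) : ZMod p) = a := by
  have : NeZero p := ⟨hp⟩
  refine ⟨⟨a.val, a.val_lt⟩, ?_⟩
  simp

theorem fin_eq_of_eq_add_mul {p : ℕ} {x y : Fin p} {b : ℤ} (h : (x : ℤ) = y + p * b) : x = y := by
  have h1 : ((x : ℕ) : ℤ) % p = ((y : ℕ) : ℤ) % p := by
    rw [h]; simp
  rw [Int.emod_eq_of_lt (by positivity) (by exact_mod_cast x.2),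
    Int.emod_eq_of_lt (by positivity) (by exact_mod_cast y.2)] at h1
  exact Fin.ext (by exact_mod_cast h1)

theorem exists_add_mul_eq_zero {p : ℕ} [Fact p.Prime] {u₀ u₁ v₀ v₁ : ZMod p}
    (h : u₀ * v₁ = u₁ * v₀) (hv : ¬ (v₀ = 0 ∧ v₁ = 0)) :
    ∃ x : Fin p, u₀ + ((x : ℤ) : ZMod p) * v₀ = 0 ∧ u₁ + ((x : ℤ) : ZMod p) * v₁ = 0 := by
  by_cases h0 : v₀ = 0
  · have h1 : v₁ ≠ 0 := fun h1 => hv ⟨h0, h1⟩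
    obtain ⟨x, hx⟩ := exists_fin_intCast_eq (NeZero.ne p) (-(u₁ / v₁))
    have hu : u₀ = 0 := by
      rw [h0, mul_zero] at h
      exact (mul_eq_zero.1 h).resolve_right h1
    exact ⟨x, by rw [hu, h0]; simp, by rw [hx]; field_simp; ring⟩
  · obtain ⟨x, hx⟩ := exists_fin_intCast_eq (NeZero.ne p) (-(u₀ / v₀))
    refine ⟨x, by rw [hx]; field_simp; ring, ?_⟩
    rw [hx]
    field_simp
    linear_combination -h

theorem mul_apply_two {R : Type} [CommRing R] (A B : Mat2 R) (i j : Fin 2) :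
    (A * B) i j = A i 0 * B 0 j + A i 1 * B 1 j := by
  rw [Matrix.mul_apply, Fin.sum_univ_two]

/-- The index is dictated by the rank of `D` modulo `p`: rank `2`, `1`, `0` gives `det D_i = p²`,
`p`, `1`. In rank `1`, the first component of the index records the linear relation between the rows
of `D`. The remaining parameters make the upper right block of `T_i h` divisible by `p`; they exist
because `Bᵀ D` is symmetric. -/
theorem exists_tri_mul_eq {p : ℕ} (hp : p.Prime) (h : Sp2Z) :
    ∃ (i : TriIndex p) (y : Sp2Z), tri i * (h : Mat4 ℤ) = y * simil p := by
  have := Fact.mk hp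
  have dvd_iff (a : ℤ) : (p : ℤ) ∣ a ↔ (a : ZMod p) = 0 :=
    (ZMod.intCast_zmod_eq_zero_iff_dvd _ _).symm
  have hsymm := congrFun (congrFun (transpose_relations h).2.1 0) 1
  simp only [mul_apply_two, transpose_apply] at hsymm
  have hsymm := congrArg (Int.cast : ℤ → ZMod p) hsymm
  push_cast at hsymm
  by_cases hdet : (p : ℤ) ∣ (blockD h).det
  swap
  -- Here `Y ≡ -B D⁻¹` modulo `p`, a symmetric matrix.
  · obtain ⟨Y, hY, hd⟩ := exists_symm_dvd_sub hp (A := (blockD h)ᵀ) (B := -(blockB h)ᵀ)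
      (by rwa [det_transpose]) (by simpa using (transpose_relations h).2.1.symm)
    obtain ⟨x, hx⟩ := exists_fin_intCast_eq hp.ne_zero (Y 0 0 : ZMod p)
    obtain ⟨y, hy⟩ := exists_fin_intCast_eq hp.ne_zero (Y 0 1 : ZMod p)
    obtain ⟨z, hz⟩ := exists_fin_intCast_eq hp.ne_zero (Y 1 1 : ZMod p)
    rw [Int.cast_natCast] at hx hy hz
    have hY10 : Y 1 0 = Y 0 1 := congrFun (congrFun hY 0) 1
    refine ⟨.inr (.inr (x, y, z)), exists_tri_mul_eq_mul_simil hp.ne_zero _ _ ?_ ?_⟩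
    · intro a b
      have h1 := (dvd_iff _).1 (hd b a)
      simp only [dvd_iff, Matrix.add_apply, mul_apply_two]
      simp only [Matrix.sub_apply, Matrix.neg_apply, mul_apply_two, mul_apply_two,
        transpose_apply] at h1
      push_cast at h1
      fin_cases a <;>
        simp [triA, triB, Matrix.one_apply, hx, hy, hz, hY10] at h1 ⊢ <;>
        linear_combination -h1
    · intro a b
      simp only [mul_apply_two]
      fin_cases a <;> simp [triD]
  have hdet' : (blockD h 0 0 * blockD h 1 1 - blockD h 0 1 * blockD h 1 0 : ZMod p) = 0 := by
    have := (dvd_iff _).1 hdet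
    rw [det_fin_two] at this
    exact_mod_cast this
  by_cases h1 : (blockD h 1 0 : ZMod p) = 0 ∧ (blockD h 1 1 : ZMod p) = 0
  · by_cases h0 : (blockD h 0 0 : ZMod p) = 0 ∧ (blockD h 0 1 : ZMod p) = 0
    · refine ⟨.inl (), exists_tri_mul_eq_mul_simil hp.ne_zero _ _ ?_ ?_⟩
      · intro a b
        simp only [Matrix.add_apply, mul_apply_two]
        fin_cases a <;> simp [triA, triB]
      · intro a b
        simp only [dvd_iff, mul_apply_two]
        fin_cases a <;> fin_cases b <;> simp [triD, h0, h1]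
    · obtain ⟨x, hx₀, hx₁⟩ := exists_add_mul_eq_zero (p := p) (u₀ := blockB h 0 0)
        (u₁ := blockB h 0 1) (v₀ := blockD h 0 0) (v₁ := blockD h 0 1)
        (by rw [h1.1, h1.2] at hsymm; linear_combination hsymm) h0
      refine ⟨.inr (.inl (none, x)), exists_tri_mul_eq_mul_simil hp.ne_zero _ _ ?_ ?_⟩
      · intro a b
        simp only [dvd_iff, Matrix.add_apply, mul_apply_two]
        fin_cases a <;> fin_cases b <;>
          simp [triA, triB] at hx₀ hx₁ ⊢
        · linear_combination -hx₀
        · linear_combination -hx₁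
      · intro a b
        simp only [dvd_iff, mul_apply_two]
        fin_cases a <;> fin_cases b <;>
          simp [triD, h1]
  · obtain ⟨j, hj₀, hj₁⟩ := exists_add_mul_eq_zero (p := p) (u₀ := blockD h 0 0)
      (u₁ := blockD h 0 1) (v₀ := blockD h 1 0) (v₁ := blockD h 1 1)
      (by linear_combination hdet') h1
    obtain ⟨x, hx₀, hx₁⟩ := exists_add_mul_eq_zero (p := p)
      (u₀ := blockB h 1 0 - (j : ℤ) * blockB h 0 0)
      (u₁ := blockB h 1 1 - (j : ℤ) * blockB h 0 1) (v₀ := blockD h 1 0) (v₁ := blockD h 1 1)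
      (by linear_combination hsymm - blockB h 0 0 * hj₁ + blockB h 0 1 * hj₀) h1
    refine ⟨.inr (.inl (some j, x)), exists_tri_mul_eq_mul_simil hp.ne_zero _ _ ?_ ?_⟩
    · intro a b
      simp only [dvd_iff, Matrix.add_apply, mul_apply_two]
      fin_cases a <;> fin_cases b <;>
        simp [triA, triB] at hx₀ hx₁ ⊢
      · linear_combination hx₀
      · linear_combination hx₁
    · intro a b
      simp only [dvd_iff, mul_apply_two]
      fin_cases a <;> fin_cases b <;>
        simp [triD] at hj₀ hj₁ ⊢
      · linear_combination hj₀
      · linear_combination hj₁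

/-- All `T_i` have the elementary divisors of `diag(I, pI)`; the two symplectic factors are written
down explicitly. -/
theorem exists_tri_eq {p : ℕ} (i : TriIndex p) :
    ∃ w h : Sp2Z, tri i = (w : Mat4 ℤ) * simil p * (h : Mat4 ℤ) := by
  have key (w h : Sp2Z) (h₁ : triA i = blockA w * blockA h + (p : ℤ) • (blockB w * blockC h))
      (h₂ : triB i = blockA w * blockB h + (p : ℤ) • (blockB w * blockD h))
      (h₃ : 0 = blockC w * blockA h + (p : ℤ) • (blockD w * blockC h))
      (h₄ : triD i = blockC w * blockB h + (p : ℤ) • (blockD w * blockD h)) :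
      tri i = (w : Mat4 ℤ) * simil p * (h : Mat4 ℤ) := by
    rw [mul_simil, coe_eq_fromBlocks h, fromBlocks_multiply, tri, fromBlocks_inj]
    simp only [smul_mul_assoc]
    exact ⟨h₁, h₂, h₃, h₄⟩
  rcases i with _ | ⟨_ | j, x⟩ | ⟨x, y, z⟩
  · refine ⟨ofBlocks 0 1 (-1) 0 (by simp) (by simp) (by simp),
      ofBlocks 0 (-1) 1 0 (by simp) (by simp) (by simp), key _ _ ?_ ?_ ?_ ?_⟩ <;>
      ext a b <;>
      simp only [blockA_ofBlocks, blockB_ofBlocks, blockC_ofBlocks, blockD_ofBlocks,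
        Matrix.add_apply, Matrix.smul_apply, mul_apply_two] <;>
      fin_cases a <;> fin_cases b <;> simp [triA, triB, triD, Matrix.one_apply]
  · refine ⟨ofBlocks !![0, 0; 0, 1] !![1, 0; 0, 0] !![-1, 0; 0, 0] !![0, 0; 0, 1] ?_ ?_ ?_,
      ofBlocks !![0, 0; -1, 0] !![0, -1; -(x : ℤ), 0] !![0, 1; 0, 0] !![0, 0; -1, 0] ?_ ?_ ?_,
      key _ _ ?_ ?_ ?_ ?_⟩ <;>
      ext a b <;>
      simp only [blockA_ofBlocks, blockB_ofBlocks, blockC_ofBlocks, blockD_ofBlocks,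
        Matrix.add_apply, Matrix.smul_apply, Matrix.sub_apply, mul_apply_two, transpose_apply] <;>
      fin_cases a <;> fin_cases b <;> simp [triA, triB, triD]
  · refine ⟨ofBlocks !![0, 0; 0, 1] !![1, 0; 0, 0] !![-1, 0; 0, 0] !![0, 0; 0, 1] ?_ ?_ ?_,
      ofBlocks !![0, 0; -(j : ℤ), 1] !![-1, -(j : ℤ); 0, (x : ℤ)] !![1, 0; 0, 0] !![0, 0; 0, 1]
        ?_ ?_ ?_, key _ _ ?_ ?_ ?_ ?_⟩ <;>
      ext a b <;>
      simp only [blockA_ofBlocks, blockB_ofBlocks, blockC_ofBlocks, blockD_ofBlocks,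
        Matrix.add_apply, Matrix.smul_apply, Matrix.sub_apply, mul_apply_two, transpose_apply] <;>
      fin_cases a <;> fin_cases b <;> simp [triA, triB, triD]
  · refine ⟨1, upper !![(x : ℤ), (y : ℤ); (y : ℤ), (z : ℤ)] ?_, key _ _ ?_ ?_ ?_ ?_⟩ <;>
      ext a b <;>
      simp only [blockA_upper, blockB_upper, blockC_upper, blockD_upper, blockA_one, blockB_one,
        blockC_one, blockD_one, Matrix.add_apply, Matrix.smul_apply, mul_apply_two,
        transpose_apply] <;>
      fin_cases a <;> fin_cases b <;> simp [triA, triB, triD, Matrix.one_apply]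

theorem det_triD_pos {p : ℕ} (hp : p ≠ 0) (i : TriIndex p) : 0 < (triD i).det := by
  rw [det_triD]; positivity

theorem det_triA_ne_zero {p : ℕ} (hp : p ≠ 0) (i : TriIndex p) : (triA i).det ≠ 0 := by
  have := congrArg det (tri_relations i).1
  rw [det_mul, det_transpose, det_smul] at this
  intro h0
  rw [h0, zero_mul] at this
  simp at this
  exact hp (by exact_mod_cast (pow_eq_zero_iff two_ne_zero).1 this.symm)

theorem eq_zero_of_mul_eq_zero {A B : Mat2 ℤ} (hB : B.det ≠ 0) (h : A * B = 0) : A = 0 := by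
  have := congrArg (· * B.adjugate) h
  simp only [Matrix.mul_assoc, mul_adjugate, mul_smul_comm, mul_one, zero_mul] at this
  exact (smul_eq_zero.1 this).resolve_left hB

/-- The representatives are in a Hermite normal form. First, `u` has `C = 0`, and `det D = 1`
because the `T_i` have `det D_i > 0`; so the exponents agree. Within one exponent, comparing entries
shows that corresponding parameters differ by multiples of `p`, and they lie in `[0, p)`. -/
theorem triIndex_eq_of_mul_eq {p : ℕ} (hp : p.Prime) {i i' : TriIndex p} {u : Sp2Z}
    (h : tri i = u * tri i') : i = i' := by
  rw [mul_tri, tri, fromBlocks_inj] at h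
  obtain ⟨hA, hB, hC, hD⟩ := h
  have hCu : blockC u = 0 := eq_zero_of_mul_eq_zero (det_triA_ne_zero hp.ne_zero i') hC.symm
  rw [hCu, zero_mul, zero_add] at hD
  have hdet := congrArg det hD
  rw [det_mul] at hdet
  have hDu : (blockD u).det = 1 := by
    rcases det_blockD_eq_one_or hCu with h | h
    · exact h
    · rw [h] at hdet
      linarith [det_triD_pos hp.ne_zero i, det_triD_pos hp.ne_zero i']
  have hexp : triExp i = triExp i' := by
    rw [hDu, one_mul, det_triD, det_triD] at hdet
    exact Nat.pow_right_injective hp.two_le (by exact_mod_cast hdet)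
  have hAD := (transpose_relations u).2.2
  rw [hCu, transpose_zero, zero_mul, sub_zero] at hAD
  have hp1 (b : ℤ) : (p : ℤ) * b ≠ 1 := fun h => by
    have := Int.isUnit_iff.1 (IsUnit.of_mul_eq_one b h)
    have := hp.two_le
    omega
  have eA (a b) : blockD u 0 a * blockA u 0 b + blockD u 1 a * blockA u 1 b = (1 : Mat2 ℤ) b a := by
    have := congrFun (congrFun hAD b) a
    rw [mul_apply_two, transpose_apply, transpose_apply] at this
    rw [← this]; ring
  have eB (a b) := congrFun (congrFun hB a) b
  have eD (a b) := congrFun (congrFun hD a) b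
  simp only [Matrix.add_apply, mul_apply_two] at eB eD
  have hDu1 : blockD u 0 0 = 1 → blockD u 0 1 = 0 → blockD u 1 0 = 0 → blockD u 1 1 = 1 →
      blockA u 0 0 = 1 ∧ blockA u 0 1 = 0 ∧ blockA u 1 0 = 0 ∧ blockA u 1 1 = 1 := by
    intro h1 h2 h3 h4
    have a00 := eA 0 0
    have a01 := eA 0 1
    have a10 := eA 1 0
    have a11 := eA 1 1
    simp only [h1, h2, h3, h4] at a00 a01 a10 a11
    simp at a00 a01 a10 a11
    exact ⟨a00, a01, a10, a11⟩
  have hp0 : (p : ℤ) ≠ 0 := by exact_mod_cast hp.ne_zero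
  have B00 := eB 0 0
  have B01 := eB 0 1
  have B10 := eB 1 0
  have B11 := eB 1 1
  have D00 := eD 0 0
  have D01 := eD 0 1
  have D10 := eD 1 0
  have D11 := eD 1 1
  rcases i with _ | ⟨_ | j, x⟩ | ⟨x, y, z⟩ <;> rcases i' with _ | ⟨_ | j', x'⟩ | ⟨x', y', z'⟩ <;>
    simp [triExp] at hexp <;> simp [triB, triD] at B00 B01 B10 B11 D00 D01 D10 D11
  · rfl
  · obtain ⟨-, -, -, a11⟩ := hDu1 D01.symm (D00.resolve_right hp.ne_zero) D11.symm
      (mul_right_cancel₀ hp0 (by rw [← D10, one_mul]))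
    rw [fin_eq_of_eq_add_mul (x := x) (y := x') (b := blockB u 1 1)
      (by rw [a11] at B10; linear_combination -B10)]
  · exact absurd (by rw [← D00] at D01; linear_combination -D01) (hp1 (blockD u 0 1))
  · exact absurd (by linear_combination -D00) (hp1 (-blockD u 0 1))
  · have hj : j = j' := fin_eq_of_eq_add_mul (b := blockD u 0 1)
      (by rw [← D00] at D01; linear_combination D01)
    subst hj
    obtain ⟨-, -, -, a11⟩ := hDu1 D00.symm
      (mul_right_cancel₀ hp0 (by rw [← D00] at D01; linear_combination -D01)) D10.symm
      (mul_right_cancel₀ hp0 (by rw [← D10] at D11; linear_combination -D11))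
    rw [fin_eq_of_eq_add_mul (x := x) (y := x') (b := blockB u 1 1)
      (by rw [a11, ← B10] at B11; linear_combination B11)]
  · obtain ⟨a00, a01, a10, a11⟩ := hDu1 (mul_right_cancel₀ hp0 (by rw [← D00, one_mul]))
      (D01.resolve_right hp.ne_zero) (D10.resolve_right hp.ne_zero)
      (mul_right_cancel₀ hp0 (by rw [← D11, one_mul]))
    rw [a00, a01] at B00 B01
    rw [a10, a11] at B11
    rw [fin_eq_of_eq_add_mul (x := x) (y := x') (b := blockB u 0 0) (by linear_combination B00),
      fin_eq_of_eq_add_mul (x := y) (y := y') (b := blockB u 0 1) (by linear_combination B01),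
      fin_eq_of_eq_add_mul (x := z) (y := z') (b := blockB u 1 1) (by linear_combination B11)]

/-! ### The Hecke representatives as cosets of `{B ≡ 0 mod p}` -/

theorem toReal_eq_fromBlocks (g : Sp2Z) : toReal g =
    fromBlocks ((blockA g).map Int.cast) ((blockB g).map Int.cast) ((blockC g).map Int.cast)
      ((blockD g).map Int.cast) := by
  rw [toReal, coe_eq_fromBlocks, fromBlocks_map]

theorem toReal_mul (g h : Sp2Z) : toReal (g * h) = toReal g * toReal h :=
  Matrix.map_mul (f := Int.castRingHom ℝ)

theorem toReal_one : toReal 1 = 1 := Matrix.map_one _ Int.cast_zero Int.cast_one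

theorem det_delta (p : ℕ) : (delta p).det = (p : ℝ) ^ 2 := by
  rw [delta, det_fromBlocks_zero₂₁, det_smul]; simp


/-- Conjugation by `δ` multiplies `B` by `p` and divides `C` by `p`, so `δ Γ_0(N) δ⁻¹ ∩ Γ_0(N)`
consists of the elements of `Γ_0(N)` with `p ∣ B`. -/
theorem exists_conj_delta_iff {N p : ℕ} (hp : p ≠ 0) {g s : Sp2Z} (hg : g ∈ Gamma0 N)
    (hs : s ∈ Gamma0 N) :
    (∃ β ∈ Gamma0 N, toReal g = delta p * toReal β * (delta p)⁻¹ * toReal s) ↔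
      g * s⁻¹ ∈ lowerCongruence p := by
  have hδ : IsUnit (delta p).det := by
    rw [det_delta]; exact (pow_ne_zero 2 (by exact_mod_cast hp)).isUnit
  have key (β : Sp2Z) : toReal g = delta p * toReal β * (delta p)⁻¹ * toReal s ↔
      toReal (g * s⁻¹) * delta p = delta p * toReal β := by
    constructor
    · intro h
      rw [toReal_mul, h, Matrix.mul_assoc _ (toReal s), ← toReal_mul, mul_inv_cancel, toReal_one,
        mul_one, nonsing_inv_mul_cancel_right _ _ hδ]
    · intro h
      rw [← h, mul_nonsing_inv_cancel_right _ _ hδ, ← toReal_mul, inv_mul_cancel_right]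
  have blocks (x β : Sp2Z) : toReal x * delta p = delta p * toReal β ↔
      (blockA x).map (Int.cast : ℤ → ℝ) = (blockA β).map Int.cast ∧
      (blockB x).map (Int.cast : ℤ → ℝ) = (p : ℝ) • (blockB β).map Int.cast ∧
      (p : ℝ) • (blockC x).map (Int.cast : ℤ → ℝ) = (blockC β).map Int.cast ∧
      (blockD x).map (Int.cast : ℤ → ℝ) = (blockD β).map Int.cast := by
    have hp' : (p : ℝ) ≠ 0 := by exact_mod_cast hp
    rw [toReal_eq_fromBlocks, toReal_eq_fromBlocks, delta, fromBlocks_multiply,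
      fromBlocks_multiply, fromBlocks_inj]
    simp only [mul_smul_comm, smul_mul_assoc, mul_one, one_mul, mul_zero, zero_mul, add_zero,
      zero_add]
    exact and_congr_left' (smul_right_injective _ hp').eq_iff
  constructor
  · rintro ⟨β, -, hβ⟩ i j
    have := congrFun (congrFun ((blocks _ _).1 ((key β).1 hβ)).2.1 i) j
    simp only [map_apply, Matrix.smul_apply, smul_eq_mul] at this
    exact ⟨blockB β i j, by exact_mod_cast this⟩
  · intro h
    obtain ⟨β, -, hA, hB, hC, hD⟩ := exists_simil_mul_eq hp h
    have hgs : g * s⁻¹ ∈ congruenceSubgroup N := 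
      mul_mem hg ((congruenceSubgroup N).inv_mem hs)
    refine ⟨β, fun i j => ?_, (key β).2 ((blocks _ _).2 ⟨by rw [hA], ?_, ?_, by rw [hD]⟩)⟩
    · rw [hC, Matrix.smul_apply, smul_eq_mul]
      exact (hgs i j).mul_left _
    · rw [hB]; ext i j
      simp only [map_apply, Matrix.smul_apply, smul_eq_mul, Int.cast_mul, Int.cast_natCast]
    · rw [hC]; ext i j
      simp only [map_apply, Matrix.smul_apply, smul_eq_mul, Int.cast_mul, Int.cast_natCast]

/-- Two elements of a set of Hecke representatives coincide if they differ by an element of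
`{B ≡ 0 mod p}`, and every coset of that group is represented. -/
theorem IsHeckeReps.eq_of_mem {N p : ℕ} {S : Set Sp2Z} (hS : IsHeckeReps N p S) (hp : p ≠ 0)
    {s t : Sp2Z} (hs : s ∈ S) (ht : t ∈ S) (h : s * t⁻¹ ∈ lowerCongruence p) : s = t := by
  have hsN := hS.1 hs
  refine (hS.2 s hsN).unique ⟨hs, ?_⟩ ⟨ht, ?_⟩
  · rw [exists_conj_delta_iff hp hsN hsN, mul_inv_cancel]; exact one_mem _
  · rwa [exists_conj_delta_iff hp hsN (hS.1 ht)]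

theorem IsHeckeReps.exists_mem {N p : ℕ} {S : Set Sp2Z} (hS : IsHeckeReps N p S) (hp : p.Prime)
    (hpN : ¬ p ∣ N) (h : Sp2Z) : ∃ s ∈ S, h * s⁻¹ ∈ lowerCongruence p := by
  obtain ⟨t, ht, hht⟩ := exists_mul_inv_mem_lowerCongruence hp hpN h
  obtain ⟨s, ⟨hs, hst⟩, -⟩ := hS.2 t ht
  rw [exists_conj_delta_iff hp.ne_zero ht (hS.1 hs)] at hst
  refine ⟨s, hs, ?_⟩
  have := mul_mem hht hst
  rwa [← mul_assoc, inv_mul_cancel_right] at this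

/-! ### The Hecke correspondence on cosets -/

/-- The relation `T_i g' = g diag(I, pI) s` between integral similitudes, `T_i` one of the upper
triangular representatives. -/
def HeckeRel (p : ℕ) (i : TriIndex p) (g' g s : Sp2Z) : Prop :=
  tri i * (g' : Mat4 ℤ) = g * simil p * (s : Mat4 ℤ)

theorem coe_mul_inv_self (g : Sp2Z) : (g : Mat4 ℤ) * ((g⁻¹ : Sp2Z) : Mat4 ℤ) = 1 := by
  rw [← Submonoid.coe_mul, mul_inv_cancel]; rfl

theorem coe_inv_mul_self (g : Sp2Z) : ((g⁻¹ : Sp2Z) : Mat4 ℤ) * (g : Mat4 ℤ) = 1 := by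
  rw [← Submonoid.coe_mul, inv_mul_cancel]; rfl

theorem exists_heckeRel {p : ℕ} (hp : p.Prime) (g' s : Sp2Z) : ∃ i g, HeckeRel p i g' g s := by
  obtain ⟨i, y, h⟩ := exists_tri_mul_eq hp (g' * s⁻¹)
  refine ⟨i, y, ?_⟩
  rw [HeckeRel, ← h, Submonoid.coe_mul, Matrix.mul_assoc, Matrix.mul_assoc, coe_inv_mul_self,
    mul_one]

/-- Write `T_i = w diag(I, pI) h` and choose `s` in the coset of `h g'`; the remaining factor has `p
∣ B` and moves to the left of `diag(I, pI)`. -/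
theorem IsHeckeReps.exists_heckeRel {N p : ℕ} {S : Set Sp2Z} (hS : IsHeckeReps N p S)
    (hp : p.Prime) (hpN : ¬ p ∣ N) (i : TriIndex p) (g' : Sp2Z) :
    ∃ s ∈ S, ∃ g, HeckeRel p i g' g s := by
  obtain ⟨w, h, hw⟩ := exists_tri_eq i
  obtain ⟨s, hs, hhs⟩ := hS.exists_mem hp hpN (h * g')
  obtain ⟨y, hy, -⟩ := exists_simil_mul_eq hp.ne_zero hhs
  refine ⟨s, hs, w * y, ?_⟩
  have e : ((h * g' * s⁻¹ : Sp2Z) : Mat4 ℤ) * (s : Mat4 ℤ) = h * (g' : Mat4 ℤ) := by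
    rw [← Submonoid.coe_mul, ← Submonoid.coe_mul, inv_mul_cancel_right]
  calc tri i * (g' : Mat4 ℤ) = w * (simil p * (h * (g' : Mat4 ℤ))) := by
        rw [hw]; simp only [Matrix.mul_assoc]
    _ = w * ((simil p * ((h * g' * s⁻¹ : Sp2Z) : Mat4 ℤ)) * (s : Mat4 ℤ)) := by
        rw [Matrix.mul_assoc, e]
    _ = _ := by
        rw [hy, Submonoid.coe_mul]; simp only [Matrix.mul_assoc]

/-- Conjugation by `diag(I, pI)` takes `s₁ s₂⁻¹` to the integral matrix `g₁⁻¹ g₂`. With distinct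
representatives in distinct cosets, this makes `s ↦ i` injective. -/
theorem HeckeRel.mem_lowerCongruence {p : ℕ} {i : TriIndex p} {g' g₁ g₂ s₁ s₂ : Sp2Z}
    (h₁ : HeckeRel p i g' g₁ s₁) (h₂ : HeckeRel p i g' g₂ s₂) :
    s₁ * s₂⁻¹ ∈ lowerCongruence p := by
  refine mem_lowerCongruence_of_simil_mul_eq (g' := g₁⁻¹ * g₂) ?_
  have h : (g₁ : Mat4 ℤ) * simil p * (s₁ : Mat4 ℤ) = g₂ * simil p * (s₂ : Mat4 ℤ) :=
    h₁.symm.trans h₂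
  calc simil p * ((s₁ * s₂⁻¹ : Sp2Z) : Mat4 ℤ)
      = (((g₁⁻¹ : Sp2Z) : Mat4 ℤ) * g₁) * simil p * s₁ * ((s₂⁻¹ : Sp2Z) : Mat4 ℤ) := by
        rw [coe_inv_mul_self, one_mul, Submonoid.coe_mul, Matrix.mul_assoc]
    _ = ((g₁⁻¹ : Sp2Z) : Mat4 ℤ) * (g₁ * simil p * s₁) * ((s₂⁻¹ : Sp2Z) : Mat4 ℤ) := by
        simp only [Matrix.mul_assoc]
    _ = ((g₁⁻¹ : Sp2Z) : Mat4 ℤ) * g₂ * simil p * (s₂ * ((s₂⁻¹ : Sp2Z) : Mat4 ℤ)) := by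
        rw [h]; simp only [Matrix.mul_assoc]
    _ = _ := by rw [coe_mul_inv_self, mul_one, Submonoid.coe_mul]

theorem HeckeRel.tri_eq {p : ℕ} {i₁ i₂ : TriIndex p} {g₁' g₂' g₁ g₂ s : Sp2Z}
    (h₁ : HeckeRel p i₁ g₁' g₁ s) (h₂ : HeckeRel p i₂ g₂' g₂ s) :
    tri i₁ * ((g₁' * g₂'⁻¹ : Sp2Z) : Mat4 ℤ) = ((g₁ * g₂⁻¹ : Sp2Z) : Mat4 ℤ) * tri i₂ := by
  rw [HeckeRel] at h₁ h₂
  calc tri i₁ * ((g₁' * g₂'⁻¹ : Sp2Z) : Mat4 ℤ)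
      = g₁ * simil p * s * ((g₂'⁻¹ : Sp2Z) : Mat4 ℤ) := by
        rw [Submonoid.coe_mul, ← Matrix.mul_assoc, h₁]
    _ = g₁ * (((g₂⁻¹ : Sp2Z) : Mat4 ℤ) * g₂) * simil p * s * ((g₂'⁻¹ : Sp2Z) : Mat4 ℤ) := by
        rw [coe_inv_mul_self, mul_one]
    _ = g₁ * ((g₂⁻¹ : Sp2Z) : Mat4 ℤ) * (g₂ * simil p * s) * ((g₂'⁻¹ : Sp2Z) : Mat4 ℤ) := by
        simp only [Matrix.mul_assoc]
    _ = _ := by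
        rw [← h₂, Matrix.mul_assoc, Matrix.mul_assoc (tri i₂), coe_mul_inv_self, mul_one,
          Submonoid.coe_mul]

theorem HeckeRel.index_eq {p : ℕ} (hp : p.Prime) {i₁ i₂ : TriIndex p} {g' g₁ g₂ s : Sp2Z}
    (h₁ : HeckeRel p i₁ g' g₁ s) (h₂ : HeckeRel p i₂ g' g₂ s) : i₁ = i₂ := by
  refine triIndex_eq_of_mul_eq hp (u := g₁ * g₂⁻¹) ?_
  rw [← h₁.tri_eq h₂, mul_inv_cancel]
  exact (mul_one _).symm

theorem HeckeRel.mem_parabolicPlus {p : ℕ} (hp : p ≠ 0) {i₁ i₂ : TriIndex p}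
    {g₁' g₂' g₁ g₂ s : Sp2Z} (h₁ : HeckeRel p i₁ g₁' g₁ s) (h₂ : HeckeRel p i₂ g₂' g₂ s)
    (hg : g₁ * g₂⁻¹ ∈ parabolicPlus) : g₁' * g₂'⁻¹ ∈ parabolicPlus := by
  have h := h₁.tri_eq h₂
  rw [tri_mul, mul_tri, fromBlocks_inj] at h
  obtain ⟨-, -, hC, hD⟩ := h
  obtain ⟨hgC, hgD⟩ := hg
  rw [hgC, zero_mul] at hC
  rw [hgC, zero_mul, zero_add] at hD
  have hC' : blockC (g₁' * g₂'⁻¹) = 0 := by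
    have := eq_zero_of_mul_eq_zero (A := (blockC (g₁' * g₂'⁻¹))ᵀ) (B := (triD i₁)ᵀ)
      (by rw [det_transpose]; exact (det_triD_pos hp _).ne')
      (by rw [← transpose_mul, hC, transpose_zero])
    exact transpose_eq_zero.1 this
  refine ⟨hC', (det_blockD_eq_one_or hC').resolve_right fun hm => ?_⟩
  have := congrArg det hD
  rw [det_mul, det_mul, hm, hgD] at this
  linarith [det_triD_pos hp i₁, det_triD_pos hp i₂]

theorem mul_simil_injective {p : ℕ} (hp : p ≠ 0) {X Y : Mat4 ℤ} (h : X * simil p = Y * simil p) :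
    X = Y := by
  have e : simil p * fromBlocks ((p : ℤ) • 1) 0 0 1 = (p : ℤ) • (1 : Mat4 ℤ) := by
    rw [simil, fromBlocks_multiply, ← fromBlocks_one, fromBlocks_smul]
    simp
  have h' := congrArg (· * fromBlocks ((p : ℤ) • 1) 0 0 1) h
  simp only [Matrix.mul_assoc, e, mul_smul_comm, mul_one] at h'
  exact smul_right_injective _ (by exact_mod_cast hp : (p : ℤ) ≠ 0) h'

theorem mul_coe_injective (s : Sp2Z) {X Y : Mat4 ℤ} (h : X * (s : Mat4 ℤ) = Y * (s : Mat4 ℤ)) :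
    X = Y := by
  have e := congrArg (· * ((s⁻¹ : Sp2Z) : Mat4 ℤ)) h
  simpa only [Matrix.mul_assoc, coe_mul_inv_self, mul_one] using e

/-- Dual to `exists_heckeRel`: up to `Γ_∞⁺`, every `g` arises from some `g'`. -/
theorem exists_forall_heckeRel {p : ℕ} (hp : p.Prime) (g s : Sp2Z) :
    ∃ g' : Sp2Z, ∀ u ∈ parabolicPlus, ∀ i g₁, HeckeRel p i (u * g') g₁ s →
      g₁ * g⁻¹ ∈ parabolicPlus := by
  -- As `diag(I, pI) w diag(I, pI) = p w`, a triangular reduction of `g w⁻¹` inverts the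
  -- correspondence up to the scalar `p`. The outcome is `T_{i'} u T_i = p g₁ g⁻¹`, whose left side
  -- is block upper triangular with positive determinant of its block `D`.
  set w : Sp2Z := ofBlocks 0 1 (-1) 0 (by simp) (by simp) (by simp) with hw
  have hwp : simil p * (w : Mat4 ℤ) * simil p = (p : ℤ) • (w : Mat4 ℤ) := by
    rw [simil_mul, simil, fromBlocks_multiply, coe_eq_fromBlocks w, fromBlocks_smul]
    simp [hw]
  obtain ⟨i, y, hy⟩ := exists_tri_mul_eq hp (g * w⁻¹)
  have h1 : tri i * (g : Mat4 ℤ) * simil p = (p : ℤ) • (y * (w : Mat4 ℤ)) := by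
    have : tri i * (g : Mat4 ℤ) = tri i * ((g * w⁻¹ : Sp2Z) : Mat4 ℤ) * (w : Mat4 ℤ) := by
      rw [Matrix.mul_assoc, ← Submonoid.coe_mul, inv_mul_cancel_right]
    rw [this, hy, Matrix.mul_assoc, Matrix.mul_assoc, ← Matrix.mul_assoc (simil p), hwp,
      mul_smul_comm]
  refine ⟨y * w * s, fun u hu i' g₁ hrel => ?_⟩
  have h2 : (tri i' * u * tri i) * (g : Mat4 ℤ) = (p : ℤ) • (g₁ : Mat4 ℤ) := by
    refine mul_simil_injective hp.ne_zero (mul_coe_injective s ?_)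
    calc tri i' * (u : Mat4 ℤ) * tri i * (g : Mat4 ℤ) * simil p * (s : Mat4 ℤ)
        = tri i' * (u : Mat4 ℤ) * (tri i * (g : Mat4 ℤ) * simil p) * (s : Mat4 ℤ) := by
          simp only [Matrix.mul_assoc]
      _ = (p : ℤ) • (tri i' * ((u * (y * w * s) : Sp2Z) : Mat4 ℤ)) := by
          rw [h1]
          simp only [Submonoid.coe_mul, mul_smul_comm, smul_mul_assoc, Matrix.mul_assoc]
      _ = _ := by
          rw [show tri i' * _ = _ from hrel]; simp only [smul_mul_assoc]
  have h3 : tri i' * (u : Mat4 ℤ) * tri i = (p : ℤ) • ((g₁ * g⁻¹ : Sp2Z) : Mat4 ℤ) := by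
    refine mul_coe_injective g ?_
    rw [h2, smul_mul_assoc, ← Submonoid.coe_mul, inv_mul_cancel_right]
  obtain ⟨hC, hD⟩ := hu
  rw [tri_mul, tri, fromBlocks_multiply, coe_eq_fromBlocks (g₁ * g⁻¹), fromBlocks_smul,
    fromBlocks_inj] at h3
  obtain ⟨-, -, h3, h4⟩ := h3
  rw [hC, mul_zero, zero_mul, mul_zero, add_zero] at h3
  rw [hC, mul_zero, zero_mul, zero_add] at h4
  have hC' : blockC (g₁ * g⁻¹) = 0 := smul_injective hp.ne_zero (by rw [← h3, smul_zero])
  refine ⟨hC', (det_blockD_eq_one_or hC').resolve_right fun hm => ?_⟩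
  have := congrArg det h4
  rw [det_mul, det_mul, hD, det_smul, hm] at this
  have h5 := mul_pos (det_triD_pos hp.ne_zero i') (det_triD_pos hp.ne_zero i)
  have h6 : 0 < (p : ℤ) ^ Fintype.card (Fin 2) := by have := hp.pos; positivity
  linarith

/-- The correspondence on cosets that is given by `HeckeRel` for a fixed `s`. -/
theorem bijective_of_heckeRel {p : ℕ} (hp : p.Prime) {s : Sp2Z} {idx : Cosets → TriIndex p}
    {img : Cosets → Sp2Z} (h : ∀ c, HeckeRel p (idx c) c.out (img c) s) :
    Function.Bijective fun c => toCoset (img c) := by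
  constructor
  · intro c₁ c₂ hc
    rw [toCoset_eq_iff] at hc
    rw [← toCoset_out c₁, ← toCoset_out c₂, toCoset_eq_iff]
    exact (h c₂).mem_parabolicPlus hp.ne_zero (h c₁) hc
  · intro c
    obtain ⟨g', hg'⟩ := exists_forall_heckeRel hp c.out s
    refine ⟨toCoset g', ?_⟩
    rw [← toCoset_out c, eq_comm, toCoset_eq_iff]
    refine hg' _ (out_mul_inv_mem g') (idx (toCoset g')) _ ?_
    rw [inv_mul_cancel_right]
    exact h _

/-- The correspondence on representatives that is given by `HeckeRel` for a fixed `g'`. -/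
theorem IsHeckeReps.bijective_of_heckeRel {N p : ℕ} {S : Set Sp2Z} (hS : IsHeckeReps N p S)
    (hp : p.Prime) (hpN : ¬ p ∣ N) {g' : Sp2Z} {idx : S → TriIndex p} {img : S → Sp2Z}
    (h : ∀ s, HeckeRel p (idx s) g' (img s) s) : Function.Bijective idx := by
  constructor
  · intro s t hst
    have hs := h s
    rw [hst] at hs
    exact Subtype.ext (hS.eq_of_mem hp.ne_zero s.2 t.2 (hs.mem_lowerCongruence (h t)))
  · intro i
    obtain ⟨s, hs, g, hg⟩ := hS.exists_heckeRel hp hpN i g'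
    exact ⟨⟨s, hs⟩, (h ⟨s, hs⟩).index_eq hp hg⟩

theorem HeckeRel.blocks {p : ℕ} {i : TriIndex p} {g' g s : Sp2Z} (h : HeckeRel p i g' g s) :
    triD i * blockC g' = blockC g * blockA s + (p : ℤ) • (blockD g * blockC s) ∧
    triD i * blockD g' = blockC g * blockB s + (p : ℤ) • (blockD g * blockD s) := by
  rw [HeckeRel, tri_mul, mul_simil, coe_eq_fromBlocks s, fromBlocks_multiply, fromBlocks_inj] at h
  simpa only [smul_mul_assoc] using h.2.2

/-! ### Slash action and the eigenvalue -/

/-- The action of `δ⁻¹ s` on the upper half space. -/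
def heckeAct (p : ℕ) (s : Sp2Z) (τ : Mat2 ℂ) : Mat2 ℂ :=
  (p : ℂ)⁻¹ • (((blockA s).map Int.cast * τ + (blockB s).map Int.cast) *
    ((blockC s).map Int.cast * τ + (blockD s).map Int.cast)⁻¹)

theorem det_toReal (s : Sp2Z) : (toReal s).det = 1 := by
  have h := SymplecticGroup.det_eq_one s.2
  have : (toReal s).det = ((s : Mat4 ℤ).det : ℝ) := ((Int.castRingHom ℝ).map_det (s : Mat4 ℤ)).symm
  rw [this, h, Int.cast_one]

theorem inv_delta {p : ℕ} (hp : p ≠ 0) : (delta p)⁻¹ = fromBlocks ((p : ℝ)⁻¹ • 1) 0 0 1 := by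
  refine inv_eq_left_inv ?_
  have hp' : (p : ℝ) ≠ 0 := by exact_mod_cast hp
  rw [delta, fromBlocks_multiply, ← fromBlocks_one]
  simp [hp']

theorem slash_delta_inv {p : ℕ} (hp : p ≠ 0) (k : ℕ) (s : Sp2Z) (f : Mat2 ℂ → ℂ) (τ : Mat2 ℂ) :
    slash k ((delta p)⁻¹ * toReal s) f τ =
      ((p : ℂ) ^ k)⁻¹ * autFactor s τ ^ (-(k : ℤ)) * f (heckeAct p s τ) := by
  have hp' : (p : ℝ) ≠ 0 := by exact_mod_cast hp
  have hdet : ((delta p)⁻¹ * toReal s).det ^ ((k : ℝ) / 2) = ((p : ℝ) ^ k)⁻¹ := by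
    rw [det_mul, det_toReal, mul_one, det_nonsing_inv, det_delta, Ring.inverse_eq_inv',
      Real.inv_rpow (by positivity), ← Real.rpow_natCast, ← Real.rpow_mul (by positivity)]
    rw [← Real.rpow_natCast]
    congr 2
    push_cast; ring
  have hmap (X : Mat2 ℤ) : (X.map (Int.cast : ℤ → ℝ)).map (fun x : ℝ => (x : ℂ)) =
      X.map Int.cast := by
    ext i j; simp
  have hmap' (X : Mat2 ℤ) : ((p : ℝ)⁻¹ • X.map (Int.cast : ℤ → ℝ)).map (fun x : ℝ => (x : ℂ)) =
      (p : ℂ)⁻¹ • X.map Int.cast := by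
    ext i j; simp
  have hb : (delta p)⁻¹ * toReal s = fromBlocks ((p : ℝ)⁻¹ • (blockA s).map Int.cast)
      ((p : ℝ)⁻¹ • (blockB s).map Int.cast) ((blockC s).map Int.cast)
      ((blockD s).map Int.cast) := by
    rw [inv_delta hp, toReal_eq_fromBlocks, fromBlocks_multiply]
    simp
  rw [slash, hdet, hb]
  simp only [toBlocks_fromBlocks₁₁, toBlocks_fromBlocks₁₂, toBlocks_fromBlocks₂₁,
    toBlocks_fromBlocks₂₂, hmap, hmap', Complex.ofReal_inv, Complex.ofReal_pow,
    Complex.ofReal_natCast, smul_mul_assoc]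
  rw [← smul_add, smul_mul_assoc]
  rfl

/-- The cocycle relation for `T_i g' = g diag(I, pI) s`: applying the lower halves to `(τ; I)` and
taking determinants gives `p²` on one side and `det D_i = p^e` on the other. -/
theorem autFactor_heckeAct {p : ℕ} (hp : p ≠ 0) {i : TriIndex p} {g' g s : Sp2Z}
    (h : HeckeRel p i g' g s) {τ : Mat2 ℂ} (hτ : τ ∈ upperHalf) :
    (p : ℂ) ^ (2 - triExp i) * (autFactor g (heckeAct p s τ) * autFactor s τ) =
      autFactor g' τ := by
  have hp' : (p : ℂ) ≠ 0 := by exact_mod_cast hp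
  have hunit : IsUnit ((blockC s).map (Int.cast : ℤ → ℂ) * τ + (blockD s).map Int.cast).det :=
    (autFactor_ne_zero s hτ).isUnit
  obtain ⟨hC, hD⟩ := h.blocks
  have hC := congrArg (fun X : Mat2 ℤ => X.map (Int.cast : ℤ → ℂ)) hC
  have hD := congrArg (fun X : Mat2 ℤ => X.map (Int.cast : ℤ → ℂ)) hD
  have hsm (X : Mat2 ℤ) : ((p : ℤ) • X).map (Int.cast : ℤ → ℂ) = (p : ℂ) • X.map Int.cast := by
    ext i j
    simp only [map_apply, Matrix.smul_apply, smul_eq_mul, Int.cast_mul, Int.cast_natCast]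
  simp only [map_add_intCast, map_mul_intCast, hsm] at hC hD
  have key : (p : ℂ) • (((blockC g).map (Int.cast : ℤ → ℂ) * heckeAct p s τ +
      (blockD g).map Int.cast) * ((blockC s).map (Int.cast : ℤ → ℂ) * τ +
        (blockD s).map Int.cast)) =
      (triD i).map Int.cast * ((blockC g').map (Int.cast : ℤ → ℂ) * τ +
        (blockD g').map Int.cast) := by
    rw [mul_add ((triD i).map (Int.cast : ℤ → ℂ)), ← Matrix.mul_assoc, hC, hD, add_mul, heckeAct,
      mul_smul_comm, smul_mul_assoc, ← Matrix.mul_assoc, nonsing_inv_mul_cancel_right _ _ hunit,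
      smul_add, smul_smul, mul_inv_cancel₀ hp', one_smul]
    simp only [mul_add, add_mul, smul_add, smul_mul_assoc, Matrix.mul_assoc]
    abel
  have hdet := congrArg det key
  rw [det_smul, det_mul, det_mul, det_map_intCast, det_triD, Fintype.card_fin] at hdet
  change (p : ℂ) ^ 2 * (autFactor g (heckeAct p s τ) * autFactor s τ) =
    _ * autFactor g' τ at hdet
  refine mul_left_cancel₀ (pow_ne_zero (triExp i) hp') ?_
  rw [← mul_assoc, ← pow_add, Nat.add_sub_cancel' (triExp_le i), hdet]
  push_cast
  rfl

namespace CuspDatum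

variable {N N₀ N₁ N₂ : ℕ} {χ : DirichletCharacter ℂ N} {χ₀ : DirichletCharacter ℂ N₀}
    {χ₁ : DirichletCharacter ℂ N₁} {χ₂ : DirichletCharacter ℂ N₂} {d : Fin 2 → ℤ}

theorem cosetTerm_heckeAct (H : CuspDatum N N₀ N₁ N₂ χ χ₀ χ₁ χ₂ d)
    {p : ℕ} (hp : p.Prime) (hpN : ¬ p ∣ N) (k : ℕ) {i : TriIndex p}
    {c : Cosets} {g s : Sp2Z} (hs : s ∈ Gamma0 N) (h : HeckeRel p i c.out g s) {τ : Mat2 ℂ}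
    (hτ : τ ∈ upperHalf) :
    (starRingEnd ℂ) (χ (detD N s)) * autFactor s τ ^ (-(k : ℤ)) *
        cosetTerm N χ k d (heckeAct p s τ) (toCoset g) =
      χ₀ ((p : ZMod N₀) ^ (2 - triExp i)) * χ₁ ((p : ZMod N₁) ^ (1 + triExp i)) *
        χ₂ ((p : ZMod N₂) ^ triExp i) * ((p : ℂ) ^ (2 - triExp i)) ^ k * cosetTerm N χ k d τ c := by
  have hp' : (p : ℂ) ≠ 0 := by exact_mod_cast hp.ne_zero
  have hinv : (p * (p : ZMod N)⁻¹ : ZMod N) = 1 :=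
    ZMod.coe_mul_inv_eq_one p ((hp.coprime_iff_not_dvd).2 hpN)
  obtain ⟨hC, hD⟩ := h.blocks
  have hw := H.weight_mul_conj_char (triExp_le i) hinv (det_triD i) hs hC hD
  rw [H.cosetTerm_toCoset, cosetTerm, ← autFactor_heckeAct hp.ne_zero h hτ]
  have e : ((p : ℂ) ^ (2 - triExp i) * (autFactor g (heckeAct p s τ) * autFactor s τ)) ^ (-(k : ℤ))
      = (((p : ℂ) ^ (2 - triExp i)) ^ k)⁻¹ * (autFactor g (heckeAct p s τ) ^ (-(k : ℤ)) *
        autFactor s τ ^ (-(k : ℤ))) := by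
    rw [mul_zpow, mul_zpow, _root_.zpow_neg ((p : ℂ) ^ _), zpow_natCast]
  rw [e]
  have hpk : ((p : ℂ) ^ (2 - triExp i)) ^ k ≠ 0 := pow_ne_zero _ (pow_ne_zero _ hp')
  calc _ = (weight N χ d g * (starRingEnd ℂ) (χ (detD N s))) *
        (autFactor g (heckeAct p s τ) ^ (-(k : ℤ)) * autFactor s τ ^ (-(k : ℤ))) := by ring
    _ = _ := by
      rw [hw]
      field_simp

theorem heckeT_eisenstein (H : CuspDatum N N₀ N₁ N₂ χ χ₀ χ₁ χ₂ d)
    {k : ℕ} (hk : 4 ≤ k) {R : Set Sp2Z}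
    (hR : IsOrbitReps GammaInfPlus N (cuspMatrix d) R) {p : ℕ} (hp : p.Prime) (hpN : ¬ p ∣ N)
    {S : Set Sp2Z} (hS : IsHeckeReps N p S) {τ : Mat2 ℂ} (hτ : τ ∈ upperHalf) :
    heckeT N χ k p S (eisenstein N χ k (cuspMatrix d) R) τ =
      (χ₀ ((p : ZMod N₀) ^ 2) * χ₁ (p : ZMod N₁) * (p : ℂ) ^ (2 * k - 3) +
        χ₀ (p : ZMod N₀) * χ₂ (p : ZMod N₂) * (p : ℂ) ^ (k - 2) * ((p : ℂ) + 1) +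
        χ₁ (p : ZMod N₁) * χ₂ ((p : ZMod N₂) ^ 2)) *
      eisenstein N χ k (cuspMatrix d) R τ := by
  have hp' : (p : ℂ) ≠ 0 := by exact_mod_cast hp.ne_zero
  choose idx img hrel using fun (s : S) (c : Cosets) => SiegelEis.exists_heckeRel hp c.out s
  have hbij (c : Cosets) : Function.Bijective fun s => idx s c :=
    hS.bijective_of_heckeRel hp hpN fun s => hrel s c
  -- Finiteness turns the `finsum` in `heckeT`, which is `0` by convention for infinite support,
  -- into a genuine sum.
  have hfin : Finite S := Finite.of_injective _ (hbij (toCoset 1)).1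
  have := Fintype.ofFinite S
  set ν : ℕ → ℂ := fun e => χ₀ ((p : ZMod N₀) ^ (2 - e)) * χ₁ ((p : ZMod N₁) ^ (1 + e)) *
        χ₂ ((p : ZMod N₂) ^ e) * ((p : ℂ) ^ (2 - e)) ^ k with hν
  have hterm (s : S) : (starRingEnd ℂ) (χ (detD N s)) *
      slash k ((delta p)⁻¹ * toReal s) (eisenstein N χ k (cuspMatrix d) R) τ =
      ((p : ℂ) ^ k)⁻¹ * (1 / 2) * ∑' c, ν (triExp (idx s c)) * cosetTerm N χ k d τ c := by
    -- Reindexing by the bijection of cosets attached to `s` brings all terms back to the point `τ`.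
    -- Equality holds term by term, so convergence at `heckeAct p s τ` is not an issue.
    rw [slash_delta_inv hp.ne_zero, eisenstein, H.eisSum_eq_tsum k hR,
      ← (Equiv.ofBijective _ (bijective_of_heckeRel hp (hrel s))).tsum_eq]
    have e : ∑' c, ν (triExp (idx s c)) * cosetTerm N χ k d τ c =
        (starRingEnd ℂ) (χ (detD N s)) * autFactor s τ ^ (-(k : ℤ)) *
          ∑' c, cosetTerm N χ k d (heckeAct p s τ) (toCoset (img s c)) := by
      rw [← tsum_mul_left]
      exact tsum_congr fun c => (H.cosetTerm_heckeAct hp hpN k (hS.1 s.2) (hrel s c) hτ).symm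
    rw [e]
    simp only [Equiv.ofBijective_apply]
    ring
  have hsum (s : S) : Summable fun c => ν (triExp (idx s c)) * cosetTerm N χ k d τ c := by
    refine Summable.of_norm_bounded
      ((summable_cosetTerm χ hk d hτ).norm.mul_left (‖ν 0‖ + ‖ν 1‖ + ‖ν 2‖)) fun c => ?_
    rw [norm_mul]
    gcongr
    have h0 := norm_nonneg (ν 0)
    have h1 := norm_nonneg (ν 1)
    have h2 := norm_nonneg (ν 2)
    have := triExp_le (idx s c)
    interval_cases triExp (idx s c) <;> linarith
  have hunit : IsUnit (p : ZMod N₁) :=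
    (ZMod.isUnit_iff_coprime p N₁).2 ((hp.coprime_iff_not_dvd).2 fun h => hpN (h.trans H.dvd₁))
  have hsq := H.char₁_sq hunit
  have hT : heckeT N χ k p S (eisenstein N χ k (cuspMatrix d) R) τ =
      (p : ℂ) ^ ((k : ℤ) - 3) * (((p : ℂ) ^ k)⁻¹ * (1 / 2) *
        ((ν 0 + (p + 1) * p * ν 1 + p ^ 3 * ν 2) * ∑' c, cosetTerm N χ k d τ c)) := by
    rw [heckeT, ← finsum_set_coe_eq_finsum_mem, finsum_eq_sum_of_fintype]
    congr 1
    calc _ = ∑ s : S, ((p : ℂ) ^ k)⁻¹ * (1 / 2) *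
          ∑' c, ν (triExp (idx s c)) * cosetTerm N χ k d τ c :=
          Finset.sum_congr rfl fun s _ => hterm s
      _ = _ := by
        -- After the interchange, the inner sum over `s` at a fixed coset runs once through all
        -- indices, so it is the same constant for every coset.
        rw [← Finset.mul_sum, ← Summable.tsum_finsetSum (s := Finset.univ) (fun s _ => hsum s)]
        congr 1
        rw [← tsum_mul_left]
        refine tsum_congr fun c => ?_
        rw [← Finset.sum_mul, ← sum_triExp ν,
          ← (Equiv.ofBijective _ (hbij c)).sum_comp fun i => ν (triExp i)]
        rfl
  rw [hT, eisenstein, H.eisSum_eq_tsum k hR]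
  -- Removes the truncated subtractions in `2 * k - 3` and `k - 2`. The total normalization is
  -- `p^(k-3) p^(-k) = p^(-3)`.
  obtain ⟨m, rfl⟩ := Nat.exists_eq_add_of_le hk
  have e1 : (p : ℂ) ^ (((4 + m : ℕ) : ℤ) - 3) = p ^ (m + 1) := by
    rw [← zpow_natCast]; congr 1; push_cast; ring
  have e2 : 2 * (4 + m) - 3 = 2 * m + 5 := by omega
  have e3 : 4 + m - 2 = m + 2 := by omega
  rw [e1, e2, e3]
  simp only [hν, map_pow]
  have h2 : χ₁ (p : ZMod N₁) ^ 2 = 1 := by rw [pow_two, hsq]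
  have h3 : χ₁ (p : ZMod N₁) ^ 3 = χ₁ (p : ZMod N₁) := by rw [pow_succ, h2, one_mul]
  norm_num [h2, h3]
  field_simp
  ring

end CuspDatum

end SiegelEis

end

theorem proposition3p3 (N N₀ N₁ N₂ : ℕ) (hN : Squarefree N) (hρ : N₀ * N₁ * N₂ = N)
    (k : ℕ) (hk : 4 ≤ k)
    (χ : DirichletCharacter ℂ N) (χ₀ : DirichletCharacter ℂ N₀)
    (χ₁ : DirichletCharacter ℂ N₁) (χ₂ : DirichletCharacter ℂ N₂)
    (hχ : ∀ a : ℤ, χ (a : ZMod N) = χ₀ (a : ZMod N₀) * χ₁ (a : ZMod N₁) * χ₂ (a : ZMod N₂))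
    (hχ₁ : χ₁ ^ 2 = 1)
    (d : Fin 2 → ℤ) (hd : SiegelEis.IsCuspMatrix N₀ N₁ N₂ d)
    (R : Set SiegelEis.Sp2Z)
    (hR : SiegelEis.IsOrbitReps SiegelEis.GammaInfPlus N (SiegelEis.cuspMatrix d) R)
    (p : ℕ) (hp : p.Prime) (hpN : ¬ p ∣ N)
    (S : Set SiegelEis.Sp2Z) (hS : SiegelEis.IsHeckeReps N p S) :
    -- the series converges absolutely
    (∀ τ ∈ SiegelEis.upperHalf, Summable fun γ : R =>
      SiegelEis.eisTerm N χ k (SiegelEis.cuspMatrix d) τ γ) ∧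
    -- if `χ(-1) = (-1)^k`, it is the sum over the cosets of `Γ_∞`
    (χ (-1) = (-1) ^ k → ∀ R' : Set SiegelEis.Sp2Z,
      SiegelEis.IsOrbitReps SiegelEis.GammaInf N (SiegelEis.cuspMatrix d) R' →
      ∀ τ ∈ SiegelEis.upperHalf,
        SiegelEis.eisenstein N χ k (SiegelEis.cuspMatrix d) R τ =
          SiegelEis.eisSum N χ k (SiegelEis.cuspMatrix d) R' τ) ∧
    -- the action of `T(p)`
    (∀ τ ∈ SiegelEis.upperHalf,
      SiegelEis.heckeT N χ k p S (SiegelEis.eisenstein N χ k (SiegelEis.cuspMatrix d) R) τ =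
        (χ₀ ((p : ZMod N₀) ^ 2) * χ₁ (p : ZMod N₁) * (p : ℂ) ^ (2 * k - 3) +
          χ₀ (p : ZMod N₀) * χ₂ (p : ZMod N₂) * (p : ℂ) ^ (k - 2) * ((p : ℂ) + 1) +
          χ₁ (p : ZMod N₁) * χ₂ ((p : ZMod N₂) ^ 2)) *
        SiegelEis.eisenstein N χ k (SiegelEis.cuspMatrix d) R τ) := by
  have H : SiegelEis.CuspDatum N N₀ N₁ N₂ χ χ₀ χ₁ χ₂ d := ⟨hN, hρ, hχ, hχ₁, hd⟩
  exact ⟨fun τ hτ => H.summable_eisTerm hk hR hτ,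
    fun hχk R' hR' τ hτ => H.eisenstein_eq_eisSum hk hχk hR hR' hτ,
    fun τ hτ => H.heckeT_eisenstein hk hR hp hpN hS hτ⟩
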